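/- **Compilation to public coin.** Let $L=(L_{yes},L_{no})$ be a promise problem over $\{0,1\}^*$ and let $c,s:\mathbb N\to\mathbb R$. A *3-message quantum interactive argument* for $L$ with completeness $c$ and soundness $s$ is a protocol in which the prover sends a quantum message $M_0$, the verifier replies with a quantum message $R$, the prover sends a quantum message $M_1$, and the verifier then measures and accepts or rejects. The verifier is a polynomial-time quantum algorithm (on input $x$ its two circuits, over the gates $X,H,T,T^\dagger$, CNOT, Toffoli, are produced from $x$ by a polynomial-time Turing machine; the same holds for polynomial-time provers), and * (completeness) there is a polynomial-time quantum prover $P$ such that for every $x\in L_{yes}$ there is a quantum advice state $|\psi_x\rangle$ with which $P$ is accepted on input $x$ with probability at least $c(|x|)$; * (soundness) for every polynomial-time quantum prover $P^*$, every $x\in L_{no}$ and every quantum advice state $|\psi_x\rangle$, $P^*$ with $|\psi_x\rangle$ is accepted on input $x$ with probability at most $s(|x|)$. It is *public coin* if the verifier's message $R$ consists of uniformly random coin flips. **Theorem.** If $L$ has a 3-message quantum interactive argument with completeness $c$ and soundness $s$, then $L$ has a 3-message public-coin quantum interactive argument with completeness $1-\frac{1-c}{2}$ and soundness $1-\frac{1-s}{16}$,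 in which the verifier's message is a single coin flip. The same statement holds if, in both arguments, soundness $s$ is required only up to a negligible function, that is, if the soundness condition reads: for every polynomial-time quantum prover $P^*$ there is a negligible function $\nu$ such that for all $x\in L_{no}$ and all advice states, $P^*$ is accepted with probability at most $s(|x|)+\nu(|x|)$. -/

import Mathlib

namespace QIA

/-! ### Qubits and registers -/

/-- The registers of a three-message protocol: `A` is private to the prover; `M₀` is the first
message (prover to verifier); `W` and `E` are private to the verifier; `R` is the second message
(verifier to prover); `M₁` is the third message (prover to verifier). -/
inductive Reg
  | A | M₀ | W | E | R | M₁
  deriving DecidableEq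

/-- The qubits of each register are numbered `0, 1, 2, …`. A protocol involves only finitely many
of them; all qubits that nobody uses are in the state `|0⟩` and play no role. -/
abbrev Wire : Type := Reg × ℕ

/-- A computational basis state, given by the finite set of the qubits that are in state `|1⟩`. -/
abbrev Basis : Type := Finset Wire

/-- A (not necessarily normalised) pure state: a finite superposition of basis states. -/
abbrev Ket : Type := Basis →₀ ℂ

/-- The squared norm of a pure state. -/
noncomputable def normSq (ψ : Ket) : ℝ := ∑ S ∈ ψ.support, ‖ψ S‖ ^ 2

/-! ### Circuits -/

/-- The elementary gates: `X`, Hadamard, `T = diag(1, e^{iπ/4})`, `T†`, `cnot control target` and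
`toffoli control control target`. -/
inductive Gate
  | X (t : Wire)
  | H (t : Wire)
  | T (t : Wire)
  | Tdg (t : Wire)
  | cnot (c t : Wire)
  | toffoli (c₁ c₂ t : Wire)

/-- The qubits on which a gate acts. -/
def Gate.wires : Gate → List Wire
  | .X t => [t]
  | .H t => [t]
  | .T t => [t]
  | .Tdg t => [t]
  | .cnot c t => [c, t]
  | .toffoli c₁ c₂ t => [c₁, c₂, t]

/-- The basis state in which qubit `t` has been flipped. -/
def flip (t : Wire) (S : Basis) : Basis := if t ∈ S then S.erase t else insert t S

/-- The action of a gate on a basis state. -/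
noncomputable def Gate.onBasis : Gate → Basis → Ket
  | .X t, S => Finsupp.single (flip t S) 1
  | .H t, S =>
      Finsupp.single (S.erase t) (1 / (Real.sqrt 2 : ℂ)) +
        Finsupp.single (insert t S) ((if t ∈ S then -1 else 1) / (Real.sqrt 2 : ℂ))
  | .T t, S =>
      Finsupp.single S (if t ∈ S then Complex.exp (Complex.I * (Real.pi : ℂ) / 4) else 1)
  | .Tdg t, S =>
      Finsupp.single S (if t ∈ S then Complex.exp (-(Complex.I * (Real.pi : ℂ) / 4)) else 1)
  | .cnot c t, S => Finsupp.single (if c ∈ S then flip t S else S) 1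
  | .toffoli c₁ c₂ t, S => Finsupp.single (if c₁ ∈ S ∧ c₂ ∈ S then flip t S else S) 1

/-- The linear action of a gate on states. -/
noncomputable def Gate.apply (g : Gate) : Ket →ₗ[ℂ] Ket :=
  Finsupp.linearCombination ℂ g.onBasis

/-- A circuit is a list of gates; the head of the list is applied first. -/
abbrev Circuit : Type := List Gate

/-- The state that a circuit produces from `ψ`. -/
noncomputable def run (C : Circuit) (ψ : Ket) : Ket := C.foldl (fun φ g => g.apply φ) ψ

/-- `C` is a well-formed circuit (the wires of every gate are distinct) which acts only on qubits
of the registers in `regs`. -/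
def ActsOn (C : Circuit) (regs : List Reg) : Prop :=
  ∀ g ∈ C, g.wires.Nodup ∧ ∀ w ∈ g.wires, w.1 ∈ regs

/-! ### Three-message protocols -/

/-- The two circuits of a party in a three-message protocol. -/
structure Party where
  first : Circuit
  second : Circuit

/-- A prover prepares `M₀` with its first circuit and, having received `R`, prepares `M₁` with its
second circuit. -/
def Party.IsProver (P : Party) : Prop :=
  ActsOn P.first [.A, .M₀, .M₁] ∧ ActsOn P.second [.A, .R, .M₁]

/-- A verifier, having received `M₀`, prepares `R` with its first circuit and, having received
`M₁`, applies its second circuit before the final measurement. It keeps `W` and `M₀` between the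
two steps; `E` holds the qubits that it does not access any more (measuring a qubit amounts to
copying it into `E`). -/
def Party.IsVerifier (V : Party) : Prop :=
  ActsOn V.first [.M₀, .W, .E, .R] ∧ ActsOn V.second [.M₀, .W, .M₁]

/-- A unit vector of the prover's private register `A`: every other qubit is in state `|0⟩`. -/
def IsAdvice (ψ : Ket) : Prop :=
  normSq ψ = 1 ∧ ∀ S ∈ ψ.support, ∀ w ∈ S, w.1 = Reg.A

/-- The joint state at the end of the interaction, just before the verifier's measurement. -/
noncomputable def finalState (V P : Party) (ψ : Ket) : Ket :=
  run V.second (run P.second (run V.first (run P.first ψ)))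

/-- The qubit whose computational-basis measurement decides acceptance (outcome `1`). -/
abbrev outWire : Wire := (.W, 0)

/-- The probability that `V` accepts when it interacts with `P`, whose private register starts in
state `ψ`. -/
noncomputable def acceptProb (V P : Party) (ψ : Ket) : ℝ :=
  ∑ S ∈ (finalState V P ψ).support with outWire ∈ S, ‖finalState V P ψ S‖ ^ 2

/-- The circuit that draws `k` uniformly random bits, keeps a copy in `W` and puts a copy into
the message `R`: each bit is the outcome of measuring a qubit of `E` in state `|+⟩`. -/
def coinToss (k : ℕ) : Circuit :=
  (List.range k).flatMap fun i =>
    [.H (.E, i), .cnot (.E, i) (.W, i + 1), .cnot (.E, i) (.R, i)]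

/-- The verifier is public-coin with `k` coins: its only message consists of `k` uniformly random
bits. -/
def Party.SendsCoins (V : Party) (k : ℕ) : Prop := V.first = coinToss k

/-! ### Polynomial-time uniform families -/

/-- The alphabet in which circuits are written down. -/
inductive Token
  | X | H | T | Tdg | cnot | toffoli
  | reg (r : Reg)
  | one
  | sep
  deriving DecidableEq

/-- A wire is written as its register followed by its index in unary. -/
def encodeWire (w : Wire) : List Token := .reg w.1 :: List.replicate w.2 .one

def encodeGate : Gate → List Token
  | .X t => .X :: encodeWire t
  | .H t => .H :: encodeWire t
  | .T t => .T :: encodeWire t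
  | .Tdg t => .Tdg :: encodeWire t
  | .cnot c t => .cnot :: (encodeWire c ++ encodeWire t)
  | .toffoli c₁ c₂ t => .toffoli :: (encodeWire c₁ ++ encodeWire c₂ ++ encodeWire t)

def encodeCircuit (C : Circuit) : List Token := C.flatMap encodeGate

def encodeParty (P : Party) : List Token :=
  encodeCircuit P.first ++ .sep :: encodeCircuit P.second

/-- A family of parties indexed by the input string `x` is polynomial-time if some polynomial-time
deterministic Turing machine computes from `x` the description of the circuits for input `x`. -/
def PolyTime (F : List Bool → Party) : Prop :=
  Nonempty (Turing.TM2ComputableInPolyTime (fun x : List Bool => x) encodeParty F)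

/-- Polynomial-time quantum verifiers. -/
def EfficientVerifier (V : List Bool → Party) : Prop := PolyTime V ∧ ∀ x, (V x).IsVerifier

/-- Polynomial-time quantum provers. -/
def EfficientProver (P : List Bool → Party) : Prop := PolyTime P ∧ ∀ x, (P x).IsProver

/-! ### Arguments -/

/-- A promise decision problem. -/
structure PromiseProblem where
  yes : Set (List Bool)
  no : Set (List Bool)
  disjoint : Disjoint yes no

/-- Completeness `c`: there is a polynomial-time honest prover which, for every yes-instance `x`
and with a suitable advice state, is accepted with probability at least `c(|x|)`. -/
def Complete (L : PromiseProblem) (V : List Bool → Party) (c : ℕ → ℝ) : Prop :=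
  ∃ P, EfficientProver P ∧
    ∀ x ∈ L.yes, ∃ ψ, IsAdvice ψ ∧ c x.length ≤ acceptProb (V x) (P x) ψ

/-- Soundness `s`: every polynomial-time prover, on every no-instance `x` and with every advice
state, is accepted with probability at most `s(|x|)`. -/
def Sound (L : PromiseProblem) (V : List Bool → Party) (s : ℕ → ℝ) : Prop :=
  ∀ P, EfficientProver P →
    ∀ x ∈ L.no, ∀ ψ, IsAdvice ψ → acceptProb (V x) (P x) ψ ≤ s x.length

/-- Soundness `s` up to a negligible function of the input length, which may depend on the
prover. -/
def SoundUpToNegl (L : PromiseProblem) (V : List Bool → Party) (s : ℕ → ℝ) : Prop :=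
  ∀ P, EfficientProver P →
    ∃ ν : ℕ → ℝ, Asymptotics.SuperpolynomialDecay Filter.atTop (fun n : ℕ => (n : ℝ)) ν ∧
      ∀ x ∈ L.no, ∀ ψ, IsAdvice ψ → acceptProb (V x) (P x) ψ ≤ s x.length + ν x.length

/-- `V` is (the verifier of) a three-message quantum interactive argument for `L` with
completeness `c` and soundness `s`. -/
def IsArgument (L : PromiseProblem) (V : List Bool → Party) (c s : ℕ → ℝ) : Prop :=
  EfficientVerifier V ∧ Complete L V c ∧ Sound L V s

/-- The same, with soundness required up to a negligible function. -/
def IsArgumentUpToNegl (L : PromiseProblem) (V : List Bool → Party) (c s : ℕ → ℝ) : Prop :=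
  EfficientVerifier V ∧ Complete L V c ∧ SoundUpToNegl L V s

/-- The verifier is public-coin, and its message is a single coin flip. -/
def IsSingleCoin (V : List Bool → Party) : Prop := ∀ x, (V x).SendsCoins 1

end QIA

/-!
The compiled protocol starts in the middle of the original one. The prover first sends everything
that the verifier `V` holds after having sent its message `R`, namely `M₀`, `W` and `E`. Then a
coin decides which of two tests takes place. On outcome `0` the prover has to answer with `M₁`, and
the second circuit of `V` is run. On outcome `1` the prover has to hand over `R`; the first circuit
of `V` is undone, after which `R` and the private qubits of `V` must turn out to be `0`.
A qubit of the original protocol travels in the place given by `pack`, and the compiled verifier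
is `compile`. Its acceptance probability is the mean of those of the two tests
(`acceptProb_compile`).

Completeness: `honest` simulates the original protocol in the prover's register and passes the
second test with certainty, and the first one with the original probability
(`acceptProb_honest`).

Soundness: let `Q` be a prover for the compiled protocol and `U` the unitary that it applies to
compute its answer. The prover `reduction V Q` runs `Q` up to its answer on outcome `1`, undoes
the first circuit of `V`, and uses the resulting `M₀` as its message. The true verifier then
applies its first circuit to `M₀` and to fresh private qubits; on the part of the state that
passes the check of the second test, this recreates the answer of `Q` on outcome `1`
(`le_acceptProb_reduction`). Having got `R`, the reduction applies `U⁻¹`, replaces the coin by `0`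
and applies `U`, whereby it reaches the state of the first test. If the two tests fail with
probabilities `a` and `b`, the part of the state that is lost has squared norm `b`, so the
reduction is rejected with probability at most `b + 2 a + 2 b`, by the parallelogram inequality.
This is at most six times the rejection probability `(a + b) / 2` of the compiled verifier
(`acceptProb_compile_le`), and `6 ≤ 16`.

The circuits are analysed through three kinds of linear maps: the bit flips `flipL`, the
projections `restrict`, and the renamings `renK` of the qubits. Every gate is a polynomial in flips
and projections to values of single qubits (`Gate.apply_eq`), so a map that is compatible with
these is compatible with circuits (`intertwine_run`). This yields the commutation of circuits on
disjoint qubits, the commutation with projections, and the covariance under renaming; the messages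
are exchanged by circuits that act as renamings (`run_swapCircuit`).

The families of circuits must also be written down by Turing machines in polynomial time. Words
computable in polynomial time are closed under composition (`PolyTimeFun.comp`) and concatenation
(`PolyTimeFun.append`), which is shown by running machines with disjoint stacks one after the
other. The concrete operations on descriptions of circuits are renaming of qubits, inversion,
and loops whose length is that of a computed word; they are carried out by finite transducers and
by small programs with several stacks (`StackProg`).
-/

namespace QIA
open Turing Function

/-! ### Bounded reachability and polynomial-time functions on words -/

/-- `b` is reached from `a` by at most `n` steps of the partial transition function `f`. -/
def ReachesIn {C : Type*} (f : C → Option C) (n : ℕ) (a b : C) : Prop :=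
  ∃ k ≤ n, (_root_.flip bind f)^[k] (some a) = some b

namespace ReachesIn

variable {C : Type*} {f : C → Option C} {n m : ℕ} {a b c : C}

theorem refl (f : C → Option C) (a : C) : ReachesIn f 0 a a := ⟨0, le_rfl, rfl⟩

theorem trans (h₁ : ReachesIn f n a b) (h₂ : ReachesIn f m b c) : ReachesIn f (n + m) a c := by
  obtain ⟨k, hk, e⟩ := h₁
  obtain ⟨l, hl, e'⟩ := h₂
  exact ⟨l + k, by omega, by rw [Function.iterate_add_apply, e, e']⟩

theorem head (h₁ : f a = some b) (h₂ : ReachesIn f n b c) : ReachesIn f (n + 1) a c := by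
  obtain ⟨k, hk, e⟩ := h₂
  refine ⟨k + 1, by omega, ?_⟩
  rw [Function.iterate_succ_apply]
  change (_root_.flip bind f)^[k] (f a) = _
  rw [h₁, e]

theorem mono (h : ReachesIn f n a b) (hnm : n ≤ m) : ReachesIn f m a b := by
  obtain ⟨k, hk, e⟩ := h
  exact ⟨k, hk.trans hnm, e⟩

end ReachesIn

/-- `f` is computed by a multi-stack Turing machine in polynomial time. -/
def PolyTimeFun {α β : Type} (f : List α → List β) : Prop :=
  Nonempty (TM2ComputableInPolyTime (fun x : List α => x) (fun y : List β => y) f)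

theorem polyTime_iff (F : List Bool → Party) :
    PolyTime F ↔ PolyTimeFun fun x => encodeParty (F x) :=
  ⟨fun ⟨h⟩ => ⟨⟨h.toTM2ComputableAux, h.time, h.outputsFun⟩⟩,
    fun ⟨h⟩ => ⟨⟨h.toTM2ComputableAux, h.time, h.outputsFun⟩⟩⟩

/-- The stack contents with `l` on stack `k` and all other stacks empty. -/
def onlyStack {K : Type} [DecidableEq K] {Γ : K → Type} (k : K) (l : List (Γ k)) :
    ∀ k, List (Γ k) :=
  update (fun _ => []) k l

theorem initList_eq (tm : FinTM2) (s : List (tm.Γ tm.k₀)) :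
    initList tm s = ⟨some tm.main, tm.initialState, onlyStack tm.k₀ s⟩ := by
  unfold initList onlyStack
  congr 1
  funext k
  by_cases h : k = tm.k₀
  · subst h; simp
  · simp [h]

theorem haltList_eq (tm : FinTM2) (s : List (tm.Γ tm.k₁)) :
    haltList tm s = ⟨none, tm.initialState, onlyStack tm.k₁ s⟩ := by
  unfold haltList onlyStack
  congr 1
  funext k
  by_cases h : k = tm.k₁
  · subst h; simp
  · simp [h]

/-- The data of a machine computing `f` in polynomial time, with the run described by
`ReachesIn`. -/
theorem polyTimeFun_iff {α β : Type} (f : List α → List β) :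
    PolyTimeFun f ↔ ∃ (tm : FinTM2) (i : tm.Γ tm.k₀ ≃ α) (o : tm.Γ tm.k₁ ≃ β)
      (p : Polynomial ℕ), ∀ x, ReachesIn (TM2.step tm.m) (p.eval x.length)
        ⟨some tm.main, tm.initialState, onlyStack tm.k₀ (x.map i.symm)⟩
        ⟨none, tm.initialState, onlyStack tm.k₁ ((f x).map o.symm)⟩ := by
  constructor
  · rintro ⟨h⟩
    refine ⟨h.tm, h.inputAlphabet, h.outputAlphabet, h.time, fun x => ?_⟩
    obtain ⟨⟨k, e⟩, hk⟩ := h.outputsFun x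
    refine ⟨k, hk, ?_⟩
    rw [initList_eq] at e
    refine e.trans ?_
    rw [Option.map_some, haltList_eq]
    rfl
  · rintro ⟨tm, i, o, p, h⟩
    refine ⟨⟨⟨tm, i, o⟩, p, fun x => ⟨⟨(h x).choose, ?_⟩, (h x).choose_spec.1⟩⟩⟩
    have e := (h x).choose_spec.2
    rw [Option.map_some, haltList_eq]
    refine Eq.trans ?_ e
    rw [initList_eq]
    rfl

/-! ### Running a machine inside a larger one -/

/-- A component `A` of a machine state of type `S`. -/
structure StateLens (S A : Type) where
  get : S → A
  set : A → S → S
  get_set : ∀ a s, get (set a s) = a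
  set_get : ∀ s, set (get s) s = s
  set_set : ∀ a b s, set a (set b s) = set a s

section Embed

variable {K K' : Type} {Γ' : K' → Type} {Λ Λ' σ σ' : Type}

/-- Jump to the label `ex`, or halt if there is none. -/
def exitStmt (ex : Option Λ') : TM2.Stmt Γ' Λ' σ' :=
  match ex with
  | none => .halt
  | some l => .goto fun _ => l

/-- A statement viewed as a statement of a machine with more stacks (`e`), a larger state (`L`) and
more labels (`f`), with halting replaced by a jump to `ex`. -/
def embedStmt (e : K → K') (L : StateLens σ' σ) (f : Λ → Λ') (ex : Option Λ') :
    TM2.Stmt (fun k => Γ' (e k)) Λ σ → TM2.Stmt Γ' Λ' σ'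
  | .push k g q => .push (e k) (fun v => g (L.get v)) (embedStmt e L f ex q)
  | .peek k g q => .peek (e k) (fun v o => L.set (g (L.get v) o) v) (embedStmt e L f ex q)
  | .pop k g q => .pop (e k) (fun v o => L.set (g (L.get v) o) v) (embedStmt e L f ex q)
  | .load g q => .load (fun v => L.set (g (L.get v)) v) (embedStmt e L f ex q)
  | .branch g q₁ q₂ =>
      .branch (fun v => g (L.get v)) (embedStmt e L f ex q₁) (embedStmt e L f ex q₂)
  | .goto g => .goto fun v => f (g (L.get v))
  | .halt => exitStmt ex

variable [DecidableEq K] [DecidableEq K']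

theorem stepAux_exitStmt (ex : Option Λ') (v : σ') (S : ∀ k, List (Γ' k)) :
    TM2.stepAux (exitStmt ex) v S = ⟨ex, v, S⟩ := by
  cases ex <;> rfl

theorem stepAux_embedStmt {e : K → K'} (he : Injective e) (L : StateLens σ' σ) (f : Λ → Λ')
    (ex : Option Λ') (s : TM2.Stmt (fun k => Γ' (e k)) Λ σ) (v : σ') (S : ∀ k, List (Γ' k)) :
    ∃ S', TM2.stepAux (embedStmt e L f ex s) v S =
        ⟨(TM2.stepAux s (L.get v) fun k => S (e k)).l.elim ex (some ∘ f),
          L.set (TM2.stepAux s (L.get v) fun k => S (e k)).var v, S'⟩ ∧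
      (∀ k, S' (e k) = (TM2.stepAux s (L.get v) fun k => S (e k)).stk k) ∧
      ∀ k', (∀ k, e k ≠ k') → S' k' = S k' := by
  have upd : ∀ (T : ∀ k, List (Γ' k)) k l,
      (fun k' => update T (e k) l (e k')) = update (fun k' => T (e k')) k l := by
    intro T k l
    funext k'
    by_cases h : k' = k
    · subst h; simp
    · rw [update_of_ne h, update_of_ne fun h' => h (he h')]
  induction s generalizing v S with
  | push k g q ih =>
    obtain ⟨S', h₁, h₂, h₃⟩ := ih v (update S (e k) (g (L.get v) :: S (e k)))
    rw [upd] at h₁ h₂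
    exact ⟨S', h₁, h₂, fun k' hk => (h₃ k' hk).trans (update_of_ne (hk k).symm _ _)⟩
  | peek k g q ih =>
    obtain ⟨S', h₁, h₂, h₃⟩ := ih (L.set (g (L.get v) (S (e k)).head?) v) S
    rw [L.get_set, L.set_set] at h₁
    rw [L.get_set] at h₂
    exact ⟨S', h₁, h₂, h₃⟩
  | pop k g q ih =>
    obtain ⟨S', h₁, h₂, h₃⟩ := ih (L.set (g (L.get v) (S (e k)).head?) v)
      (update S (e k) (S (e k)).tail)
    rw [L.get_set, L.set_set, upd] at h₁
    rw [L.get_set, upd] at h₂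
    exact ⟨S', h₁, h₂, fun k' hk => (h₃ k' hk).trans (update_of_ne (hk k).symm _ _)⟩
  | load g q ih =>
    obtain ⟨S', h₁, h₂, h₃⟩ := ih (L.set (g (L.get v)) v) S
    rw [L.get_set, L.set_set] at h₁
    rw [L.get_set] at h₂
    exact ⟨S', h₁, h₂, h₃⟩
  | branch g q₁ q₂ ih₁ ih₂ =>
    simp only [embedStmt, TM2.stepAux]
    cases g (L.get v)
    · exact ih₂ v S
    · exact ih₁ v S
  | goto g => exact ⟨S, by simp [embedStmt, L.set_get], fun _ => rfl, fun _ _ => rfl⟩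
  | halt =>
    exact ⟨S, by simp [embedStmt, stepAux_exitStmt, L.set_get], fun _ => rfl, fun _ _ => rfl⟩

/-- A halting run of a machine is also a run of any machine that contains it. -/
theorem reachesIn_embed {e : K → K'} (he : Injective e) (L : StateLens σ' σ) (f : Λ → Λ')
    (ex : Option Λ') (m : Λ → TM2.Stmt (fun k => Γ' (e k)) Λ σ) (m' : Λ' → TM2.Stmt Γ' Λ' σ')
    (hm : ∀ l, m' (f l) = embedStmt e L f ex (m l)) {n : ℕ} {l : Λ} {v : σ'} {w : σ}
    {S : ∀ k, List (Γ' k)} {T T' : ∀ k, List (Γ' (e k))} (hT : ∀ k, S (e k) = T k)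
    (h : ReachesIn (TM2.step m) n ⟨some l, L.get v, T⟩ ⟨none, w, T'⟩) :
    ∃ S', ReachesIn (TM2.step m') n ⟨some (f l), v, S⟩ ⟨ex, L.set w v, S'⟩ ∧
      (∀ k, S' (e k) = T' k) ∧ ∀ k', (∀ k, e k ≠ k') → S' k' = S k' := by
  obtain ⟨k, hk, hkk⟩ := h
  obtain rfl : (fun k => S (e k)) = T := funext hT
  suffices H : ∃ S', (_root_.flip bind (TM2.step m'))^[k] (some ⟨some (f l), v, S⟩) =
      some ⟨ex, L.set w v, S'⟩ ∧
      (∀ k, S' (e k) = T' k) ∧ ∀ k', (∀ k, e k ≠ k') → S' k' = S k' by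
    obtain ⟨S', h₁, h₂⟩ := H
    exact ⟨S', ⟨k, hk, h₁⟩, h₂⟩
  clear hk
  induction k generalizing l v S with
  | zero => simp at hkk
  | succ k ih =>
    obtain ⟨S₁, h₁, h₂, h₃⟩ := stepAux_embedStmt he L f ex (m l) v S
    rw [iterate_succ_apply] at hkk
    change (_root_.flip bind (TM2.step m))^[k]
      (some (TM2.stepAux (m l) (L.get v) fun k => S (e k))) = _ at hkk
    have e₁ : _root_.flip bind (TM2.step m') (some ⟨some (f l), v, S⟩) =
        some (TM2.stepAux (m' (f l)) v S) := rfl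
    rw [iterate_succ_apply, e₁, hm, h₁]
    generalize TM2.stepAux (m l) (L.get v) (fun k => S (e k)) = c at *
    obtain ⟨_ | l', w', T₁⟩ := c
    · have halt_eq : ∀ j, (_root_.flip bind (TM2.step m))^[j + 1] (some ⟨none, w', T₁⟩) = none := by
        intro j
        rw [iterate_succ_apply]
        change (_root_.flip bind (TM2.step m))^[j] none = none
        exact iterate_fixed rfl j
      cases k with
      | succ j => rw [halt_eq] at hkk; cases hkk
      | zero =>
        simp only [iterate_zero, id, Option.some.injEq, TM2.Cfg.mk.injEq, true_and] at hkk
        obtain ⟨rfl, rfl⟩ := hkk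
        exact ⟨S₁, rfl, h₂, h₃⟩
    · obtain rfl : (fun k => S₁ (e k)) = T₁ := funext h₂
      obtain ⟨S', g₁, g₂, g₃⟩ := @ih l' (L.set w' v) S₁ (fun _ => rfl)
        (by rw [L.get_set]; exact hkk)
      rw [L.set_set] at g₁
      exact ⟨S', g₁, g₂, fun k' hk' => (g₃ k' hk').trans (h₃ k' hk')⟩

end Embed

/-! ### Moving a stack -/

section Move

variable {K : Type} [DecidableEq K] {Γ : K → Type} {Λ σ γ : Type} [Inhabited γ]

/-- One round of the loop `l` that pops `a` and pushes the symbol (recoded by `r` and `w`) on each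
of the stacks `b ∈ bs`; when `a` is empty the loop ends with a jump to `ex`. -/
def moveStmt (L : StateLens σ (Option γ)) (a : K) (r : Γ a → γ)
    (bs : List ((b : K) × (γ → Γ b))) (l : Λ) (ex : Option Λ) : TM2.Stmt Γ Λ σ :=
  .pop a (fun v o => L.set (o.map r) v) <|
    .branch (fun v => (L.get v).isSome)
      (bs.foldr (fun b q => .push b.1 (fun v => b.2 ((L.get v).getD default)) q)
        (.load (L.set none) (.goto fun _ => l)))
      (exitStmt ex)

theorem reachesIn_move (L : StateLens σ (Option γ)) {a : K} {r : Γ a → γ} {b : K}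
    {w : γ → Γ b} (hab : a ≠ b) {l : Λ} {ex : Option Λ} {m : Λ → TM2.Stmt Γ Λ σ}
    (hm : m l = moveStmt L a r [⟨b, w⟩] l ex) {v : σ} (hv : L.get v = none)
    {S T : ∀ k, List (Γ k)} (x : List γ) (hx : (S a).map r = x) (hTa : T a = [])
    (hTb : T b = (x.map w).reverse ++ S b) (hT : ∀ k, k ≠ a → k ≠ b → T k = S k) :
    ReachesIn (TM2.step m) (x.length + 1) ⟨some l, v, S⟩ ⟨ex, v, T⟩ := by
  have hset : L.set none v = v := by rw [← hv, L.set_get]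
  induction x generalizing S with
  | nil =>
    have hl : S a = [] := List.map_eq_nil_iff.1 hx
    obtain rfl : T = S := by
      funext k
      by_cases h1 : k = a
      · subst h1; rw [hl, hTa]
      by_cases h2 : k = b
      · subst h2; simpa using hTb
      exact hT k h1 h2
    refine ReachesIn.head ?_ (ReachesIn.refl _ _)
    simp only [TM2.step, hm, moveStmt, TM2.stepAux, hl, List.head?_nil, Option.map_none,
      Option.isSome_none, cond_false, stepAux_exitStmt, hset, hv, List.tail_nil]
    rw [← hl, update_eq_self]
  | cons s x ih =>
    obtain ⟨s, t, hl, rfl, rfl⟩ := List.map_eq_cons_iff.1 hx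
    refine ReachesIn.head (f := TM2.step m) (a := ⟨some l, v, S⟩) ?_
      (ih (S := update (update S a t) b (w (r s) :: S b)) ?_ ?_ ?_)
    · simp only [TM2.step, hm, moveStmt, TM2.stepAux, hl, List.head?_cons, Option.map_some,
        L.get_set, Option.isSome_some, cond_true, List.tail_cons, List.foldr_cons, List.foldr_nil,
        Option.getD_some, L.set_set, hset, update_of_ne hab.symm]
    · simp [update_of_ne hab]
    · simp [hTb]
    · intro k h1 h2
      simp [hT k h1 h2, h1, h2]

theorem reachesIn_move₂ (L : StateLens σ (Option γ)) {a : K} {r : Γ a → γ} {b c : K}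
    {w : γ → Γ b} {w' : γ → Γ c} (hab : a ≠ b) (hac : a ≠ c) (hbc : b ≠ c) {l : Λ}
    {ex : Option Λ} {m : Λ → TM2.Stmt Γ Λ σ}
    (hm : m l = moveStmt L a r [⟨b, w⟩, ⟨c, w'⟩] l ex) {v : σ} (hv : L.get v = none)
    {S T : ∀ k, List (Γ k)} (x : List γ) (hx : (S a).map r = x) (hTa : T a = [])
    (hTb : T b = (x.map w).reverse ++ S b) (hTc : T c = (x.map w').reverse ++ S c)
    (hT : ∀ k, k ≠ a → k ≠ b → k ≠ c → T k = S k) :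
    ReachesIn (TM2.step m) (x.length + 1) ⟨some l, v, S⟩ ⟨ex, v, T⟩ := by
  have hset : L.set none v = v := by rw [← hv, L.set_get]
  induction x generalizing S with
  | nil =>
    have hl : S a = [] := List.map_eq_nil_iff.1 hx
    obtain rfl : T = S := by
      funext k
      by_cases h1 : k = a
      · subst h1; rw [hl, hTa]
      by_cases h2 : k = b
      · subst h2; simpa using hTb
      by_cases h3 : k = c
      · subst h3; simpa using hTc
      exact hT k h1 h2 h3
    refine ReachesIn.head ?_ (ReachesIn.refl _ _)
    simp only [TM2.step, hm, moveStmt, TM2.stepAux, hl, List.head?_nil, Option.map_none,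
      Option.isSome_none, cond_false, stepAux_exitStmt, hset, hv, List.tail_nil]
    rw [← hl, update_eq_self]
  | cons s x ih =>
    obtain ⟨s, t, hl, rfl, rfl⟩ := List.map_eq_cons_iff.1 hx
    refine ReachesIn.head (f := TM2.step m) (a := ⟨some l, v, S⟩) ?_
      (ih (S := update (update (update S a t) b (w (r s) :: S b)) c (w' (r s) :: S c)) ?_ ?_ ?_ ?_)
    · simp only [TM2.step, hm, moveStmt, TM2.stepAux, hl, List.head?_cons, Option.map_some,
        L.get_set, Option.isSome_some, cond_true, List.tail_cons, List.foldr_cons, List.foldr_nil,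
        Option.getD_some, L.set_set, hset, update_of_ne hab.symm, update_of_ne hac.symm,
        update_of_ne hbc.symm]
    · simp [update_of_ne hab, update_of_ne hac]
    · simp [hTb, update_of_ne hbc]
    · simp [hTc]
    · intro k h1 h2 h3
      simp [hT k h1 h2 h3, h1, h2, h3]

end Move

/-! ### Composition and concatenation of polynomial-time functions -/

theorem eval_mono (p : Polynomial ℕ) {a b : ℕ} (h : a ≤ b) : p.eval a ≤ p.eval b := by
  rw [Polynomial.eval_eq_sum_range, Polynomial.eval_eq_sum_range]
  gcongr

/-- An upper bound for the number of symbols that a statement pushes. -/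
def pushCount {K : Type} {Γ : K → Type} {Λ σ : Type} : TM2.Stmt Γ Λ σ → ℕ
  | .push _ _ q => pushCount q + 1
  | .peek _ _ q => pushCount q
  | .pop _ _ q => pushCount q
  | .load _ q => pushCount q
  | .branch _ q₁ q₂ => max (pushCount q₁) (pushCount q₂)
  | .goto _ => 0
  | .halt => 0

theorem length_stepAux_le {K : Type} [DecidableEq K] {Γ : K → Type} {Λ σ : Type}
    (s : TM2.Stmt Γ Λ σ) (v : σ) (S : ∀ k, List (Γ k)) (k : K) :
    ((TM2.stepAux s v S).stk k).length ≤ (S k).length + pushCount s := by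
  induction s generalizing v S with
  | push a g q ih =>
    refine (ih _ _).trans ?_
    by_cases h : k = a
    · subst h; simp [pushCount]; omega
    · simp [pushCount, h]
  | peek a g q ih => exact ih _ _
  | pop a g q ih =>
    refine (ih _ _).trans ?_
    by_cases h : k = a
    · subst h; simp [pushCount]
    · simp [pushCount, h]
  | load g q ih => exact ih _ _
  | branch g q₁ q₂ ih₁ ih₂ =>
    simp only [TM2.stepAux, pushCount]
    cases g v
    · exact (ih₂ _ _).trans (by simp)
    · exact (ih₁ _ _).trans (by simp)
  | goto g => simp [pushCount]
  | halt => simp [pushCount]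

theorem exists_length_bound {K : Type} [DecidableEq K] {Γ : K → Type} {Λ σ : Type} [Fintype Λ]
    (m : Λ → TM2.Stmt Γ Λ σ) : ∃ C, ∀ n a b, ReachesIn (TM2.step m) n a b →
      ∀ k, (b.stk k).length ≤ (a.stk k).length + C * n := by
  refine ⟨Finset.univ.sup fun l => pushCount (m l), ?_⟩
  rintro n a b ⟨j, hj, e⟩ k
  suffices H : (b.stk k).length ≤ (a.stk k).length +
      (Finset.univ.sup fun l => pushCount (m l)) * j from H.trans (by gcongr)
  clear hj
  induction j generalizing a with
  | zero =>
    simp only [iterate_zero, id, Option.some.injEq] at e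
    simp [e]
  | succ j ih =>
    rw [iterate_succ_apply] at e
    change (_root_.flip bind (TM2.step m))^[j] (TM2.step m a) = _ at e
    cases hs : TM2.step m a with
    | none =>
      rw [hs, show (_root_.flip bind (TM2.step m))^[j] none = none from iterate_fixed rfl j] at e
      cases e
    | some c =>
      rw [hs] at e
      refine (ih c e).trans ?_
      obtain ⟨_ | l, v, S⟩ := a
      · cases hs
      · simp only [TM2.step, Option.some.injEq] at hs
        have h₁ := length_stepAux_le (m l) v S k
        have h₂ : pushCount (m l) ≤ Finset.univ.sup fun l => pushCount (m l) :=
          Finset.le_sup (f := fun l => pushCount (m l)) (Finset.mem_univ l)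
        rw [hs] at h₁
        simp only [mul_add, mul_one]
        omega

/-- The output of a polynomial-time function has polynomial length. -/
theorem exists_output_bound (tm : FinTM2) {α β : Type} (f : List α → List β) (i : tm.Γ tm.k₀ ≃ α)
    (o : tm.Γ tm.k₁ ≃ β) (p : Polynomial ℕ)
    (h : ∀ x, ReachesIn (TM2.step tm.m) (p.eval x.length)
        ⟨some tm.main, tm.initialState, onlyStack tm.k₀ (x.map i.symm)⟩
        ⟨none, tm.initialState, onlyStack tm.k₁ ((f x).map o.symm)⟩) :
    ∃ q : Polynomial ℕ, ∀ x, (f x).length ≤ q.eval x.length := by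
  have := tm.ΛFin
  obtain ⟨C, hC⟩ := exists_length_bound tm.m
  refine ⟨Polynomial.X + Polynomial.C C * p, fun x => ?_⟩
  have := hC _ _ _ (h x) tm.k₁
  simp only [onlyStack, update_self, List.length_map] at this
  simp only [Polynomial.eval_add, Polynomial.eval_X, Polynomial.eval_mul, Polynomial.eval_C]
  refine this.trans ?_
  gcongr
  by_cases hk : tm.k₁ = tm.k₀
  · generalize tm.k₁ = k at hk
    subst hk; simp
  · simp [hk]

theorem onlyStack_self {K : Type} [DecidableEq K] {Γ : K → Type} (k : K) (l : List (Γ k)) :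
    onlyStack k l k = l := update_self _ _ _

theorem onlyStack_of_ne {K : Type} [DecidableEq K] {Γ : K → Type} {k k' : K} (h : k' ≠ k)
    (l : List (Γ k)) : onlyStack k l k' = [] := update_of_ne h _ _

theorem map_reverse_reverse {α β : Type} (h : α → β) (x : List α) :
    (x.reverse.map h).reverse = x.map h := by
  rw [← List.map_reverse, List.reverse_reverse]

/-- The stacks of two machines together with auxiliary stacks. -/
def joinStacks {K₁ K₂ J : Type} {Γ₁ : K₁ → Type} {Γ₂ : K₂ → Type} {Δ : J → Type}
    (S₁ : ∀ k, List (Γ₁ k)) (S₂ : ∀ k, List (Γ₂ k)) (T : ∀ j, List (Δ j)) :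
    ∀ k : K₁ ⊕ (K₂ ⊕ J), List (Sum.elim Γ₁ (Sum.elim Γ₂ Δ) k)
  | .inl k => S₁ k
  | .inr (.inl k) => S₂ k
  | .inr (.inr j) => T j

section JoinStacks

variable {K₁ K₂ J : Type} [DecidableEq K₁] [DecidableEq K₂] [DecidableEq J]
  {Γ₁ : K₁ → Type} {Γ₂ : K₂ → Type} {Δ : J → Type}

theorem onlyStack_eq_joinStacks₁ (k : K₁) (l : List (Γ₁ k)) :
    onlyStack (Γ := Sum.elim Γ₁ (Sum.elim Γ₂ Δ)) (.inl k) l =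
      joinStacks (onlyStack k l) (fun _ => []) fun _ => [] := by
  funext k'
  rcases k' with k' | k' | k'
  · by_cases h : k' = k
    · subst h
      exact (onlyStack_self _ _).trans (onlyStack_self _ _).symm
    · exact (onlyStack_of_ne (fun h' => h (Sum.inl_injective h')) _).trans
        (onlyStack_of_ne h _).symm
  · exact onlyStack_of_ne Sum.inr_ne_inl _
  · exact onlyStack_of_ne Sum.inr_ne_inl _

theorem onlyStack_eq_joinStacks₂ (k : K₂) (l : List (Γ₂ k)) :
    onlyStack (Γ := Sum.elim Γ₁ (Sum.elim Γ₂ Δ)) (.inr (.inl k)) l =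
      joinStacks (fun _ => []) (onlyStack k l) fun _ => [] := by
  funext k'
  rcases k' with k' | k' | k'
  · exact onlyStack_of_ne Sum.inl_ne_inr _
  · by_cases h : k' = k
    · subst h
      exact (onlyStack_self _ _).trans (onlyStack_self _ _).symm
    · exact (onlyStack_of_ne (fun h' => h (Sum.inl_injective (Sum.inr_injective h'))) _).trans
        (onlyStack_of_ne h _).symm
  · exact onlyStack_of_ne (fun h => Sum.inr_ne_inl (Sum.inr_injective h)) _

theorem onlyStack_eq_joinStacks₃ (j : J) (l : List (Δ j)) :
    onlyStack (Γ := Sum.elim Γ₁ (Sum.elim Γ₂ Δ)) (.inr (.inr j)) l =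
      joinStacks (fun _ => []) (fun _ => []) (onlyStack j l) := by
  funext k'
  rcases k' with k' | k' | k'
  · exact onlyStack_of_ne Sum.inl_ne_inr _
  · exact onlyStack_of_ne (fun h => Sum.inl_ne_inr (Sum.inr_injective h)) _
  · by_cases h : k' = j
    · subst h
      exact (onlyStack_self _ _).trans (onlyStack_self _ _).symm
    · exact (onlyStack_of_ne (fun h' => h (Sum.inr_injective (Sum.inr_injective h'))) _).trans
        (onlyStack_of_ne h _).symm

variable {Λ Λ' σ σ' : Type}

/-- A run of the first machine inside the joint machine. -/
theorem reachesIn_joinStacks₁ (L : StateLens σ' σ) (f : Λ → Λ') (ex : Option Λ')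
    (m : Λ → TM2.Stmt Γ₁ Λ σ) (m' : Λ' → TM2.Stmt (Sum.elim Γ₁ (Sum.elim Γ₂ Δ)) Λ' σ')
    (hm : ∀ l, m' (f l) = embedStmt (Γ' := Sum.elim Γ₁ (Sum.elim Γ₂ Δ)) Sum.inl L f ex (m l))
    {n : ℕ} {l : Λ} {v : σ'} {S S' : ∀ k, List (Γ₁ k)}
    (h : ReachesIn (TM2.step m) n ⟨some l, L.get v, S⟩ ⟨none, L.get v, S'⟩)
    (S₂ : ∀ k, List (Γ₂ k)) (T : ∀ j, List (Δ j)) :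
    ReachesIn (TM2.step m') n ⟨some (f l), v, joinStacks S S₂ T⟩ ⟨ex, v, joinStacks S' S₂ T⟩ := by
  obtain ⟨U, h₁, h₂, h₃⟩ := reachesIn_embed (Γ' := Sum.elim Γ₁ (Sum.elim Γ₂ Δ))
    Sum.inl_injective L f ex m m' hm (S := joinStacks S S₂ T) (fun _ => rfl) h
  rw [L.set_get] at h₁
  obtain rfl : U = joinStacks S' S₂ T := by
    funext k
    rcases k with k | k | k
    · exact h₂ k
    · exact h₃ _ fun _ => Sum.inl_ne_inr
    · exact h₃ _ fun _ => Sum.inl_ne_inr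
  exact h₁

/-- A run of the second machine inside the joint machine. -/
theorem reachesIn_joinStacks₂ (L : StateLens σ' σ) (f : Λ → Λ') (ex : Option Λ')
    (m : Λ → TM2.Stmt Γ₂ Λ σ) (m' : Λ' → TM2.Stmt (Sum.elim Γ₁ (Sum.elim Γ₂ Δ)) Λ' σ')
    (hm : ∀ l, m' (f l) = embedStmt (Γ' := Sum.elim Γ₁ (Sum.elim Γ₂ Δ))
      (fun k => Sum.inr (Sum.inl k)) L f ex (m l))
    {n : ℕ} {l : Λ} {v : σ'} {S S' : ∀ k, List (Γ₂ k)}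
    (h : ReachesIn (TM2.step m) n ⟨some l, L.get v, S⟩ ⟨none, L.get v, S'⟩)
    (S₁ : ∀ k, List (Γ₁ k)) (T : ∀ j, List (Δ j)) :
    ReachesIn (TM2.step m') n ⟨some (f l), v, joinStacks S₁ S T⟩ ⟨ex, v, joinStacks S₁ S' T⟩ := by
  obtain ⟨U, h₁, h₂, h₃⟩ := reachesIn_embed (Γ' := Sum.elim Γ₁ (Sum.elim Γ₂ Δ))
    (Sum.inr_injective.comp Sum.inl_injective) L f ex m m' hm (S := joinStacks S₁ S T)
    (fun _ => rfl) h
  rw [L.set_get] at h₁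
  obtain rfl : U = joinStacks S₁ S' T := by
    funext k
    rcases k with k | k | k
    · exact h₃ _ fun _ => Sum.inr_ne_inl
    · exact h₂ k
    · exact h₃ _ fun _ h => Sum.inl_ne_inr (Sum.inr_injective h)
  exact h₁

end JoinStacks

/-- The composition of polynomial-time functions is polynomial-time. -/
theorem PolyTimeFun.comp {α β γ : Type} [Fintype β] [Inhabited β] {g : List β → List γ}
    {f : List α → List β} (hg : PolyTimeFun g) (hf : PolyTimeFun f) :
    PolyTimeFun fun x => g (f x) := by
  rw [polyTimeFun_iff] at hf hg ⊢
  obtain ⟨M₁, i₁, o₁, p₁, h₁⟩ := hf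
  obtain ⟨M₂, i₂, o₂, p₂, h₂⟩ := hg
  obtain ⟨q, hq⟩ := exists_output_bound M₁ f i₁ o₁ p₁ h₁
  have := M₁.kFin
  have := M₂.kFin
  have := M₁.ΛFin
  have := M₂.ΛFin
  have := M₁.σFin
  have := M₂.σFin
  have := M₁.Γk₀Fin
  let K := M₁.K ⊕ (M₂.K ⊕ Unit)
  let Γ : K → Type := Sum.elim M₁.Γ (Sum.elim M₂.Γ fun _ => β)
  let Λ := M₁.Λ ⊕ (M₂.Λ ⊕ Bool)
  let σ := M₁.σ × M₂.σ × Option β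
  let L₁ : StateLens σ M₁.σ :=
    ⟨fun s => s.1, fun a s => (a, s.2), fun _ _ => rfl, fun _ => rfl, fun _ _ _ => rfl⟩
  let L₂ : StateLens σ M₂.σ :=
    ⟨fun s => s.2.1, fun a s => (s.1, a, s.2.2), fun _ _ => rfl, fun _ => rfl, fun _ _ _ => rfl⟩
  let L₃ : StateLens σ (Option β) :=
    ⟨fun s => s.2.2, fun a s => (s.1, s.2.1, a), fun _ _ => rfl, fun _ => rfl, fun _ _ _ => rfl⟩
  let f₁ : M₁.Λ → Λ := Sum.inl
  let f₂ : M₂.Λ → Λ := fun l => Sum.inr (Sum.inl l)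
  let tmp : K := Sum.inr (Sum.inr ())
  let mv : Bool → Λ := fun b => Sum.inr (Sum.inr b)
  let m : Λ → TM2.Stmt Γ Λ σ := Sum.elim
    (fun l => embedStmt (Γ' := Γ) Sum.inl L₁ f₁ (some (mv false)) (M₁.m l))
    (Sum.elim
      (fun l => embedStmt (Γ' := Γ) (fun k => Sum.inr (Sum.inl k)) L₂ f₂ none (M₂.m l))
      (fun b => cond b
        (moveStmt (Γ := Γ) L₃ tmp (fun s : β => s)
          [⟨Sum.inr (Sum.inl M₂.k₀), (i₂.symm : β → M₂.Γ M₂.k₀)⟩] (mv true) (some (f₂ M₂.main)))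
        (moveStmt (Γ := Γ) L₃ (Sum.inl M₁.k₁) (o₁ : M₁.Γ M₁.k₁ → β) [⟨tmp, fun s : β => s⟩]
          (mv false) (some (mv true)))))
  let v₀ : σ := (M₁.initialState, M₂.initialState, none)
  refine ⟨@FinTM2.mk K _ _ (Sum.inl M₁.k₀) (Sum.inr (Sum.inl M₂.k₁)) Γ Λ (f₁ M₁.main) _ σ v₀ _
    M₁.Γk₀Fin m, i₁, o₂, p₁ + (q + 1) + (q + 1) + p₂.comp q, fun x => ?_⟩
  have r₁ := reachesIn_joinStacks₁ (Γ₂ := M₂.Γ) (Δ := fun _ : Unit => β) L₁ f₁ (some (mv false))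
    M₁.m m (fun _ => rfl) (v := v₀) (h₁ x) (fun _ => []) fun _ => []
  have r₂ : ReachesIn (TM2.step m) ((f x).length + 1)
      ⟨some (mv false), v₀, joinStacks (onlyStack M₁.k₁ ((f x).map o₁.symm)) (fun _ => [])
        fun _ => []⟩
      ⟨some (mv true), v₀, joinStacks (fun _ => []) (fun _ => []) fun _ => (f x).reverse⟩ := by
    refine reachesIn_move (Γ := Γ) L₃ (a := Sum.inl M₁.k₁) (b := tmp) Sum.inl_ne_inr
      (l := mv false) (ex := some (mv true)) rfl (v := v₀) rfl (f x) ?_ rfl ?_ ?_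
    · refine (congrArg (List.map o₁) (onlyStack_self _ _)).trans ?_
      simp [Function.comp_def]
    · exact (congrArg List.reverse (List.map_id (f x)).symm).trans (List.append_nil _).symm
    · rintro (k | k | k) h h'
      · exact (onlyStack_of_ne (fun hk => h (congrArg _ hk)) _).symm
      · rfl
      · exact absurd rfl h'
  have r₃ : ReachesIn (TM2.step m) ((f x).reverse.length + 1)
      ⟨some (mv true), v₀, joinStacks (fun _ => []) (fun _ => []) fun _ => (f x).reverse⟩
      ⟨some (f₂ M₂.main), v₀, joinStacks (fun _ => []) (onlyStack M₂.k₀ ((f x).map i₂.symm))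
        fun _ => []⟩ := by
    refine reachesIn_move (Γ := Γ) L₃ (a := tmp) (b := Sum.inr (Sum.inl M₂.k₀))
      (fun h => Sum.inr_ne_inl (Sum.inr_injective h))
      (l := mv true) (ex := some (f₂ M₂.main)) rfl (v := v₀) rfl (f x).reverse ?_ rfl ?_ ?_
    · exact List.map_id _
    · refine (onlyStack_self _ _).trans ?_
      exact (map_reverse_reverse _ _).symm.trans (List.append_nil _).symm
    · rintro (k | k | k) h h'
      · rfl
      · exact onlyStack_of_ne (fun hk => h' (congrArg (fun k => Sum.inr (Sum.inl k)) hk)) _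
      · exact absurd rfl h
  have r₄ := reachesIn_joinStacks₂ (Γ₁ := M₁.Γ) (Δ := fun _ : Unit => β) L₂ f₂ none
    M₂.m m (fun _ => rfl) (v := v₀) (h₂ (f x)) (fun _ => []) fun _ => []
  have r := (((r₁.trans r₂).trans r₃).trans r₄).mono
    (m := (p₁ + (q + 1) + (q + 1) + p₂.comp q).eval x.length) (by
      have := hq x
      have := eval_mono p₂ (hq x)
      simp only [List.length_reverse, Polynomial.eval_add, Polynomial.eval_one,
        Polynomial.eval_comp]
      omega)
  rw [← onlyStack_eq_joinStacks₁, ← onlyStack_eq_joinStacks₂] at r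
  exact r

/-- The concatenation of the results of two polynomial-time functions is polynomial-time. -/
theorem PolyTimeFun.append {α β : Type} [Fintype α] [Inhabited α] [Fintype β] [Inhabited β]
    {f g : List α → List β} (hf : PolyTimeFun f) (hg : PolyTimeFun g) :
    PolyTimeFun fun x => f x ++ g x := by
  rw [polyTimeFun_iff] at hf hg ⊢
  obtain ⟨M₁, i₁, o₁, p₁, h₁⟩ := hf
  obtain ⟨M₂, i₂, o₂, p₂, h₂⟩ := hg
  obtain ⟨q, hq⟩ := exists_output_bound M₁ f i₁ o₁ p₁ h₁
  have := M₁.kFin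
  have := M₂.kFin
  have := M₁.ΛFin
  have := M₂.ΛFin
  have := M₁.σFin
  have := M₂.σFin
  let J := Bool ⊕ Unit
  let Δ : J → Type := Sum.elim (fun _ => α) fun _ => β
  let K := M₁.K ⊕ (M₂.K ⊕ J)
  let Γ : K → Type := Sum.elim M₁.Γ (Sum.elim M₂.Γ Δ)
  let Λ := M₁.Λ ⊕ (M₂.Λ ⊕ (Bool ⊕ Bool))
  let σ := M₁.σ × M₂.σ × Option α × Option β
  let L₁ : StateLens σ M₁.σ :=
    ⟨fun s => s.1, fun a s => (a, s.2), fun _ _ => rfl, fun _ => rfl, fun _ _ _ => rfl⟩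
  let L₂ : StateLens σ M₂.σ :=
    ⟨fun s => s.2.1, fun a s => (s.1, a, s.2.2), fun _ _ => rfl, fun _ => rfl, fun _ _ _ => rfl⟩
  let L₃ : StateLens σ (Option α) :=
    ⟨fun s => s.2.2.1, fun a s => (s.1, s.2.1, a, s.2.2.2), fun _ _ => rfl, fun _ => rfl,
      fun _ _ _ => rfl⟩
  let L₄ : StateLens σ (Option β) :=
    ⟨fun s => s.2.2.2, fun a s => (s.1, s.2.1, s.2.2.1, a), fun _ _ => rfl, fun _ => rfl,
      fun _ _ _ => rfl⟩
  let f₁ : M₁.Λ → Λ := Sum.inl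
  let f₂ : M₂.Λ → Λ := fun l => Sum.inr (Sum.inl l)
  let inp : K := Sum.inr (Sum.inr (Sum.inl false))
  let tmp : K := Sum.inr (Sum.inr (Sum.inl true))
  let tmp' : K := Sum.inr (Sum.inr (Sum.inr ()))
  let mvA : Bool → Λ := fun b => Sum.inr (Sum.inr (Sum.inl b))
  let mvB : Bool → Λ := fun b => Sum.inr (Sum.inr (Sum.inr b))
  -- The loops `mvA` copy the input to both machines, the loops `mvB` join their outputs.
  let m : Λ → TM2.Stmt Γ Λ σ := Sum.elim
    (fun l => embedStmt (Γ' := Γ) Sum.inl L₁ f₁ (some (f₂ M₂.main)) (M₁.m l))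
    (Sum.elim
      (fun l => embedStmt (Γ' := Γ) (fun k => Sum.inr (Sum.inl k)) L₂ f₂ (some (mvB false))
        (M₂.m l))
      (Sum.elim
        (fun b => cond b
          (moveStmt (Γ := Γ) L₃ tmp (fun s : α => s)
            [⟨Sum.inl M₁.k₀, (i₁.symm : α → M₁.Γ M₁.k₀)⟩,
              ⟨Sum.inr (Sum.inl M₂.k₀), (i₂.symm : α → M₂.Γ M₂.k₀)⟩]
            (mvA true) (some (f₁ M₁.main)))
          (moveStmt (Γ := Γ) L₃ inp (fun s : α => s) [⟨tmp, fun s : α => s⟩]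
            (mvA false) (some (mvA true))))
        (fun b => cond b
          (moveStmt (Γ := Γ) L₄ tmp' (fun s : β => s)
            [⟨Sum.inr (Sum.inl M₂.k₁), (o₂.symm : β → M₂.Γ M₂.k₁)⟩] (mvB true) none)
          (moveStmt (Γ := Γ) L₄ (Sum.inl M₁.k₁) (o₁ : M₁.Γ M₁.k₁ → β) [⟨tmp', fun s : β => s⟩]
            (mvB false) (some (mvB true))))))
  let v₀ : σ := (M₁.initialState, M₂.initialState, none, none)
  refine ⟨@FinTM2.mk K _ _ inp (Sum.inr (Sum.inl M₂.k₁)) Γ Λ (mvA false) _ σ v₀ _ ‹Fintype α› m,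
    Equiv.refl _, o₂, (Polynomial.X + 1) + (Polynomial.X + 1) + p₁ + p₂ + (q + 1) + (q + 1),
    fun x => ?_⟩
  let aux : List α → List α → List β → ∀ j, List (Δ j) := fun a b c =>
    Sum.rec (Bool.rec a b) fun _ => c
  have r₁ : ReachesIn (TM2.step m) (x.length + 1)
      ⟨some (mvA false), v₀, joinStacks (fun _ => []) (fun _ => []) (aux x [] [])⟩
      ⟨some (mvA true), v₀, joinStacks (fun _ => []) (fun _ => []) (aux [] x.reverse [])⟩ := by
    refine reachesIn_move (Γ := Γ) L₃ (a := inp) (b := tmp)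
      (fun h => Bool.false_ne_true (Sum.inl_injective (Sum.inr_injective (Sum.inr_injective h))))
      (l := mvA false) (ex := some (mvA true)) rfl (v := v₀) rfl x ?_ rfl ?_ ?_
    · exact List.map_id _
    · exact (congrArg List.reverse (List.map_id x).symm).trans (List.append_nil _).symm
    · rintro (k | k | (_ | _) | k) h h'
      · rfl
      · rfl
      · exact absurd rfl h
      · exact absurd rfl h'
      · rfl
  have r₂ : ReachesIn (TM2.step m) (x.reverse.length + 1)
      ⟨some (mvA true), v₀, joinStacks (fun _ => []) (fun _ => []) (aux [] x.reverse [])⟩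
      ⟨some (f₁ M₁.main), v₀, joinStacks (onlyStack M₁.k₀ (x.map i₁.symm))
        (onlyStack M₂.k₀ (x.map i₂.symm)) (aux [] [] [])⟩ := by
    refine reachesIn_move₂ (Γ := Γ) L₃ (a := tmp) (b := Sum.inl M₁.k₀)
      (c := Sum.inr (Sum.inl M₂.k₀)) Sum.inr_ne_inl
      (fun h => Sum.inr_ne_inl (Sum.inr_injective h)) Sum.inl_ne_inr
      (l := mvA true) (ex := some (f₁ M₁.main)) rfl (v := v₀) rfl x.reverse ?_ rfl ?_ ?_ ?_
    · exact List.map_id _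
    · refine (onlyStack_self _ _).trans ?_
      exact (map_reverse_reverse _ _).symm.trans (List.append_nil _).symm
    · refine (onlyStack_self _ _).trans ?_
      exact (map_reverse_reverse _ _).symm.trans (List.append_nil _).symm
    · rintro (k | k | (_ | _) | k) h h' h''
      · exact onlyStack_of_ne (fun hk => h' (congrArg _ hk)) _
      · exact onlyStack_of_ne (fun hk => h'' (congrArg (fun k => Sum.inr (Sum.inl k)) hk)) _
      · rfl
      · exact absurd rfl h
      · rfl
  have r₃ := reachesIn_joinStacks₁ (Γ₂ := M₂.Γ) (Δ := Δ) L₁ f₁ (some (f₂ M₂.main))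
    M₁.m m (fun _ => rfl) (v := v₀) (h₁ x) (onlyStack M₂.k₀ (x.map i₂.symm)) (aux [] [] [])
  have r₄ := reachesIn_joinStacks₂ (Γ₁ := M₁.Γ) (Δ := Δ) L₂ f₂ (some (mvB false))
    M₂.m m (fun _ => rfl) (v := v₀) (h₂ x) (onlyStack M₁.k₁ ((f x).map o₁.symm)) (aux [] [] [])
  have r₅ : ReachesIn (TM2.step m) ((f x).length + 1)
      ⟨some (mvB false), v₀, joinStacks (onlyStack M₁.k₁ ((f x).map o₁.symm))
        (onlyStack M₂.k₁ ((g x).map o₂.symm)) (aux [] [] [])⟩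
      ⟨some (mvB true), v₀, joinStacks (fun _ => []) (onlyStack M₂.k₁ ((g x).map o₂.symm))
        (aux [] [] (f x).reverse)⟩ := by
    refine reachesIn_move (Γ := Γ) L₄ (a := Sum.inl M₁.k₁) (b := tmp') Sum.inl_ne_inr
      (l := mvB false) (ex := some (mvB true)) rfl (v := v₀) rfl (f x) ?_ rfl ?_ ?_
    · refine (congrArg (List.map o₁) (onlyStack_self _ _)).trans ?_
      simp [Function.comp_def]
    · exact (congrArg List.reverse (List.map_id (f x)).symm).trans (List.append_nil _).symm
    · rintro (k | k | (_ | _) | k) h h'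
      · exact (onlyStack_of_ne (fun hk => h (congrArg _ hk)) _).symm
      · rfl
      · rfl
      · rfl
      · exact absurd rfl h'
  have r₆ : ReachesIn (TM2.step m) ((f x).reverse.length + 1)
      ⟨some (mvB true), v₀, joinStacks (fun _ => []) (onlyStack M₂.k₁ ((g x).map o₂.symm))
        (aux [] [] (f x).reverse)⟩
      ⟨none, v₀, joinStacks (fun _ => []) (onlyStack M₂.k₁ ((f x ++ g x).map o₂.symm))
        (aux [] [] [])⟩ := by
    refine reachesIn_move (Γ := Γ) L₄ (a := tmp') (b := Sum.inr (Sum.inl M₂.k₁))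
      (fun h => Sum.inr_ne_inl (Sum.inr_injective h))
      (l := mvB true) (ex := none) rfl (v := v₀) rfl (f x).reverse ?_ rfl ?_ ?_
    · exact List.map_id _
    · refine (onlyStack_self _ _).trans ?_
      rw [List.map_append]
      exact congrArg₂ (· ++ ·) (map_reverse_reverse _ _).symm (onlyStack_self _ _).symm
    · rintro (k | k | (_ | _) | k) h h'
      · rfl
      · have hk : k ≠ M₂.k₁ := fun hk => h' (congrArg (fun k => Sum.inr (Sum.inl k)) hk)
        exact (onlyStack_of_ne hk _).trans (onlyStack_of_ne hk _).symm
      · rfl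
      · rfl
      · exact absurd rfl h
  have r := (((((r₁.trans r₂).trans r₃).trans r₄).trans r₅).trans r₆).mono
    (m := ((Polynomial.X + 1) + (Polynomial.X + 1) + p₁ + p₂ + (q + 1) + (q + 1)).eval x.length)
    (by
      have := hq x
      simp only [List.length_reverse, Polynomial.eval_add, Polynomial.eval_one, Polynomial.eval_X]
      omega)
  have haux : aux [] [] [] = fun _ => [] := by
    funext j
    rcases j with (_ | _) | _ <;> rfl
  have haux' : aux x [] [] = onlyStack (Γ := Δ) (Sum.inl false) x := by
    funext j
    rcases j with (_ | _) | _
    · exact (onlyStack_self (Γ := Δ) (Sum.inl false) x).symm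
    · exact (onlyStack_of_ne (Γ := Δ) (k := Sum.inl false) (k' := Sum.inl true)
        (fun h => Bool.false_ne_true (Sum.inl_injective h).symm) x).symm
    · exact (onlyStack_of_ne (Γ := Δ) (k := Sum.inl false) Sum.inr_ne_inl x).symm
  have hin : joinStacks (fun _ => []) (fun _ => []) (aux x [] []) =
      onlyStack (Γ := Γ) inp (x.map (Equiv.refl α).symm) :=
    ((congrArg _ haux').trans (onlyStack_eq_joinStacks₃ (Γ₁ := M₁.Γ)
      (Γ₂ := M₂.Γ) (Δ := Δ) (Sum.inl false) x).symm).trans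
      (congrArg (onlyStack (Γ := Γ) inp) (List.map_id x).symm)
  rw [haux, hin, ← onlyStack_eq_joinStacks₂] at r
  exact r


/-! ### Simple stack programs -/

/-- A program for a machine with the stacks `K` over one alphabet `Γ`: in state `q` the stack
`src q` is popped, and depending on the symbol obtained (`none` if the stack is empty) the symbols
`out` are pushed and the program passes to the state `next` (`none` means that it halts). -/
structure StackProg (Q K Γ : Type) where
  src : Q → K
  next : Q → Option Γ → Option Q
  out : Q → Option Γ → List (K × Γ)

/-- Push symbols, one after the other. -/
def pushAll {K Γ : Type} [DecidableEq K] : List (K × Γ) → (K → List Γ) → K → List Γ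
  | [], S => S
  | (k, g) :: l, S => pushAll l (update S k (g :: S k))

/-- The statement pushing symbols one after the other. -/
def pushStmt {K Γ Λ σ : Type} (l : List (K × Γ)) (q : TM2.Stmt (fun _ : K => Γ) Λ σ) :
    TM2.Stmt (fun _ : K => Γ) Λ σ :=
  l.foldr (fun a q => .push a.1 (fun _ => a.2) q) q

theorem stepAux_pushStmt {K Γ Λ σ : Type} [DecidableEq K] (l : List (K × Γ))
    (q : TM2.Stmt (fun _ : K => Γ) Λ σ) (v : σ) (S : K → List Γ) :
    TM2.stepAux (pushStmt l q) v S = TM2.stepAux q v (pushAll l S) := by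
  induction l generalizing S with
  | nil => rfl
  | cons a l ih => exact ih _

/-- Case distinction on the machine state, tried along a list of possible values. -/
def caseStmt {K Γ Λ σ : Type} [DecidableEq σ] (f : σ → TM2.Stmt (fun _ : K => Γ) Λ σ) :
    List σ → TM2.Stmt (fun _ : K => Γ) Λ σ
  | [] => .halt
  | a :: l => .branch (fun v => decide (v = a)) (f a) (caseStmt f l)

theorem stepAux_caseStmt {K Γ Λ σ : Type} [DecidableEq K] [DecidableEq σ]
    (f : σ → TM2.Stmt (fun _ : K => Γ) Λ σ) (l : List σ) (v : σ) (hv : v ∈ l) (S : K → List Γ) :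
    TM2.stepAux (caseStmt f l) v S = TM2.stepAux (f v) v S := by
  induction l with
  | nil => simp at hv
  | cons a l ih =>
    simp only [caseStmt, TM2.stepAux]
    by_cases h : v = a
    · subst h; simp
    · rw [decide_eq_false h, cond_false]
      exact ih (List.mem_of_ne_of_mem h hv)

namespace StackProg

variable {Q K Γ : Type} [DecidableEq K] [DecidableEq Γ] [Fintype Γ]

/-- The Turing machine program that executes `P`; its state holds the symbol just popped. -/
noncomputable def toTM (P : StackProg Q K Γ) (q : Q) : TM2.Stmt (fun _ : K => Γ) Q (Option Γ) :=
  .pop (P.src q) (fun _ o => o) <|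
    caseStmt (fun o => pushStmt (P.out q o) (.load (fun _ => none) (exitStmt (P.next q o))))
      (Finset.univ : Finset (Option Γ)).toList

theorem step_toTM (P : StackProg Q K Γ) (q : Q) (S : K → List Γ) :
    TM2.step P.toTM ⟨some q, none, S⟩ =
      some ⟨P.next q (S (P.src q)).head?, none,
        pushAll (P.out q (S (P.src q)).head?) (update S (P.src q) (S (P.src q)).tail)⟩ := by
  simp only [TM2.step, toTM, TM2.stepAux]
  rw [stepAux_caseStmt _ _ _ (by simp), stepAux_pushStmt]
  simp only [TM2.stepAux, stepAux_exitStmt]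

/-- One step of a stack program followed by a run. -/
theorem reachesIn_head (P : StackProg Q K Γ) {n : ℕ} {q : Q} {S S' : K → List Γ} {q' : Option Q}
    {c : TM2.Cfg (fun _ : K => Γ) Q (Option Γ)} {o : Option Γ} (ho : (S (P.src q)).head? = o)
    (hq : P.next q o = q')
    (hS : pushAll (P.out q o) (update S (P.src q) (S (P.src q)).tail) = S')
    (h : ReachesIn (TM2.step P.toTM) n ⟨q', none, S'⟩ c) :
    ReachesIn (TM2.step P.toTM) (n + 1) ⟨some q, none, S⟩ c := by
  subst ho hq hS
  exact ReachesIn.head (P.step_toTM q S) h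

theorem polyTimeFun (P : StackProg Q K Γ) [Fintype Q] [Fintype K] (q₀ : Q) (k₀ k₁ : K)
    (f : List Γ → List Γ) (p : Polynomial ℕ)
    (h : ∀ x, ReachesIn (TM2.step P.toTM) (p.eval x.length) ⟨some q₀, none, onlyStack k₀ x⟩
      ⟨none, none, onlyStack k₁ (f x)⟩) : PolyTimeFun f := by
  rw [polyTimeFun_iff]
  refine ⟨@FinTM2.mk K _ _ k₀ k₁ (fun _ => Γ) Q q₀ _ (Option Γ) none _ _ P.toTM,
    Equiv.refl _, Equiv.refl _, p, fun x => ?_⟩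
  have e₀ : onlyStack (Γ := fun _ => Γ) k₀ (x.map (Equiv.refl Γ).symm) = onlyStack k₀ x :=
    congrArg _ (List.map_id x)
  have e₁ : onlyStack (Γ := fun _ => Γ) k₁ ((f x).map (Equiv.refl Γ).symm) = onlyStack k₁ (f x) :=
    congrArg _ (List.map_id (f x))
  have := h x
  rw [← e₀, ← e₁] at this
  exact this

end StackProg

/-- The stacks of the programs below. -/
inductive Stk
  | inp | out | buf | cnt
  deriving DecidableEq

instance : Fintype Stk :=
  ⟨{.inp, .out, .buf, .cnt}, fun k => by cases k <;> simp⟩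

/-- The given contents of the four stacks. -/
def stks {Γ : Type} (i o b c : List Γ) : Stk → List Γ
  | .inp => i
  | .out => o
  | .buf => b
  | .cnt => c

section Stks

variable {Γ : Type} (i o b c l : List Γ)

theorem update_stks_inp : update (stks i o b c) .inp l = stks l o b c := by
  funext k; cases k <;> rfl

theorem update_stks_out : update (stks i o b c) .out l = stks i l b c := by
  funext k; cases k <;> rfl

theorem update_stks_buf : update (stks i o b c) .buf l = stks i o l c := by
  funext k; cases k <;> rfl

theorem update_stks_cnt : update (stks i o b c) .cnt l = stks i o b l := by
  funext k; cases k <;> rfl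

theorem onlyStack_inp : onlyStack (Γ := fun _ => Γ) Stk.inp l = stks l [] [] [] := by
  funext k; cases k <;> rfl

theorem onlyStack_out : onlyStack (Γ := fun _ => Γ) Stk.out l = stks [] l [] [] := by
  funext k; cases k <;> rfl

theorem pushAll_out : pushAll (l.map fun s => (Stk.out, s)) (stks i o b c) =
    stks i (l.reverse ++ o) b c := by
  induction l generalizing o with
  | nil => rfl
  | cons a l ih =>
    simp only [List.map_cons, pushAll, update_stks_out, List.reverse_cons, List.append_assoc]
    exact ih _

end Stks

/-! ### Transducers -/

section Transduce

variable {S Γ : Type}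

/-- The output of a finite-state transducer with transition and output function `δ` that ends with
the output `fin s` if the last state is `s`. -/
def transduce (δ : S → Γ → S × List Γ) (fin : S → List Γ) : S → List Γ → List Γ
  | s, [] => fin s
  | s, a :: l => (δ s a).2 ++ transduce δ fin (δ s a).1 l

variable [Fintype S] [DecidableEq Γ] [Fintype Γ]

theorem polyTimeFun_reverse_transduce (δ : S → Γ → S × List Γ) (fin : S → List Γ) (s₀ : S) :
    PolyTimeFun fun x => (transduce δ fin s₀ x).reverse := by
  let P : StackProg S Stk Γ :=
    { src := fun _ => .inp
      next := fun s a => a.map fun a => (δ s a).1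
      out := fun s a => (a.elim (fin s) fun a => (δ s a).2).map fun b => (.out, b) }
  refine P.polyTimeFun s₀ .inp .out _ (Polynomial.X + 1) fun x => ?_
  rw [onlyStack_inp, onlyStack_out]
  suffices H : ∀ x s o, ReachesIn (TM2.step P.toTM) (x.length + 1) ⟨some s, none, stks x o [] []⟩
      ⟨none, none, stks [] ((transduce δ fin s x).reverse ++ o) [] []⟩ by
    simpa using H x s₀ []
  intro x
  induction x with
  | nil =>
    intro s o
    refine P.reachesIn_head rfl rfl ?_ (ReachesIn.refl _ _)
    simp only [P, update_stks_inp]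
    exact pushAll_out _ _ _ _ _
  | cons a x ih =>
    intro s o
    have h := P.reachesIn_head (q := s) (S := stks (a :: x) o [] []) (o := some a) rfl rfl
      (by
        simp only [P, update_stks_inp]
        exact pushAll_out _ _ _ _ _) (ih (δ s a).1 ((δ s a).2.reverse ++ o))
    simpa [transduce] using h

theorem polyTimeFun_reverse : PolyTimeFun (List.reverse : List Γ → List Γ) := by
  have h := polyTimeFun_reverse_transduce (Γ := Γ) (fun (_ : Unit) a => ((), [a])) (fun _ => []) ()
  convert h using 2 with x
  induction x with
  | nil => rfl
  | cons a x ih => simp [transduce, ih]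

theorem polyTimeFun_transduce [Inhabited Γ] (δ : S → Γ → S × List Γ) (fin : S → List Γ) (s₀ : S) :
    PolyTimeFun (transduce δ fin s₀) := by
  have h := polyTimeFun_reverse.comp (polyTimeFun_reverse_transduce δ fin s₀)
  simpa using h

end Transduce

/-! ### Unrolled loops -/

section Unroll

variable {Γ : Type}

/-- The instance for the loop index `i` of a template: each item `(s, k)` stands for the symbol `s`
followed by `k * i` copies of `one`. -/
def instantiate (one : Γ) (T : List (Γ × ℕ)) (i : ℕ) : List Γ :=
  T.flatMap fun t => t.1 :: List.replicate (t.2 * i) one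

/-- The instances of a template for all `i < n`. -/
def unroll (one : Γ) (T : List (Γ × ℕ)) (n : ℕ) : List Γ :=
  (List.range n).flatMap (instantiate one T)

variable [DecidableEq Γ] [Fintype Γ]

/-- The unary index `i` is kept on the stack `cnt`; an item `(s, k)` is written by moving `cnt` to
`buf` with `k` copies of each symbol written to `out`, and then moving it back. -/
theorem polyTimeFun_reverse_unroll (one : Γ) (t₀ : Γ × ℕ) (T₀ : List (Γ × ℕ)) :
    PolyTimeFun fun x : List Γ => (unroll one (t₀ :: T₀) x.length).reverse := by
  set T := t₀ :: T₀ with hT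
  -- States: `inl false` starts a round, `inl true` clears the counter, `inr (false, j)` writes
  -- the item `j` and `inr (true, j)` restores the counter after that.
  let P : StackProg (Bool ⊕ Bool × Fin T.length) Stk Γ :=
    { src := fun q => match q with
        | .inl false => .inp
        | .inl true => .cnt
        | .inr (false, _) => .cnt
        | .inr (true, _) => .buf
      next := fun q a => match q, a with
        | .inl false, some _ => some (.inr (false, ⟨0, by simp [hT]⟩))
        | .inl false, none => some (.inl true)
        | .inl true, some _ => some (.inl true)
        | .inl true, none => none
        | .inr (false, j), some _ => some (.inr (false, j))
        | .inr (false, j), none => some (.inr (true, j))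
        | .inr (true, j), some _ => some (.inr (true, j))
        | .inr (true, j), none =>
            if h : j.1 + 1 < T.length then some (.inr (false, ⟨j.1 + 1, h⟩)) else some (.inl false)
      out := fun q a => match q, a with
        | .inl false, some _ => [(.out, t₀.1)]
        | .inr (false, j), some _ => (.buf, one) :: (List.replicate T[j].2 one).map (.out, ·)
        | .inr (true, _), some _ => [(.cnt, one)]
        | .inr (true, j), none =>
            if h : j.1 + 1 < T.length then [(.out, T[j.1 + 1].1)] else [(.cnt, one)]
        | _, _ => [] }
  have emit : ∀ (j : Fin T.length) a b x o, ReachesIn (TM2.step P.toTM) (a + 1)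
      ⟨some (.inr (false, j)), none, stks x o (List.replicate b one) (List.replicate a one)⟩
      ⟨some (.inr (true, j)), none,
        stks x (List.replicate (T[j].2 * a) one ++ o) (List.replicate (b + a) one) []⟩ := by
    intro j a
    induction a with
    | zero =>
      intro b x o
      exact P.reachesIn_head (o := none) rfl rfl (by simp [P, pushAll, update_stks_cnt, stks])
        (ReachesIn.refl _ _)
    | succ a ih =>
      intro b x o
      have h := P.reachesIn_head (q := .inr (false, j))
        (S := stks x o (List.replicate b one) (List.replicate (a + 1) one)) (o := some one) rfl rfl
        (by
          simp only [P, pushAll, List.replicate_succ, update_stks_cnt, update_stks_buf]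
          exact (pushAll_out _ _ _ _ _).trans (by rw [List.reverse_replicate]; rfl))
        (ih (b + 1) x (List.replicate T[j].2 one ++ o))
      convert! h using 3
      · rw [← List.append_assoc, ← List.replicate_add]
        ring_nf
      · ring_nf
  have restore : ∀ (j : Fin T.length) b a x o, ReachesIn (TM2.step P.toTM) b
      ⟨some (.inr (true, j)), none, stks x o (List.replicate b one) (List.replicate a one)⟩
      ⟨some (.inr (true, j)), none, stks x o [] (List.replicate (a + b) one)⟩ := by
    intro j b
    induction b with
    | zero => exact fun a x o => ReachesIn.refl _ _
    | succ b ih =>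
      intro a x o
      have h := P.reachesIn_head (q := .inr (true, j))
        (S := stks x o (List.replicate (b + 1) one) (List.replicate a one)) (o := some one) rfl rfl
        (by simp only [P, pushAll, List.replicate_succ, stks, List.tail_cons, update_stks_cnt,
          update_stks_buf])
        (ih (a + 1) x o)
      convert! h using 3
      ring_nf
  have item : ∀ (j : Fin T.length) i x o q o' c, P.next (.inr (true, j)) none = some q →
      pushAll (P.out (.inr (true, j)) none) (stks x
        (List.replicate (T[j].2 * i) one ++ o) [] (List.replicate i one)) = stks x o' [] c →
      ReachesIn (TM2.step P.toTM) (2 * i + 2)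
        ⟨some (.inr (false, j)), none, stks x o [] (List.replicate i one)⟩
        ⟨some q, none, stks x o' [] c⟩ := by
    intro j i x o q o' c hq hS
    have h₁ := emit j i 0 x o
    rw [Nat.zero_add] at h₁
    have h₂ := restore j i 0 x (List.replicate (T[j].2 * i) one ++ o)
    rw [Nat.zero_add] at h₂
    have h₃ := P.reachesIn_head (o := none)
      (S := stks x (List.replicate (T[j].2 * i) one ++ o) [] (List.replicate i one))
      rfl hq (by simpa [P, update_stks_buf, stks] using hS) (ReachesIn.refl _ _)
    exact ((h₁.trans h₂).trans h₃).mono (by omega)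
  have round : ∀ d (j : Fin T.length), j.1 + 1 + d = T.length → ∀ i x o,
      ReachesIn (TM2.step P.toTM) ((d + 1) * (2 * i + 2))
        ⟨some (.inr (false, j)), none, stks x o [] (List.replicate i one)⟩
        ⟨some (.inl false), none, stks x ((List.replicate (T[j].2 * i) one ++
          instantiate one (T.drop (j.1 + 1)) i).reverse ++ o) []
          (List.replicate (i + 1) one)⟩ := by
    intro d
    induction d with
    | zero =>
      intro j hj i x o
      have hj' : ¬j.1 + 1 < T.length := by omega
      refine (item j i x o _ _ _ (by simp only [P, dif_neg hj']) ?_).mono (by omega)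
      simp only [P, dif_neg hj', pushAll, update_stks_cnt]
      rw [List.drop_eq_nil_of_le (by omega)]
      simp [instantiate, List.replicate_succ, stks]
    | succ d ih =>
      intro j hj i x o
      have hj' : j.1 + 1 < T.length := by omega
      have h₁ := item j i x o (.inr (false, ⟨j.1 + 1, hj'⟩))
        (T[j.1 + 1].1 :: (List.replicate (T[j].2 * i) one ++ o)) (List.replicate i one)
        (by simp only [P, dif_pos hj'])
        (by simp only [P, dif_pos hj', pushAll, update_stks_out, stks])
      have h₂ := ih ⟨j.1 + 1, hj'⟩ (by simp only; omega) i x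
        (T[j.1 + 1].1 :: (List.replicate (T[j].2 * i) one ++ o))
      have h := (h₁.trans h₂).mono (m := (d + 1 + 1) * (2 * i + 2)) (le_of_eq (by ring))
      convert! h using 3
      · have e : instantiate one (T.drop (j.1 + 1)) i = T[j.1 + 1].1 ::
            (List.replicate (T[j.1 + 1].2 * i) one ++
              instantiate one (T.drop (j.1 + 1 + 1)) i) := by
          rw [List.drop_eq_getElem_cons hj']
          rfl
        rw [e]
        simp
  have loop : ∀ x i o, ReachesIn (TM2.step P.toTM)
      (x.length * (1 + T.length * (2 * (i + x.length) + 2)) + (i + x.length + 2))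
      ⟨some (.inl false), none, stks x o [] (List.replicate i one)⟩
      ⟨none, none, stks [] (((List.range' i x.length).flatMap (instantiate one T)).reverse ++ o)
        [] []⟩ := by
    intro x
    induction x with
    | nil =>
      intro i o
      have clear : ∀ i, ReachesIn (TM2.step P.toTM) (i + 1)
          ⟨some (.inl true), none, stks [] o [] (List.replicate i one)⟩
          ⟨none, none, stks [] o [] []⟩ := by
        intro i
        induction i with
        | zero =>
          exact P.reachesIn_head (q := .inl true) (S := stks [] o [] []) (o := none) rfl rfl
            (by simp [P, pushAll, update_stks_cnt, stks]) (ReachesIn.refl _ _)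
        | succ i ih =>
          exact P.reachesIn_head (q := .inl true)
            (S := stks [] o [] (List.replicate (i + 1) one)) (o := some one) rfl rfl
            (by simp [P, pushAll, update_stks_cnt, stks, List.replicate_succ]) ih
      refine (P.reachesIn_head (q := .inl false) (o := none) rfl rfl ?_ (clear i)).mono (by simp)
      simp [P, pushAll, update_stks_inp, stks]
    | cons a x ih =>
      intro i o
      have h₁ := round (T.length - 1) ⟨0, by simp [hT]⟩ (by simp [hT]; omega) i x (t₀.1 :: o)
      have h₂ := P.reachesIn_head (q := .inl false) (o := some a)
        (S := stks (a :: x) o [] (List.replicate i one))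
        rfl rfl (by simp only [P, pushAll, update_stks_inp, update_stks_out, stks, List.tail_cons])
        h₁
      have h := (h₂.trans (ih (i + 1) _)).mono (m := (a :: x).length *
        (1 + T.length * (2 * (i + (a :: x).length) + 2)) + (i + (a :: x).length + 2)) (by
          have : T.length - 1 + 1 = T.length := by simp [hT]
          rw [this, show (a :: x).length = x.length + 1 from rfl]
          have e : T.length * (2 * i + 2) ≤ T.length * (2 * (i + (x.length + 1)) + 2) := by
            gcongr
            omega
          have e' : i + 1 + x.length = i + (x.length + 1) := by ring
          rw [e', add_mul]
          omega)
      convert! h using 3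
      simp [hT, List.range'_succ, instantiate]
  refine P.polyTimeFun (.inl false) .inp .out _ (Polynomial.X * (1 + Polynomial.C T.length *
    (2 * Polynomial.X + 2)) + (Polynomial.X + 2)) fun x => ?_
  rw [onlyStack_inp, onlyStack_out]
  have h := loop x 0 []
  simp only [List.replicate_zero, List.append_nil, zero_add] at h
  rw [unroll, List.range_eq_range']
  convert! h using 1
  simp

theorem polyTimeFun_unroll [Inhabited Γ] (one : Γ) (t₀ : Γ × ℕ) (T₀ : List (Γ × ℕ)) :
    PolyTimeFun fun x : List Γ => unroll one (t₀ :: T₀) x.length := by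
  have h := polyTimeFun_reverse.comp (polyTimeFun_reverse_unroll one t₀ T₀)
  simpa using h

end Unroll


/-! ### Polynomial-time operations on circuits -/

instance : Fintype Reg :=
  ⟨{.A, .M₀, .W, .E, .R, .M₁}, fun r => by cases r <;> simp⟩

instance : Fintype Token :=
  ⟨{.X, .H, .T, .Tdg, .cnot, .toffoli, .one, .sep} ∪ Finset.univ.image Token.reg,
    fun t => by cases t <;> simp⟩

instance : Inhabited Token := ⟨.sep⟩

/-- The gate acting on renamed wires. -/
def Gate.map (f : Wire → Wire) : Gate → Gate
  | .X t => .X (f t)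
  | .H t => .H (f t)
  | .T t => .T (f t)
  | .Tdg t => .Tdg (f t)
  | .cnot c t => .cnot (f c) (f t)
  | .toffoli c₁ c₂ t => .toffoli (f c₁) (f c₂) (f t)

/-- The circuit on renamed wires. -/
def mapCircuit (f : Wire → Wire) (C : Circuit) : Circuit := C.map (Gate.map f)

/-- The inverse gate. -/
def Gate.inv : Gate → Gate
  | .T t => .Tdg t
  | .Tdg t => .T t
  | g => g

/-- The inverse circuit. -/
def invCircuit (C : Circuit) : Circuit := (C.map Gate.inv).reverse

/-- The renaming of wires that is given on the register `r` by `i ↦ a r * i + b r`, with values in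
the register `ρ r`. -/
def affineRename (ρ : Reg → Reg) (a b : Reg → ℕ) (w : Wire) : Wire :=
  (ρ w.1, a w.1 * w.2 + b w.1)

theorem polyTimeFun_const {α : Type} {v : List α → List Token} (hv : PolyTimeFun v)
    (l : List Token) : PolyTimeFun fun _ : List α => l := by
  have h := (polyTimeFun_transduce (Γ := Token) (fun (_ : Unit) _ => ((), [])) (fun _ => l) ()).comp
    hv
  convert h using 2 with x
  induction v x with
  | nil => rfl
  | cons a y ih => simpa [transduce] using ih

section Rename

variable (ρ : Reg → Reg) (a b : Reg → ℕ)

/-- The transducer for affine renamings; its state is the register read last. -/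
def renameStep (s : Reg) : Token → Reg × List Token
  | .reg r => (r, .reg (ρ r) :: List.replicate (b r) .one)
  | .one => (s, List.replicate (a s) .one)
  | t => (s, [t])

theorem transduce_encodeWire (s : Reg) (w : Wire) (l : List Token) :
    transduce (renameStep ρ a b) (fun _ => []) s (encodeWire w ++ l) =
      encodeWire (affineRename ρ a b w) ++ transduce (renameStep ρ a b) (fun _ => []) w.1 l := by
  have ones : ∀ n, transduce (renameStep ρ a b) (fun _ => []) w.1 (List.replicate n .one ++ l) =
      List.replicate (a w.1 * n) .one ++ transduce (renameStep ρ a b) (fun _ => []) w.1 l := by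
    intro n
    induction n with
    | zero => simp
    | succ n ih =>
      rw [List.replicate_succ, List.cons_append, transduce, renameStep, ih, ← List.append_assoc,
        ← List.replicate_add]
      ring_nf
  obtain ⟨r, n⟩ := w
  simp only [encodeWire, affineRename, List.cons_append, transduce, renameStep] at ones ⊢
  rw [ones, ← List.append_assoc, ← List.replicate_add, Nat.add_comm]

theorem exists_transduce_encodeGate (s : Reg) (g : Gate) (l : List Token) : ∃ s',
    transduce (renameStep ρ a b) (fun _ => []) s (encodeGate g ++ l) =
      encodeGate (g.map (affineRename ρ a b)) ++
        transduce (renameStep ρ a b) (fun _ => []) s' l := by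
  cases g <;>
    simp only [encodeGate, Gate.map, List.cons_append, List.append_assoc, transduce, renameStep,
      transduce_encodeWire] <;>
    exact ⟨_, rfl⟩

theorem transduce_encodeCircuit (s : Reg) (C : Circuit) :
    transduce (renameStep ρ a b) (fun _ => []) s (encodeCircuit C) =
      encodeCircuit (mapCircuit (affineRename ρ a b) C) := by
  induction C generalizing s with
  | nil => rfl
  | cons g C ih =>
    obtain ⟨s', h⟩ := exists_transduce_encodeGate ρ a b s g (encodeCircuit C)
    exact h.trans (congrArg _ (ih s'))

end Rename

section Invert

/-- Whether a token is the name of a gate. -/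
def Token.isGate : Token → Bool
  | .X | .H | .T | .Tdg | .cnot | .toffoli => true
  | _ => false

/-- The name of the inverse gate. -/
def Token.inv : Token → Token
  | .T => .Tdg
  | .Tdg => .T
  | t => t

/-- The result of reading a word whose blocks (a gate name with the tokens that follow it) are to
be put into reverse order and inverted; `b` is the current block, reversed, and `o` is the result
so far. -/
def invertBlocks : List Token → List Token → List Token → List Token
  | b, o, [] => b.reverse ++ o
  | b, o, t :: l =>
      if t.isGate then invertBlocks [t.inv] (b.reverse ++ o) l else invertBlocks (t :: b) o l

theorem polyTimeFun_invertBlocks : PolyTimeFun (invertBlocks [] []) := by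
  -- States: `inl ()` reads the input, `inr (some t)` empties the buffer before the gate name `t`
  -- is put there, `inr none` empties the buffer at the end.
  let P : StackProg (Unit ⊕ Option Token) Stk Token :=
    { src := fun q => match q with
        | .inl _ => .inp
        | .inr _ => .buf
      next := fun q a => match q, a with
        | .inl _, some t => if t.isGate then some (.inr (some t)) else some (.inl ())
        | .inl _, none => some (.inr none)
        | .inr q, some _ => some (.inr q)
        | .inr (some _), none => some (.inl ())
        | .inr none, none => none
      out := fun q a => match q, a with
        | .inl _, some t => if t.isGate then [] else [(.buf, t)]
        | .inl _, none => []
        | .inr _, some u => [(.out, u)]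
        | .inr (some t), none => [(.buf, t.inv)]
        | .inr none, none => [] }
  have dump : ∀ b q x o, ReachesIn (TM2.step P.toTM) b.length
      ⟨some (.inr q), none, stks x o b []⟩
      ⟨some (.inr q), none, stks x (b.reverse ++ o) [] []⟩ := by
    intro b
    induction b with
    | nil => exact fun q x o => ReachesIn.refl _ _
    | cons u b ih =>
      intro q x o
      have h := P.reachesIn_head (q := .inr q) (S := stks x o (u :: b) []) (o := some u) rfl rfl
        (by simp only [P, pushAll, stks, List.tail_cons, update_stks_buf, update_stks_out])
        (ih q x (u :: o))
      convert! h using 3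
      simp
  have loop : ∀ x b o, ReachesIn (TM2.step P.toTM) (3 * x.length + b.length + 2)
      ⟨some (.inl ()), none, stks x o b []⟩
      ⟨none, none, stks [] (invertBlocks b o x) [] []⟩ := by
    intro x
    induction x with
    | nil =>
      intro b o
      have h₁ := P.reachesIn_head (q := .inr none) (S := stks [] (b.reverse ++ o) [] [])
        (o := none) rfl rfl
        (S' := stks [] (b.reverse ++ o) [] [])
        (by simp only [P, pushAll, stks, List.tail_nil, update_stks_buf]) (ReachesIn.refl _ _)
      have h₂ := P.reachesIn_head (q := .inl ()) (S := stks [] o b [])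
        (o := none) rfl rfl
        (by simp only [P, pushAll, stks, List.tail_nil, update_stks_inp])
        ((dump b none [] o).trans h₁)
      exact h₂.mono (by simp)
    | cons t x ih =>
      intro b o
      by_cases ht : t.isGate = true
      · have h₁ := P.reachesIn_head (q := .inr (some t)) (S := stks x (b.reverse ++ o) [] [])
          (o := none) rfl rfl
          (by simp only [P, pushAll, stks, List.tail_nil, update_stks_buf])
          (ih [t.inv] (b.reverse ++ o))
        have h₂ := P.reachesIn_head (q := .inl ()) (S := stks (t :: x) o b [])
          (o := some t) rfl (if_pos ht)
          (by simp only [P, if_pos ht, pushAll, stks, List.tail_cons, update_stks_inp])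
          ((dump b (some t) x o).trans h₁)
        rw [invertBlocks, if_pos ht]
        exact h₂.mono (by simp only [List.length_cons, List.length_nil]; omega)
      · have h := P.reachesIn_head (q := .inl ()) (S := stks (t :: x) o b [])
          (o := some t) rfl (if_neg ht)
          (by simp only [P, if_neg ht, pushAll, stks, List.tail_cons, update_stks_inp,
            update_stks_buf]) (ih (t :: b) o)
        rw [invertBlocks, if_neg ht]
        exact h.mono (by simp only [List.length_cons]; omega)
  refine P.polyTimeFun (.inl ()) .inp .out _ (3 * Polynomial.X + 2) fun x => ?_
  rw [onlyStack_inp, onlyStack_out]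
  convert! loop x [] [] using 1
  simp

theorem invertBlocks_ones (b o l : List Token) (n : ℕ) :
    invertBlocks b o (List.replicate n .one ++ l) =
      invertBlocks (List.replicate n .one ++ b) o l := by
  induction n generalizing b with
  | zero => rfl
  | succ n ih =>
    rw [List.replicate_succ, List.cons_append, invertBlocks, if_neg (by simp [Token.isGate]), ih,
      ← List.replicate_succ, List.replicate_succ', List.append_assoc]
    rfl

theorem invertBlocks_encodeWire (b o l : List Token) (w : Wire) :
    invertBlocks b o (encodeWire w ++ l) = invertBlocks ((encodeWire w).reverse ++ b) o l := by
  rw [encodeWire, List.cons_append, invertBlocks, if_neg (by simp [Token.isGate]),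
    invertBlocks_ones]
  simp

theorem invertBlocks_encodeGate (b o l : List Token) (g : Gate) :
    invertBlocks b o (encodeGate g ++ l) =
      invertBlocks (encodeGate g.inv).reverse (b.reverse ++ o) l := by
  cases g <;>
    simp [encodeGate, Gate.inv, invertBlocks, Token.isGate, Token.inv, invertBlocks_encodeWire]

theorem invertBlocks_encodeCircuit (C : Circuit) :
    invertBlocks [] [] (encodeCircuit C) = encodeCircuit (invCircuit C) := by
  suffices H : ∀ b o, invertBlocks b o (encodeCircuit C) =
      encodeCircuit (invCircuit C) ++ (b.reverse ++ o) by simpa using H [] []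
  induction C with
  | nil => exact fun b o => rfl
  | cons g C ih =>
    intro b o
    have h := invertBlocks_encodeGate b o (encodeCircuit C) g
    rw [ih] at h
    refine h.trans ?_
    simp [invCircuit, encodeCircuit]

end Invert

/-! ### Polynomial-time families of circuits -/

/-- A family of circuits that a polynomial-time machine writes down. -/
def PolyTimeCircuit (F : List Bool → Circuit) : Prop :=
  PolyTimeFun fun x => encodeCircuit (F x)

theorem encodeCircuit_append (C D : Circuit) :
    encodeCircuit (C ++ D) = encodeCircuit C ++ encodeCircuit D := by
  simp [encodeCircuit]

theorem sep_notMem_encodeCircuit (C : Circuit) : Token.sep ∉ encodeCircuit C := by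
  simp only [encodeCircuit, List.mem_flatMap, not_exists, not_and]
  intro g _
  cases g <;> simp [encodeGate, encodeWire]

namespace PolyTimeCircuit

variable {F G : List Bool → Circuit}

theorem append (hF : PolyTimeCircuit F) (hG : PolyTimeCircuit G) :
    PolyTimeCircuit fun x => F x ++ G x := by
  simpa only [PolyTimeCircuit, encodeCircuit_append] using PolyTimeFun.append hF hG

theorem const (hF : PolyTimeCircuit F) (C : Circuit) : PolyTimeCircuit fun _ => C :=
  polyTimeFun_const hF _

theorem map (hF : PolyTimeCircuit F) (ρ : Reg → Reg) (a b : Reg → ℕ) :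
    PolyTimeCircuit fun x => mapCircuit (affineRename ρ a b) (F x) := by
  have h := (polyTimeFun_transduce (renameStep ρ a b) (fun _ => []) .A).comp hF
  simpa only [PolyTimeCircuit, transduce_encodeCircuit] using h

theorem inv (hF : PolyTimeCircuit F) : PolyTimeCircuit fun x => invCircuit (F x) := by
  have h := polyTimeFun_invertBlocks.comp hF
  simpa only [PolyTimeCircuit, invertBlocks_encodeCircuit] using h

theorem mk (hF : PolyTimeCircuit F) (hG : PolyTimeCircuit G) :
    PolyTime fun x => ⟨F x, G x⟩ := by
  rw [polyTime_iff]
  exact PolyTimeFun.append hF ((polyTimeFun_const hF [.sep]).append hG)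

end PolyTimeCircuit

/-- The transducer that keeps the part before (`s = true`) or after the first separator. -/
def selectStep (keep s : Bool) (t : Token) : Bool × List Token :=
  if t = .sep ∧ s = true then (false, []) else (s, if s = keep then [t] else [])

theorem transduce_selectStep (keep : Bool) (l l' : List Token) (hl : Token.sep ∉ l) :
    transduce (selectStep keep) (fun _ => []) true (l ++ .sep :: l') = if keep then l else l' := by
  have h₂ : ∀ m, transduce (selectStep keep) (fun _ => []) false m = if keep then [] else m := by
    intro m
    induction m with
    | nil => cases keep <;> rfl
    | cons t m ih =>
      cases keep <;> simp [transduce, selectStep] at ih ⊢ <;> exact ih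
  induction l with
  | nil =>
    rw [List.nil_append, transduce]
    simp [selectStep] at h₂ ⊢
    rw [h₂]
  | cons t l ih =>
    simp only [List.mem_cons, not_or] at hl
    rw [List.cons_append, transduce]
    simp only [selectStep, Ne.symm hl.1, false_and, if_false] at ih ⊢
    rw [ih hl.2]
    cases keep <;> simp

theorem PolyTime.first {P : List Bool → Party} (hP : PolyTime P) :
    PolyTimeCircuit fun x => (P x).first := by
  rw [polyTime_iff] at hP
  have h := (polyTimeFun_transduce (selectStep true) (fun _ => []) true).comp hP
  simpa only [PolyTimeCircuit, encodeParty, Bool.false_eq_true, if_true, if_false,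
    transduce_selectStep true _ _ (sep_notMem_encodeCircuit _)] using h

theorem PolyTime.second {P : List Bool → Party} (hP : PolyTime P) :
    PolyTimeCircuit fun x => (P x).second := by
  rw [polyTime_iff] at hP
  have h := (polyTimeFun_transduce (selectStep false) (fun _ => []) true).comp hP
  simpa only [PolyTimeCircuit, encodeParty, Bool.false_eq_true, if_true, if_false,
    transduce_selectStep false _ _ (sep_notMem_encodeCircuit _)] using h

/-! ### Loops in circuits -/

/-- The words `f i` are the instances of a template. -/
def IsTemplate (f : ℕ → List Token) : Prop :=
  ∃ T, ∀ i, f i = instantiate .one T i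

namespace IsTemplate

variable {f g : ℕ → List Token}

theorem append (hf : IsTemplate f) (hg : IsTemplate g) : IsTemplate fun i => f i ++ g i := by
  obtain ⟨S, hS⟩ := hf
  obtain ⟨T, hT⟩ := hg
  exact ⟨S ++ T, fun i => by simp [hS, hT, instantiate]⟩

theorem cons (t : Token) (hf : IsTemplate f) : IsTemplate fun i => t :: f i := by
  obtain ⟨S, hS⟩ := hf
  exact ⟨(t, 0) :: S, fun i => by simp [hS, instantiate]⟩

theorem wire (r : Reg) (a b : ℕ) : IsTemplate fun i => encodeWire (r, a * i + b) := by
  refine ⟨(.reg r, a) :: List.replicate b (.one, 0), fun i => ?_⟩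
  have : ∀ b, (List.replicate b ((Token.one, 0) : Token × ℕ)).flatMap
      (fun t => t.1 :: List.replicate (t.2 * i) Token.one) = List.replicate b .one := by
    intro b
    induction b with
    | zero => rfl
    | succ b ih => rw [List.replicate_succ, List.flatMap_cons, ih]; simp [List.replicate_succ]
  rw [instantiate, List.flatMap_cons, this, List.cons_append, ← List.replicate_add]
  rfl

end IsTemplate

/-- `n` rounds of a loop that runs the circuit `C i` in round `i`. -/
def loopCircuit (C : ℕ → Circuit) (n : ℕ) : Circuit := (List.range n).flatMap C

theorem polyTimeCircuit_loop {v : List Bool → List Token} (hv : PolyTimeFun v) {C : ℕ → Circuit}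
    (hC : IsTemplate fun i => encodeCircuit (C i)) :
    PolyTimeCircuit fun x => loopCircuit C (v x).length := by
  obtain ⟨T, hT⟩ := hC
  have h : PolyTimeFun fun x => unroll .one T (v x).length := by
    cases T with
    | nil =>
      convert polyTimeFun_const hv [] using 2 with x
      simp [unroll, instantiate]
    | cons t T => exact (polyTimeFun_unroll .one t T).comp hv
  have e : ∀ n, encodeCircuit (loopCircuit C n) = unroll .one T n := fun n => by
    rw [loopCircuit, encodeCircuit, List.flatMap_assoc, unroll]
    exact List.flatMap_congr fun i _ => hT i
  simpa only [PolyTimeCircuit, e] using h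


/-! ### Linear operations on kets -/

/-- The linear map that sends the basis state `S` to the basis state `h S`. -/
noncomputable def pushL (h : Basis → Basis) : Ket →ₗ[ℂ] Ket := Finsupp.lmapDomain ℂ ℂ h

/-- The Pauli operator `X` on the qubit `t`. -/
noncomputable def flipL (t : Wire) : Ket →ₗ[ℂ] Ket := pushL (flip t)

/-- The renaming of the qubits along `f`. -/
noncomputable def renK (f : Wire → Wire) : Ket →ₗ[ℂ] Ket := pushL (Finset.image f)

open Classical in
/-- The projection to the span of the basis states with property `p`. -/
noncomputable def restrict (p : Basis → Prop) : Ket →ₗ[ℂ] Ket where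
  toFun ψ := ψ.filter p
  map_add' _ _ := Finsupp.filter_add
  map_smul' _ _ := Finsupp.filter_smul

/-- The projection to the basis states in which the qubit `t` is `1`. -/
noncomputable def bitL (t : Wire) : Ket →ₗ[ℂ] Ket := restrict (t ∈ ·)

@[simp] theorem pushL_single (h : Basis → Basis) (S : Basis) (z : ℂ) :
    pushL h (Finsupp.single S z) = Finsupp.single (h S) z := by
  simp [pushL]

open Classical in
theorem restrict_apply (p : Basis → Prop) (ψ : Ket) (S : Basis) :
    restrict p ψ S = if p S then ψ S else 0 := by
  simp [restrict, Finsupp.filter_apply]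

open Classical in
theorem restrict_single (p : Basis → Prop) (S : Basis) (z : ℂ) :
    restrict p (Finsupp.single S z) = if p S then Finsupp.single S z else 0 := by
  split_ifs with h
  · exact Finsupp.filter_single_of_pos _ h
  · exact Finsupp.filter_single_of_neg _ h

theorem ket_hom_ext {A B : Ket →ₗ[ℂ] Ket}
    (h : ∀ S, A (Finsupp.single S 1) = B (Finsupp.single S 1)) : A = B :=
  Finsupp.lhom_ext' fun S => LinearMap.ext_ring (h S)

theorem pushL_pushL (h k : Basis → Basis) (ψ : Ket) :
    pushL h (pushL k ψ) = pushL (fun S => h (k S)) ψ :=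
  (Finsupp.mapDomain_comp (v := ψ) (f := k) (g := h)).symm

theorem pushL_congr {h k : Basis → Basis} {ψ : Ket} (e : ∀ S ∈ ψ.support, h S = k S) :
    pushL h ψ = pushL k ψ := Finsupp.mapDomain_congr e

theorem pushL_eq_self {h : Basis → Basis} {ψ : Ket} (e : ∀ S ∈ ψ.support, h S = S) :
    pushL h ψ = ψ := (pushL_congr e).trans Finsupp.mapDomain_id

theorem restrict_pushL (p : Basis → Prop) (h : Basis → Basis) (ψ : Ket) :
    restrict p (pushL h ψ) = pushL h (restrict (fun S => p (h S)) ψ) := by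
  suffices H : restrict p ∘ₗ pushL h = pushL h ∘ₗ restrict (fun S => p (h S)) from
    LinearMap.congr_fun H ψ
  refine ket_hom_ext fun S => ?_
  simp only [LinearMap.comp_apply, pushL_single, restrict_single]
  split_ifs <;> simp

theorem restrict_restrict (p q : Basis → Prop) (ψ : Ket) :
    restrict p (restrict q ψ) = restrict (fun S => p S ∧ q S) ψ := by
  ext S
  simp only [restrict_apply]
  split_ifs <;> tauto

theorem restrict_comm (p q : Basis → Prop) (ψ : Ket) :
    restrict p (restrict q ψ) = restrict q (restrict p ψ) := by
  rw [restrict_restrict, restrict_restrict]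
  simp only [and_comm]

theorem restrict_congr {p q : Basis → Prop} {ψ : Ket} (h : ∀ S ∈ ψ.support, (p S ↔ q S)) :
    restrict p ψ = restrict q ψ := by
  ext S
  simp only [restrict_apply]
  by_cases hS : ψ S = 0
  · simp [hS]
  · have := h S (Finsupp.mem_support_iff.2 hS)
    split_ifs <;> tauto

theorem restrict_eq_self_iff {p : Basis → Prop} {ψ : Ket} :
    restrict p ψ = ψ ↔ ∀ S ∈ ψ.support, p S := by
  simp only [Finsupp.ext_iff, restrict_apply, Finsupp.mem_support_iff]
  refine forall_congr' fun S => ?_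
  split_ifs with h <;> simp [h, eq_comm]

theorem restrict_add_restrict_not (p : Basis → Prop) (ψ : Ket) :
    restrict p ψ + restrict (fun S => ¬ p S) ψ = ψ := by
  ext S
  simp only [Finsupp.add_apply, restrict_apply]
  split_ifs <;> simp_all

theorem mem_flip {t w : Wire} {S : Basis} : w ∈ flip t S ↔ (w ∈ S ↔ w ≠ t) := by
  unfold flip
  by_cases h : w = t
  · subst h; split_ifs <;> simp_all
  · split_ifs <;> simp_all

theorem flip_flip (t : Wire) (S : Basis) : flip t (flip t S) = S := by
  ext w
  simp only [mem_flip]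
  tauto

theorem flip_comm (t u : Wire) (S : Basis) : flip t (flip u S) = flip u (flip t S) := by
  ext w
  simp only [mem_flip]
  tauto

theorem image_flip {f : Wire → Wire} (hf : Injective f) (t : Wire) (S : Basis) :
    (flip t S).image f = flip (f t) (S.image f) := by
  ext w
  by_cases hw : ∃ u, f u = w
  · obtain ⟨u, rfl⟩ := hw
    simp [mem_flip, hf.eq_iff]
  · have h : ∀ S : Basis, w ∉ S.image f := fun S h => by
      obtain ⟨u, -, hu⟩ := Finset.mem_image.1 h
      exact hw ⟨u, hu⟩
    have ht : w ≠ f t := fun h => hw ⟨t, h.symm⟩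
    simp [mem_flip, h, ht]

/-! ### Gates as operators -/

/-- The linear map of a circuit. -/
noncomputable def runL : Circuit → Ket →ₗ[ℂ] Ket
  | [] => LinearMap.id
  | g :: C => runL C ∘ₗ g.apply

theorem runL_apply (C : Circuit) (ψ : Ket) : runL C ψ = run C ψ := by
  induction C generalizing ψ with
  | nil => rfl
  | cons g C ih => exact ih _

theorem run_nil (ψ : Ket) : run [] ψ = ψ := rfl

theorem run_cons (g : Gate) (C : Circuit) (ψ : Ket) : run (g :: C) ψ = run C (g.apply ψ) := rfl

theorem run_append (C D : Circuit) (ψ : Ket) : run (C ++ D) ψ = run D (run C ψ) := by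
  simp [run]

theorem run_add (C : Circuit) (φ ψ : Ket) : run C (φ + ψ) = run C φ + run C ψ := by
  simp only [← runL_apply, map_add]

theorem run_smul (C : Circuit) (z : ℂ) (ψ : Ket) : run C (z • ψ) = z • run C ψ := by
  simp only [← runL_apply, map_smul]

/-- A gate as a polynomial in the operators `flipL w` and `bitL w` for its qubits `w`. -/
noncomputable def Gate.toEnd : Gate → Module.End ℂ Ket
  | .X t => flipL t
  | .H t => (1 / (Real.sqrt 2 : ℂ)) • (flipL t + (1 - 2 * bitL t))
  | .T t => 1 - bitL t + Complex.exp (Complex.I * (Real.pi : ℂ) / 4) • bitL t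
  | .Tdg t => 1 - bitL t + Complex.exp (-(Complex.I * (Real.pi : ℂ) / 4)) • bitL t
  | .cnot c t => flipL t * bitL c + (1 - bitL c)
  | .toffoli c₁ c₂ t => flipL t * (bitL c₁ * bitL c₂) + (1 - bitL c₁ * bitL c₂)

theorem flipL_single (t : Wire) (S : Basis) (z : ℂ) :
    flipL t (Finsupp.single S z) = Finsupp.single (flip t S) z := pushL_single _ _ _

theorem bitL_single (t : Wire) (S : Basis) (z : ℂ) :
    bitL t (Finsupp.single S z) = if t ∈ S then Finsupp.single S z else 0 := by
  rw [bitL, restrict_single]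
  congr

theorem Gate.apply_eq (g : Gate) : g.apply = g.toEnd := by
  refine ket_hom_ext fun S => ?_
  rw [Gate.apply, Finsupp.linearCombination_single, one_smul]
  have two : ∀ ψ : Ket, (2 : Module.End ℂ Ket) ψ = ψ + ψ := fun ψ => by
    rw [← one_add_one_eq_two]; rfl
  cases g with
  | X t => simp [Gate.onBasis, Gate.toEnd, flipL_single]
  | H t =>
    simp only [Gate.onBasis, Gate.toEnd, LinearMap.smul_apply, LinearMap.add_apply,
      LinearMap.sub_apply, Module.End.mul_apply, Module.End.one_apply, flipL_single, bitL_single,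
      two]
    by_cases h : t ∈ S
    · simp [h, flip, Finset.insert_eq_of_mem h, neg_div]
    · simp [h, flip, add_comm]
  | T t =>
    by_cases h : t ∈ S <;> simp [Gate.onBasis, Gate.toEnd, bitL_single, h]
  | Tdg t =>
    by_cases h : t ∈ S <;> simp [Gate.onBasis, Gate.toEnd, bitL_single, h]
  | cnot c t =>
    by_cases h : c ∈ S <;> simp [Gate.onBasis, Gate.toEnd, bitL_single, flipL_single, h]
  | toffoli c₁ c₂ t =>
    by_cases h₁ : c₁ ∈ S <;> by_cases h₂ : c₂ ∈ S <;>
      simp [Gate.onBasis, Gate.toEnd, bitL_single, flipL_single, h₁, h₂]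

/-- A linear map which intertwines the generators `flipL w`, `bitL w` with `flipL (f w)`,
`bitL (f w)` for the qubits `w` of `C` intertwines `C` with its renaming along `f`. -/
theorem intertwine_run {J : Ket →ₗ[ℂ] Ket} {f : Wire → Wire} {C : Circuit}
    (hF : ∀ g ∈ C, ∀ w ∈ g.wires, ∀ ψ, J (flipL w ψ) = flipL (f w) (J ψ))
    (hB : ∀ g ∈ C, ∀ w ∈ g.wires, ∀ ψ, J (bitL w ψ) = bitL (f w) (J ψ)) (ψ : Ket) :
    J (run C ψ) = run (mapCircuit f C) (J ψ) := by
  induction C generalizing ψ with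
  | nil => rfl
  | cons g C ih =>
    have two : ∀ ψ : Ket, (2 : Module.End ℂ Ket) ψ = ψ + ψ := fun ψ => by
      rw [← one_add_one_eq_two]; rfl
    have hg : J (g.apply ψ) = (g.map f).apply (J ψ) := by
      have hF' := hF g List.mem_cons_self
      have hB' := hB g List.mem_cons_self
      cases g <;> simp [Gate.wires] at hF' hB' <;>
        simp [Gate.apply_eq, Gate.toEnd, Gate.map, hF', hB', two]
    rw [run_cons, ih (fun g' h => hF g' (List.mem_cons_of_mem _ h))
      (fun g' h => hB g' (List.mem_cons_of_mem _ h)), hg]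
    rfl

theorem Gate.map_congr {f f' : Wire → Wire} {g : Gate} (h : ∀ w ∈ g.wires, f w = f' w) :
    g.map f = g.map f' := by
  cases g <;> simp_all [Gate.map, Gate.wires]

theorem mapCircuit_congr {f f' : Wire → Wire} {C : Circuit}
    (h : ∀ g ∈ C, ∀ w ∈ g.wires, f w = f' w) : mapCircuit f C = mapCircuit f' C :=
  List.map_congr_left fun g hg => Gate.map_congr (h g hg)

theorem mapCircuit_id (C : Circuit) : mapCircuit id C = C :=
  (List.map_congr_left fun g _ => by cases g <;> rfl).trans (List.map_id C)

theorem mapCircuit_mapCircuit (f f' : Wire → Wire) (C : Circuit) :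
    mapCircuit f (mapCircuit f' C) = mapCircuit (fun w => f (f' w)) C := by
  rw [mapCircuit, mapCircuit, List.map_map]
  exact List.map_congr_left fun g _ => by cases g <;> rfl

theorem mapCircuit_append (f : Wire → Wire) (C D : Circuit) :
    mapCircuit f (C ++ D) = mapCircuit f C ++ mapCircuit f D := List.map_append

theorem Gate.wires_map (f : Wire → Wire) (g : Gate) : (g.map f).wires = g.wires.map f := by
  cases g <;> rfl

/-- A linear map that commutes with `flipL w` and `bitL w` for the qubits `w` of `C` commutes
with `C`. -/
theorem commute_run {J : Ket →ₗ[ℂ] Ket} {C : Circuit}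
    (hF : ∀ g ∈ C, ∀ w ∈ g.wires, ∀ ψ, J (flipL w ψ) = flipL w (J ψ))
    (hB : ∀ g ∈ C, ∀ w ∈ g.wires, ∀ ψ, J (bitL w ψ) = bitL w (J ψ)) (ψ : Ket) :
    J (run C ψ) = run C (J ψ) := by
  rw [intertwine_run (f := id) hF hB, mapCircuit_id]

theorem run_renK {f : Wire → Wire} (hf : Injective f) (C : Circuit) (ψ : Ket) :
    run (mapCircuit f C) (renK f ψ) = renK f (run C ψ) := by
  refine (intertwine_run (fun g _ w _ φ => ?_) (fun g _ w _ φ => ?_) ψ).symm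
  · simp only [renK, flipL, pushL_pushL, image_flip hf]
  · simp only [renK, bitL, restrict_pushL, Finset.mem_image, hf.eq_iff, exists_eq_right]

theorem restrict_run {p : Basis → Prop} {C : Circuit}
    (hp : ∀ g ∈ C, ∀ w ∈ g.wires, ∀ S, p (flip w S) ↔ p S) (ψ : Ket) :
    restrict p (run C ψ) = run C (restrict p ψ) := by
  refine commute_run (fun g hg w hw φ => ?_) (fun g _ w _ φ => restrict_comm _ _ _) ψ
  simp only [flipL, restrict_pushL, hp g hg w hw]

theorem flipL_run {t : Wire} {C : Circuit} (ht : ∀ g ∈ C, t ∉ g.wires) (ψ : Ket) :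
    flipL t (run C ψ) = run C (flipL t ψ) := by
  refine commute_run (fun g hg w hw φ => ?_) (fun g hg w hw φ => ?_) ψ
  · simp only [flipL, pushL_pushL, flip_comm]
  · have : w ≠ t := fun h => ht g hg (h ▸ hw)
    simp [flipL, bitL, restrict_pushL, mem_flip, this]

theorem bitL_run {t : Wire} {C : Circuit} (ht : ∀ g ∈ C, t ∉ g.wires) (ψ : Ket) :
    bitL t (run C ψ) = run C (bitL t ψ) := by
  refine restrict_run (fun g hg w hw S => ?_) ψ
  have : t ≠ w := fun h => ht g hg (h ▸ hw)
  simp [mem_flip, this]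

/-- Circuits on disjoint sets of qubits commute. -/
theorem run_comm {C D : Circuit} (h : ∀ g ∈ C, ∀ g' ∈ D, ∀ w ∈ g.wires, w ∉ g'.wires) (ψ : Ket) :
    run C (run D ψ) = run D (run C ψ) := by
  rw [← runL_apply D, ← runL_apply D]
  refine (commute_run (J := runL D) (fun g hg w hw φ => ?_) (fun g hg w hw φ => ?_) ψ).symm
  · rw [runL_apply, runL_apply, flipL_run fun g' hg' => h g hg g' hg' w hw]
  · rw [runL_apply, runL_apply, bitL_run fun g' hg' => h g hg g' hg' w hw]

theorem flipL_flipL (t : Wire) (ψ : Ket) : flipL t (flipL t ψ) = ψ := by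
  rw [flipL, pushL_pushL]
  exact pushL_eq_self fun S _ => flip_flip t S

/-! ### Inverse circuits -/

theorem flipL_mul_self (t : Wire) : (flipL t : Module.End ℂ Ket) * flipL t = 1 :=
  LinearMap.ext (flipL_flipL t)

theorem bitL_mul_self (t : Wire) : (bitL t : Module.End ℂ Ket) * bitL t = bitL t :=
  LinearMap.ext fun ψ => by simp [bitL, restrict_restrict]

theorem bitL_mul_comm (t u : Wire) : (bitL t : Module.End ℂ Ket) * bitL u = bitL u * bitL t :=
  LinearMap.ext (restrict_comm _ _)

theorem flipL_mul_bitL {t u : Wire} (h : u ≠ t) :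
    (flipL t : Module.End ℂ Ket) * bitL u = bitL u * flipL t :=
  LinearMap.ext fun ψ => by simp [flipL, bitL, restrict_pushL, mem_flip, h]

theorem bitL_mul_flipL_self (t : Wire) :
    (bitL t : Module.End ℂ Ket) * flipL t = flipL t - flipL t * bitL t := by
  refine ket_hom_ext fun S => ?_
  by_cases h : t ∈ S <;> simp [flipL_single, bitL_single, mem_flip, h]

/-- The square of a controlled operation, where `P` is the control and `F` an involution. -/
theorem control_mul_self {A : Type*} [Ring A] {F P : A} (hF : F * F = 1)
    (hP : P * P = P) (hFP : F * P = P * F) :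
    (F * P + (1 - P)) * (F * P + (1 - P)) = 1 := by
  have e₂ : F * P * P = F * P := by rw [mul_assoc, hP]
  have e₃ : P * (F * P) = F * P := by rw [← mul_assoc, ← hFP, e₂]
  have e₁ : F * P * (F * P) = P := by rw [mul_assoc, e₃, ← mul_assoc, hF, one_mul]
  simp only [mul_add, add_mul, mul_sub, sub_mul, mul_one, one_mul, e₁, e₂, e₃, hP]
  abel

theorem phase_mul_phase {A : Type*} [Ring A] [Algebra ℂ A] {u v : ℂ} {P : A} (huv : u * v = 1)
    (hP : P * P = P) : (1 - P + u • P) * (1 - P + v • P) = 1 := by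
  simp only [mul_add, add_mul, mul_sub, sub_mul, mul_one, one_mul, smul_mul_assoc,
    mul_smul_comm, hP, smul_add, smul_sub, smul_smul, mul_comm v u, huv, one_smul]
  abel

theorem hadamard_mul_self {A : Type*} [Ring A] [Algebra ℂ A] {F P : A} (hF : F * F = 1) 
    (hP : P * P = P) (hPF : P * F = F - F * P) {z : ℂ} (hz : z * z = 1 / 2) :
    (z • (F + (1 - 2 * P))) * (z • (F + (1 - 2 * P))) = 1 := by
  have e : (F + (1 - 2 * P)) * (F + (1 - 2 * P)) = (2 : ℂ) • (1 : A) := by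
    simp only [two_mul, mul_add, add_mul, mul_sub, sub_mul, mul_one, one_mul, hF, hP, hPF,
      two_smul]
    abel
  rw [smul_mul_smul_comm, hz, e, smul_smul]
  norm_num

theorem Gate.apply_inv_apply {g : Gate} (hg : g.wires.Nodup) (ψ : Ket) :
    g.inv.apply (g.apply ψ) = ψ := by
  suffices H : g.inv.toEnd * g.toEnd = 1 by
    rw [Gate.apply_eq, Gate.apply_eq]
    exact LinearMap.congr_fun H ψ
  have hexp : Complex.exp (-(Complex.I * (Real.pi : ℂ) / 4)) *
      Complex.exp (Complex.I * (Real.pi : ℂ) / 4) = 1 := by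
    rw [← Complex.exp_add, neg_add_cancel, Complex.exp_zero]
  cases g with
  | X t => exact flipL_mul_self t
  | H t =>
    have hs : (1 / (Real.sqrt 2 : ℂ)) * (1 / (Real.sqrt 2 : ℂ)) = 1 / 2 := by
      rw [div_mul_div_comm, ← Complex.ofReal_mul, Real.mul_self_sqrt (by norm_num)]
      norm_num
    exact hadamard_mul_self (A := Module.End ℂ Ket) (flipL_mul_self t) (bitL_mul_self t)
      (bitL_mul_flipL_self t) hs
  | T t => exact phase_mul_phase (A := Module.End ℂ Ket) hexp (bitL_mul_self t)
  | Tdg t =>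
    exact phase_mul_phase (A := Module.End ℂ Ket) (by rw [mul_comm, hexp])
      (bitL_mul_self t)
  | cnot c t =>
    simp only [Gate.wires, List.nodup_cons, List.mem_singleton] at hg
    exact control_mul_self (A := Module.End ℂ Ket) (flipL_mul_self t) (bitL_mul_self c)
      (flipL_mul_bitL hg.1)
  | toffoli c₁ c₂ t =>
    simp only [Gate.wires, List.nodup_cons, List.mem_cons, List.not_mem_nil, or_false,
      not_or] at hg
    refine control_mul_self (A := Module.End ℂ Ket) (flipL_mul_self t) ?_ ?_
    · rw [mul_assoc, ← mul_assoc (bitL c₂), bitL_mul_comm c₂ c₁, mul_assoc (bitL c₁),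
        ← mul_assoc, bitL_mul_self, bitL_mul_self]
    · rw [← mul_assoc, flipL_mul_bitL hg.1.2, mul_assoc, flipL_mul_bitL hg.2.1, mul_assoc]

theorem Gate.wires_inv (g : Gate) : g.inv.wires = g.wires := by cases g <;> rfl

theorem Gate.inv_inv (g : Gate) : g.inv.inv = g := by cases g <;> rfl

theorem Gate.inv_map (f : Wire → Wire) (g : Gate) : (g.map f).inv = g.inv.map f := by
  cases g <;> rfl

theorem run_inv_run {C : Circuit} (hC : ∀ g ∈ C, g.wires.Nodup) (ψ : Ket) :
    run (invCircuit C) (run C ψ) = ψ := by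
  induction C generalizing ψ with
  | nil => rfl
  | cons g C ih =>
    have e : invCircuit (g :: C) = invCircuit C ++ [g.inv] := by simp [invCircuit]
    rw [e, run_append, run_cons, run_cons g C,
      ih fun g' h => hC g' (List.mem_cons_of_mem _ h)]
    exact Gate.apply_inv_apply (hC g List.mem_cons_self) ψ

theorem invCircuit_invCircuit (C : Circuit) : invCircuit (invCircuit C) = C := by
  simp [invCircuit, Function.comp_def, Gate.inv_inv]

theorem mapCircuit_invCircuit (f : Wire → Wire) (C : Circuit) :
    mapCircuit f (invCircuit C) = invCircuit (mapCircuit f C) := by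
  simp [invCircuit, mapCircuit, Gate.inv_map]

theorem mem_invCircuit {g : Gate} {C : Circuit} (hg : g ∈ invCircuit C) :
    ∃ g' ∈ C, g'.wires = g.wires := by
  simp only [invCircuit, List.mem_reverse, List.mem_map] at hg
  obtain ⟨g', h, rfl⟩ := hg
  exact ⟨g', h, g'.wires_inv.symm⟩

theorem run_run_inv {C : Circuit} (hC : ∀ g ∈ C, g.wires.Nodup) (ψ : Ket) :
    run C (run (invCircuit C) ψ) = ψ := by
  have h := run_inv_run (C := invCircuit C) (fun g hg => by
    obtain ⟨g', h, e⟩ := mem_invCircuit hg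
    exact e ▸ hC g' h) ψ
  rwa [invCircuit_invCircuit] at h


/-! ### Norms -/

theorem normSq_eq_sum {ψ : Ket} {s : Finset Basis} (h : ψ.support ⊆ s) :
    normSq ψ = ∑ S ∈ s, ‖ψ S‖ ^ 2 :=
  Finset.sum_subset h fun S _ hS => by simp [Finsupp.notMem_support_iff.1 hS]

theorem normSq_nonneg (ψ : Ket) : 0 ≤ normSq ψ := Finset.sum_nonneg fun _ _ => by positivity

theorem support_restrict_subset (p : Basis → Prop) (ψ : Ket) :
    (restrict p ψ).support ⊆ ψ.support := fun S hS => by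
  simp only [Finsupp.mem_support_iff, restrict_apply] at hS ⊢
  exact fun h => hS (by simp [h])

theorem normSq_restrict_add (p : Basis → Prop) (ψ : Ket) :
    normSq (restrict p ψ) + normSq (restrict (fun S => ¬ p S) ψ) = normSq ψ := by
  rw [normSq_eq_sum (support_restrict_subset p ψ), normSq_eq_sum (support_restrict_subset _ ψ),
    normSq, ← Finset.sum_add_distrib]
  refine Finset.sum_congr rfl fun S _ => ?_
  by_cases h : p S <;> simp [restrict_apply, h]

theorem normSq_restrict_le (p : Basis → Prop) (ψ : Ket) : normSq (restrict p ψ) ≤ normSq ψ := by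
  linarith [normSq_restrict_add p ψ, normSq_nonneg (restrict (fun S => ¬ p S) ψ)]

theorem normSq_smul (z : ℂ) (ψ : Ket) : normSq (z • ψ) = ‖z‖ ^ 2 * normSq ψ := by
  rw [normSq_eq_sum Finsupp.support_smul, normSq, Finset.mul_sum]
  exact Finset.sum_congr rfl fun S _ => by simp [mul_pow]

theorem normSq_add_add_normSq_sub (φ ψ : Ket) :
    normSq (φ + ψ) + normSq (φ - ψ) = 2 * normSq φ + 2 * normSq ψ := by
  classical
  rw [normSq_eq_sum (Finsupp.support_add (g₁ := φ) (g₂ := ψ)),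
    normSq_eq_sum (Finsupp.support_sub (f := φ) (g := ψ)),
    normSq_eq_sum (Finset.subset_union_left (s₁ := φ.support) (s₂ := ψ.support)),
    normSq_eq_sum (Finset.subset_union_right (s₁ := φ.support) (s₂ := ψ.support)),
    Finset.mul_sum, Finset.mul_sum, ← Finset.sum_add_distrib, ← Finset.sum_add_distrib]
  refine Finset.sum_congr rfl fun S _ => ?_
  have := parallelogram_law_with_norm ℂ (φ S) (ψ S)
  simp only [Finsupp.add_apply, Finsupp.sub_apply]
  linarith

theorem normSq_add_le (φ ψ : Ket) : normSq (φ + ψ) ≤ 2 * normSq φ + 2 * normSq ψ := by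
  linarith [normSq_add_add_normSq_sub φ ψ, normSq_nonneg (φ - ψ)]

theorem normSq_pushL {h : Basis → Basis} (hh : Injective h) (ψ : Ket) :
    normSq (pushL h ψ) = normSq ψ :=
  Finsupp.sum_mapDomain_index_inj (h := fun _ z => ‖z‖ ^ 2) hh

theorem normSq_flipL (t : Wire) (ψ : Ket) : normSq (flipL t ψ) = normSq ψ :=
  normSq_pushL (Involutive.injective (flip_flip t)) ψ

theorem normSq_renK {f : Wire → Wire} (hf : Injective f) (ψ : Ket) :
    normSq (renK f ψ) = normSq ψ :=
  normSq_pushL (Finset.image_injective hf) ψ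

theorem Gate.normSq_apply {g : Gate} (hg : g.wires.Nodup) (ψ : Ket) :
    normSq (g.apply ψ) = normSq ψ := by
  -- Controlled operations and phases: compare the two parts with and without the property `p`.
  have split : ∀ (p : Basis → Prop) (φ : Ket), normSq (restrict p φ) = normSq (restrict p ψ) →
      restrict (fun S => ¬ p S) φ = restrict (fun S => ¬ p S) ψ → normSq φ = normSq ψ := by
    intro p φ h₁ h₂
    rw [← normSq_restrict_add p φ, h₁, h₂, normSq_restrict_add]
  have phase : ∀ (u : ℂ) (t : Wire), ‖u‖ = 1 → normSq (ψ - bitL t ψ + u • bitL t ψ) = normSq ψ := by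
    intro u t hu
    refine split (t ∈ ·) _ ?_ ?_
    · trans normSq (u • restrict (t ∈ ·) ψ)
      · congr 1
        simp [bitL, restrict_restrict]
      · rw [normSq_smul, hu, one_pow, one_mul]
    · ext S
      by_cases h : t ∈ S <;> simp [restrict_apply, bitL, h]
  have ctrl : ∀ (p : Basis → Prop) (t : Wire), (∀ S, p (flip t S) ↔ p S) →
      normSq (flipL t (restrict p ψ) + (ψ - restrict p ψ)) = normSq ψ := by
    intro p t hp
    have e : ∀ q : Basis → Prop, (∀ S, q (flip t S) ↔ q S) → ∀ φ,
        restrict q (flipL t φ) = flipL t (restrict q φ) := fun q hq φ => by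
      rw [flipL, restrict_pushL]
      simp only [hq]
    refine split p _ ?_ ?_
    · trans normSq (flipL t (restrict p ψ))
      · congr 1
        simp [e p hp, restrict_restrict]
      · rw [normSq_flipL]
    · rw [map_add, e _ fun S => not_congr (hp S)]
      ext S
      have h₀ : restrict (fun S => ¬ p S) (restrict p ψ) = 0 := by
        ext S
        by_cases h : p S <;> simp [restrict_apply, h]
      rw [h₀, map_zero]
      by_cases h : p S <;> simp [restrict_apply, h]
  have phaseNorm : ∀ z : ℝ, ‖Complex.exp (Complex.I * (z : ℂ))‖ = 1 := fun z => by
    rw [mul_comm, Complex.norm_exp_ofReal_mul_I]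
  rw [Gate.apply_eq]
  cases g with
  | X t => exact normSq_flipL t ψ
  | T t =>
    refine phase _ t ?_
    convert phaseNorm (Real.pi / 4) using 3
    push_cast
    ring
  | Tdg t =>
    refine phase _ t ?_
    convert phaseNorm (-(Real.pi / 4)) using 3
    push_cast
    ring
  | cnot c t =>
    simp only [Gate.wires, List.nodup_cons, List.mem_singleton] at hg
    exact ctrl (c ∈ ·) t fun S => by simp [mem_flip, hg.1]
  | toffoli c₁ c₂ t =>
    simp only [Gate.wires, List.nodup_cons, List.mem_cons, List.not_mem_nil, or_false,
      not_or] at hg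
    have h := ctrl (fun S => c₁ ∈ S ∧ c₂ ∈ S) t fun S => by
      simp [mem_flip, hg.1.2, hg.2.1]
    rw [← restrict_restrict] at h
    exact h
  | H t =>
    -- `H = (F + Z) / √2`, where `F + Z` and `F - Z` have the same norm since `F` and `Z`
    -- are anticommuting isometric involutions.
    set Z : Ket → Ket := fun φ => φ - (2 : ℂ) • bitL t φ with hZ
    have hZnorm : ∀ φ, normSq (Z φ) = normSq φ := fun φ => by
      have : Z φ = restrict (fun S => ¬ t ∈ S) φ - restrict (t ∈ ·) φ := by
        ext S
        by_cases h : t ∈ S <;> simp [hZ, bitL, restrict_apply, h]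
        ring
      rw [this, ← normSq_restrict_add (t ∈ ·) φ, ← normSq_restrict_add (t ∈ ·) (_ - _), map_sub,
        map_sub, restrict_restrict, restrict_restrict, restrict_restrict, restrict_restrict]
      have h₀ : restrict (fun S : Basis => t ∈ S ∧ ¬ t ∈ S) φ = 0 := by
        ext S; simp [restrict_apply]
      have h₁ : restrict (fun S : Basis => ¬ t ∈ S ∧ t ∈ S) φ = 0 := by
        ext S; simp [restrict_apply]
      rw [h₀, h₁, zero_sub, sub_zero, ← neg_one_smul ℂ, normSq_smul]
      simp
    have hFZ : ∀ φ, Z (flipL t φ) = - flipL t (Z φ) := fun φ => by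
      have := LinearMap.congr_fun (bitL_mul_flipL_self t) φ
      simp only [Module.End.mul_apply, LinearMap.sub_apply] at this
      simp only [hZ, this, map_sub, map_add, two_smul]
      abel
    have hsame : normSq (flipL t ψ - Z ψ) = normSq (flipL t ψ + Z ψ) := by
      have : Z (flipL t ψ - Z ψ) = (-1 : ℂ) • flipL t (flipL t ψ + Z ψ) := by
        have hZZ : Z (Z ψ) = ψ := by
          ext S
          by_cases h : t ∈ S <;> simp [hZ, bitL, restrict_apply, h]
          ring
        have hsub : Z (flipL t ψ - Z ψ) = Z (flipL t ψ) - Z (Z ψ) := by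
          simp only [hZ, map_sub, smul_sub]
          abel
        rw [hsub, hFZ, hZZ, map_add, flipL_flipL, neg_one_smul]
        abel
      rw [← hZnorm, this, normSq_smul, normSq_flipL]
      simp
    have hpar := normSq_add_add_normSq_sub (flipL t ψ) (Z ψ)
    rw [hsame, normSq_flipL, hZnorm] at hpar
    have hz : ‖(1 / (Real.sqrt 2 : ℂ))‖ ^ 2 = 1 / 2 := by
      rw [norm_div, Complex.norm_real, norm_one, div_pow, Real.norm_eq_abs, sq_abs,
        Real.sq_sqrt (by norm_num), one_pow]
    have hH : (Gate.H t).toEnd ψ = (1 / (Real.sqrt 2 : ℂ)) • (flipL t ψ + Z ψ) := by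
      have two : (2 : Module.End ℂ Ket) (bitL t ψ) = (2 : ℂ) • bitL t ψ := by
        rw [two_smul, ← one_add_one_eq_two]; rfl
      simp only [Gate.toEnd, LinearMap.smul_apply, LinearMap.add_apply, LinearMap.sub_apply,
        Module.End.mul_apply, Module.End.one_apply, two, hZ]
    rw [hH, normSq_smul, hz]
    linarith

theorem normSq_run {C : Circuit} (hC : ∀ g ∈ C, g.wires.Nodup) (ψ : Ket) :
    normSq (run C ψ) = normSq ψ := by
  induction C generalizing ψ with
  | nil => rfl
  | cons g C ih =>
    rw [run_cons, ih fun g' h => hC g' (List.mem_cons_of_mem _ h),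
      Gate.normSq_apply (hC g List.mem_cons_self)]

theorem acceptProb_eq (V P : Party) (ψ : Ket) :
    acceptProb V P ψ = normSq (restrict (outWire ∈ ·) (finalState V P ψ)) := by
  rw [acceptProb, normSq_eq_sum (support_restrict_subset _ _), Finset.sum_filter]
  refine Finset.sum_congr rfl fun S _ => ?_
  by_cases h : outWire ∈ S <;> simp [restrict_apply, h]


/-! ### Registers on which circuits and states live -/

/-- All qubits outside the registers in `G` are in state `|0⟩`. -/
def SupportedOn (G : List Reg) (ψ : Ket) : Prop := ∀ S ∈ ψ.support, ∀ w ∈ S, w.1 ∈ G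

theorem supportedOn_iff {G : List Reg} {ψ : Ket} :
    SupportedOn G ψ ↔ restrict (fun S => ∀ w ∈ S, w.1 ∈ G) ψ = ψ := restrict_eq_self_iff.symm

theorem SupportedOn.mono {G G' : List Reg} {ψ : Ket} (h : SupportedOn G ψ) (hG : G ⊆ G') :
    SupportedOn G' ψ := fun S hS w hw => hG (h S hS w hw)

theorem forall_mem_flip_iff {G : List Reg} {t : Wire} (ht : t.1 ∈ G) (S : Basis) :
    (∀ w ∈ flip t S, w.1 ∈ G) ↔ ∀ w ∈ S, w.1 ∈ G := by
  refine forall_congr' fun w => ?_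
  by_cases h : w = t
  · simp [h, ht]
  · simp [mem_flip, h]

theorem SupportedOn.run {G : List Reg} {C : Circuit} {ψ : Ket} (h : SupportedOn G ψ)
    (hC : ActsOn C G) : SupportedOn G (run C ψ) := by
  rw [supportedOn_iff] at h ⊢
  rw [restrict_run fun g hg w hw S => forall_mem_flip_iff ((hC g hg).2 w hw) S, h]

theorem SupportedOn.flipL {G : List Reg} {t : Wire} {ψ : Ket} (h : SupportedOn G ψ)
    (ht : t.1 ∈ G) : SupportedOn G (flipL t ψ) := by
  rw [supportedOn_iff] at h ⊢
  simp only [QIA.flipL, restrict_pushL, forall_mem_flip_iff ht]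
  rw [h]

theorem SupportedOn.restrict {G : List Reg} {ψ : Ket} (h : SupportedOn G ψ) (p : Basis → Prop) :
    SupportedOn G (restrict p ψ) := fun S hS => h S (support_restrict_subset p ψ hS)

theorem mem_support_pushL {h : Basis → Basis} {ψ : Ket} {S : Basis} (hS : S ∈ (pushL h ψ).support) :
    ∃ S' ∈ ψ.support, h S' = S := by
  classical
  exact Finset.mem_image.1 (Finsupp.mapDomain_support hS)

theorem ActsOn.mono {C : Circuit} {G G' : List Reg} (h : ActsOn C G) (hG : G ⊆ G') :
    ActsOn C G' := fun g hg => ⟨(h g hg).1, fun w hw => hG ((h g hg).2 w hw)⟩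

theorem ActsOn.append {C D : Circuit} {G : List Reg} (hC : ActsOn C G) (hD : ActsOn D G) :
    ActsOn (C ++ D) G := fun g hg => (List.mem_append.1 hg).elim (hC g) (hD g)

theorem ActsOn.map {C : Circuit} {G G' : List Reg} (h : ActsOn C G) {f : Wire → Wire}
    (hf : Injective f) (hG : ∀ w : Wire, w.1 ∈ G → (f w).1 ∈ G') : ActsOn (mapCircuit f C) G' := by
  intro g hg
  obtain ⟨g, hg', rfl⟩ := List.mem_map.1 hg
  rw [Gate.wires_map]
  refine ⟨(h g hg').1.map hf, fun w hw => ?_⟩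
  obtain ⟨w, hw', rfl⟩ := List.mem_map.1 hw
  exact hG w ((h g hg').2 w hw')

theorem ActsOn.inv {C : Circuit} {G : List Reg} (h : ActsOn C G) : ActsOn (invCircuit C) G := by
  intro g hg
  obtain ⟨g', hg', e⟩ := mem_invCircuit hg
  exact e ▸ h g' hg'

theorem ActsOn.nodup {C : Circuit} {G : List Reg} (h : ActsOn C G) : ∀ g ∈ C, g.wires.Nodup :=
  fun g hg => (h g hg).1

theorem ActsOn.flatMap {ι : Type} {l : List ι} {C : ι → Circuit} {G : List Reg}
    (h : ∀ i ∈ l, ActsOn (C i) G) : ActsOn (l.flatMap C) G := fun g hg => by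
  obtain ⟨i, hi, hg⟩ := List.mem_flatMap.1 hg
  exact h i hi g hg

/-! ### Reversible classical circuits -/

theorem apply_X (t : Wire) : (Gate.X t).apply = flipL t := Gate.apply_eq _

theorem apply_cnot (c t : Wire) :
    (Gate.cnot c t).apply = pushL fun S => if c ∈ S then flip t S else S :=
  ket_hom_ext fun S => by simp [Gate.apply, Gate.onBasis]

theorem apply_toffoli (c₁ c₂ t : Wire) :
    (Gate.toffoli c₁ c₂ t).apply = pushL fun S => if c₁ ∈ S ∧ c₂ ∈ S then flip t S else S :=
  ket_hom_ext fun S => by simp [Gate.apply, Gate.onBasis]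

/-- The circuit that exchanges two qubits. -/
def swapGates (a b : Wire) : Circuit := [.cnot a b, .cnot b a, .cnot a b]

/-- The circuit that exchanges the qubits `a` and `b` if the qubit `c` is `1`. -/
def controlledSwap (c a b : Wire) : Circuit := [.cnot b a, .toffoli c a b, .cnot b a]

theorem mem_image_equiv (π : Equiv.Perm Wire) (S : Basis) (w : Wire) :
    w ∈ S.image π ↔ π.symm w ∈ S := by
  rw [← Finset.mem_map_equiv, Finset.map_eq_image]
  rfl

theorem run_swapGates {a b : Wire} (h : a ≠ b) (ψ : Ket) :
    run (swapGates a b) ψ = renK (Equiv.swap a b) ψ := by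
  rw [swapGates, run_cons, run_cons, run_cons, run_nil, apply_cnot, apply_cnot, pushL_pushL,
    pushL_pushL, renK]
  refine pushL_congr fun S _ => ?_
  ext w
  rw [mem_image_equiv, Equiv.symm_swap]
  by_cases ha : a ∈ S <;> by_cases hb : b ∈ S <;> by_cases hwa : w = a <;>
    by_cases hwb : w = b <;>
    simp_all [mem_flip, Equiv.swap_apply_of_ne_of_ne, h.symm]

theorem run_controlledSwap {a b c : Wire} (h : a ≠ b) (ha : c ≠ a) (ψ : Ket) :
    run (controlledSwap c a b) ψ =
      pushL (fun S => if c ∈ S then S.image (Equiv.swap a b) else S) ψ := by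
  rw [controlledSwap, run_cons, run_cons, run_cons, run_nil, apply_cnot, apply_toffoli,
    pushL_pushL, pushL_pushL]
  refine pushL_congr fun S _ => ?_
  by_cases hc : c ∈ S
  · rw [if_pos hc]
    ext w
    rw [mem_image_equiv, Equiv.symm_swap]
    by_cases ha : a ∈ S <;> by_cases hb : b ∈ S <;> by_cases hwa : w = a <;>
      by_cases hwb : w = b <;>
      simp_all [mem_flip, Equiv.swap_apply_of_ne_of_ne, h.symm]
  · rw [if_neg hc]
    by_cases hb' : b ∈ S <;> simp [hb', mem_flip, hc, ha, h.symm, flip_flip]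

/-! ### Exchanging many qubits -/

section Swap

variable (α β : Wire → Wire)

/-- The circuit that exchanges `α u` and `β u` for the `u` in a list. -/
def swapCircuit (l : List Wire) : Circuit := l.flatMap fun u => swapGates (α u) (β u)

/-- The same, controlled on the qubit `c`. -/
def controlledSwaps (c : Wire) (l : List Wire) : Circuit :=
  l.flatMap fun u => controlledSwap c (α u) (β u)

/-- The permutation that exchanges `α u` and `β u` for the `u` in a list. -/
def swapPerm : List Wire → Equiv.Perm Wire
  | [] => 1
  | u :: l => swapPerm l * Equiv.swap (α u) (β u)

theorem swapPerm_comm (l : List Wire) : swapPerm α β l = swapPerm β α l := by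
  induction l with
  | nil => rfl
  | cons u l ih => rw [swapPerm, swapPerm, ih, Equiv.swap_comm]

variable {α β}

theorem swapPerm_of_ne {l : List Wire} {w : Wire} (h : ∀ u ∈ l, w ≠ α u ∧ w ≠ β u) :
    swapPerm α β l w = w := by
  induction l with
  | nil => rfl
  | cons u l ih =>
    obtain ⟨h₁, h₂⟩ := h u List.mem_cons_self
    rw [swapPerm, Equiv.Perm.mul_apply, Equiv.swap_apply_of_ne_of_ne h₁ h₂,
      ih fun v hv => h v (List.mem_cons_of_mem _ hv)]

variable {G : Wire → Prop} (hα : Injective α) (hβ : Injective β)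
  (hd : ∀ u v, G u → G v → α u ≠ β v)
include hα hd

theorem swapPerm_left_of_notMem {l : List Wire} (hl : ∀ u ∈ l, G u) {u : Wire} (hu : G u)
    (h : u ∉ l) : swapPerm α β l (α u) = α u :=
  swapPerm_of_ne fun v hv => ⟨fun e => h (hα e ▸ hv), hd u v hu (hl v hv)⟩

include hβ

theorem swapPerm_left_of_mem {l : List Wire} (hl : ∀ u ∈ l, G u) (hn : l.Nodup) {u : Wire}
    (h : u ∈ l) : swapPerm α β l (α u) = β u := by
  induction l with
  | nil => simp at h
  | cons v l ih =>
    have hl' : ∀ u ∈ l, G u := fun u hu => hl u (List.mem_cons_of_mem _ hu)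
    rw [List.nodup_cons] at hn
    rw [swapPerm, Equiv.Perm.mul_apply]
    by_cases e : u = v
    · rw [e, Equiv.swap_apply_left, swapPerm_comm,
        swapPerm_left_of_notMem hβ (fun u v hu hv => (hd v u hv hu).symm) hl'
          (hl v List.mem_cons_self) hn.1]
    · rw [Equiv.swap_apply_of_ne_of_ne (fun h => e (hα h))
        (hd u v (hl u h) (hl v List.mem_cons_self)),
        ih hl' hn.2 ((List.mem_cons.1 h).resolve_left e)]

theorem swapPerm_left {l : List Wire} (hl : ∀ u ∈ l, G u) (hn : l.Nodup) {u : Wire} (hu : G u) :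
    swapPerm α β l (α u) = if u ∈ l then β u else α u := by
  split_ifs with h
  · exact swapPerm_left_of_mem hα hβ hd hl hn h
  · exact swapPerm_left_of_notMem hα hd hl hu h

theorem swapPerm_right {l : List Wire} (hl : ∀ u ∈ l, G u) (hn : l.Nodup) {u : Wire} (hu : G u) :
    swapPerm α β l (β u) = if u ∈ l then α u else β u := by
  rw [swapPerm_comm]
  exact swapPerm_left hβ hα (fun u v hu hv => (hd v u hv hu).symm) hl hn hu

theorem swapPerm_swapPerm {l : List Wire} (hl : ∀ u ∈ l, G u) (hn : l.Nodup) (w : Wire) :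
    swapPerm α β l (swapPerm α β l w) = w := by
  by_cases h : ∃ u ∈ l, w = α u ∨ w = β u
  · obtain ⟨u, hu, rfl | rfl⟩ := h
    · rw [swapPerm_left hα hβ hd hl hn (hl u hu), if_pos hu,
        swapPerm_right hα hβ hd hl hn (hl u hu), if_pos hu]
    · rw [swapPerm_right hα hβ hd hl hn (hl u hu), if_pos hu,
        swapPerm_left hα hβ hd hl hn (hl u hu), if_pos hu]
  · have h' : ∀ u ∈ l, w ≠ α u ∧ w ≠ β u := by simpa only [not_exists, not_and, not_or] using h
    rw [swapPerm_of_ne h', swapPerm_of_ne h']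

end Swap

theorem renK_renK (f f' : Wire → Wire) (ψ : Ket) :
    renK f (renK f' ψ) = renK (fun w => f (f' w)) ψ := by
  simp only [renK, pushL_pushL, Finset.image_image]
  rfl

theorem renK_congr {f f' : Wire → Wire} {ψ : Ket} (h : ∀ S ∈ ψ.support, ∀ w ∈ S, f w = f' w) :
    renK f ψ = renK f' ψ :=
  pushL_congr fun S hS => Finset.image_congr fun w hw => h S hS w hw

theorem run_swapCircuit {α β : Wire → Wire} {l : List Wire} (h : ∀ u ∈ l, α u ≠ β u) (ψ : Ket) :
    run (swapCircuit α β l) ψ = renK (swapPerm α β l) ψ := by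
  induction l generalizing ψ with
  | nil => exact (pushL_eq_self fun S _ => Finset.image_id).symm
  | cons u l ih =>
    rw [swapCircuit, List.flatMap_cons, run_append, run_swapGates (h u List.mem_cons_self)]
    exact (ih (fun v hv => h v (List.mem_cons_of_mem _ hv)) _).trans (renK_renK _ _ _)

theorem run_controlledSwaps {α β : Wire → Wire} {c : Wire} {l : List Wire}
    (h : ∀ u ∈ l, α u ≠ β u ∧ c ≠ α u ∧ c ≠ β u) (ψ : Ket) :
    run (controlledSwaps α β c l) ψ =
      pushL (fun S => if c ∈ S then S.image (swapPerm α β l) else S) ψ := by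
  induction l generalizing ψ with
  | nil =>
    refine (pushL_eq_self fun S _ => ?_).symm
    split_ifs
    · exact Finset.image_id
    · rfl
  | cons u l ih =>
    obtain ⟨h₁, h₂, h₃⟩ := h u List.mem_cons_self
    rw [controlledSwaps, List.flatMap_cons, run_append, run_controlledSwap h₁ h₂]
    refine (ih (fun v hv => h v (List.mem_cons_of_mem _ hv)) _).trans ?_
    rw [pushL_pushL]
    refine pushL_congr fun S _ => ?_
    by_cases hc : c ∈ S
    · have : c ∈ S.image (Equiv.swap (α u) (β u)) := by
        rwa [mem_image_equiv, Equiv.symm_swap, Equiv.swap_apply_of_ne_of_ne h₂ h₃]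
      rw [if_pos hc, if_pos this, if_pos hc, Finset.image_image]
      rfl
    · rw [if_neg hc, if_neg hc, if_neg hc]

/-- The qubits with index less than `N` of the registers in `X`. -/
def wireList (X : List Reg) (N : ℕ) : List Wire :=
  X.flatMap fun r => (List.range N).map fun i => (r, i)

theorem mem_wireList {X : List Reg} {N : ℕ} {w : Wire} :
    w ∈ wireList X N ↔ w.1 ∈ X ∧ w.2 < N := by
  obtain ⟨r, i⟩ := w
  simp [wireList]

theorem nodup_wireList {X : List Reg} (hX : X.Nodup) (N : ℕ) : (wireList X N).Nodup := by
  rw [wireList, List.nodup_flatMap]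
  refine ⟨fun r _ => List.nodup_range.map fun i j h => (Prod.mk.inj h).2, hX.imp fun h => ?_⟩
  intro w h₁ h₂
  simp only [List.mem_map] at h₁ h₂
  obtain ⟨i, -, rfl⟩ := h₁
  obtain ⟨j, -, e⟩ := h₂
  exact h (Prod.mk.inj e).1.symm

theorem actsOn_swapCircuit {α β : Wire → Wire} {l : List Wire} {G : List Reg}
    (h : ∀ u ∈ l, α u ≠ β u ∧ (α u).1 ∈ G ∧ (β u).1 ∈ G) : ActsOn (swapCircuit α β l) G := by
  refine ActsOn.flatMap fun u hu g hg => ?_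
  obtain ⟨h₁, h₂, h₃⟩ := h u hu
  simp only [swapGates, List.mem_cons, List.not_mem_nil, or_false] at hg
  rcases hg with rfl | rfl | rfl <;> simp [Gate.wires, h₁, h₁.symm, h₂, h₃]

theorem actsOn_controlledSwaps {α β : Wire → Wire} {c : Wire} {l : List Wire} {G : List Reg}
    (hc : c.1 ∈ G)
    (h : ∀ u ∈ l, (α u ≠ β u ∧ c ≠ α u ∧ c ≠ β u) ∧ (α u).1 ∈ G ∧ (β u).1 ∈ G) :
    ActsOn (controlledSwaps α β c l) G := by
  refine ActsOn.flatMap fun u hu g hg => ?_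
  obtain ⟨⟨h₁, h₂, h₃⟩, h₄, h₅⟩ := h u hu
  simp only [controlledSwap, List.mem_cons, List.not_mem_nil, or_false] at hg
  rcases hg with rfl | rfl | rfl <;> simp [Gate.wires, h₁, h₁.symm, h₂, h₃, h₄, h₅, hc]


/-! ### The compiled verifier -/

/-- The register of the compiled protocol that takes the qubits of a register of the original one:
the first message of the compiled protocol consists of `M₀`, `W` and `E`, the third one of `R` and
`M₁`. -/
def packReg : Reg → Reg
  | .A => .A
  | .M₀ | .W | .E => .M₀
  | .R | .M₁ => .M₁

/-- The number of registers that share the target of a register under `packReg`. -/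
def packScale : Reg → ℕ
  | .A => 1
  | .M₀ | .W | .E => 3
  | .R | .M₁ => 2

/-- The rank of a register among those with the same target under `packReg`. -/
def packShift : Reg → ℕ
  | .A | .M₀ | .R => 0
  | .W | .M₁ => 1
  | .E => 2

/-- The place in the messages of the compiled protocol where a qubit of the original protocol is
kept; the qubits of registers with a common target are interleaved. -/
def pack : Wire → Wire := affineRename packReg packScale packShift

theorem pack_injective : Injective pack := by
  rintro ⟨r, i⟩ ⟨r', j⟩ h
  cases r <;> cases r' <;>
    simp [pack, affineRename, packReg, packScale, packShift] at h ⊢ <;> omega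

/-- The qubits that the verifier of the original protocol expects to be `0` at the beginning. -/
def zeroWires (N : ℕ) : List Wire :=
  (List.range N).flatMap fun i => [pack (.W, i), pack (.E, i), pack (.R, i)]

theorem mem_zeroWires {N : ℕ} {w : Wire} :
    w ∈ zeroWires N ↔ ∃ u : Wire, u.1 ∈ [Reg.W, Reg.E, Reg.R] ∧ u.2 < N ∧ w = pack u := by
  simp only [zeroWires, List.mem_flatMap, List.mem_range, List.mem_cons, List.not_mem_nil,
    or_false]
  constructor
  · rintro ⟨i, hi, rfl | rfl | rfl⟩
    exacts [⟨(.W, i), by simp, hi, rfl⟩, ⟨(.E, i), by simp, hi, rfl⟩, ⟨(.R, i), by simp, hi, rfl⟩]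
  · rintro ⟨⟨r, i⟩, hr, hi, rfl⟩
    refine ⟨i, hi, ?_⟩
    rcases hr with rfl | rfl | rfl <;> simp

/-- All qubits of a list are `0`. -/
def AllZero (l : List Wire) (S : Basis) : Prop := ∀ w ∈ l, w ∉ S

/-- The circuit that copies the qubit `j` of `W` to the qubit `j + 1` if the qubit `w` is `0`. -/
def checkStep (w : Wire) (j : ℕ) : Circuit := [.X w, .toffoli (.W, j) w (.W, j + 1), .X w]

/-- The circuit that carries the qubit `j` of `W` along a list of qubits as long as these
are `0`. -/
def zeroChain : ℕ → List Wire → Circuit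
  | _, [] => []
  | j, w :: l => checkStep w j ++ zeroChain (j + 1) l

theorem zeroChain_append (j : ℕ) (l l' : List Wire) :
    zeroChain j (l ++ l') = zeroChain j l ++ zeroChain (j + l.length) l' := by
  induction l generalizing j with
  | nil => rfl
  | cons w l ih =>
    simp only [List.cons_append, zeroChain, ih, List.append_assoc, List.length_cons]
    rw [Nat.add_assoc, Nat.add_comm 1]

theorem length_zeroWires (N : ℕ) : (zeroWires N).length = 3 * N := by
  simp [zeroWires, List.length_flatMap, Nat.mul_comm]

theorem zeroChain_zeroWires (N : ℕ) : zeroChain 1 (zeroWires N) =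
    loopCircuit (fun i => checkStep (pack (.W, i)) (3 * i + 1) ++
      checkStep (pack (.E, i)) (3 * i + 2) ++ checkStep (pack (.R, i)) (3 * i + 3)) N := by
  induction N with
  | zero => rfl
  | succ N ih =>
    have e : zeroWires (N + 1) =
        zeroWires N ++ [pack (.W, N), pack (.E, N), pack (.R, N)] := by
      simp [zeroWires, List.range_succ]
    rw [e, zeroChain_append, ih, length_zeroWires, Nat.add_comm 1]
    simp [loopCircuit, List.range_succ, zeroChain]

/-- The verifier of the compiled protocol. On outcome `1` of its coin, it undoes the first circuit
of the original verifier and checks that the private and reply qubits of the latter were `0`, with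
the result in `(W, 3 * N + 1)`; on outcome `0` it runs the second circuit of the original verifier.
The answer of the check is copied into `(W, 0)` before the first circuit is applied again, so that
the same circuit serves both outcomes. -/
def compile (V : Party) (N : ℕ) : Party where
  first := coinToss 1
  second := invCircuit (mapCircuit pack V.first) ++
    ((zeroChain 1 (zeroWires N) ++ [.cnot (.W, 3 * N + 1) (.W, 0)]) ++
      (mapCircuit pack V.first ++ (mapCircuit pack V.second ++
        [.X (.W, 1), .toffoli (.W, 1) (pack outWire) outWire])))

theorem actsOn_zeroChain (j : ℕ) {l : List Wire} (hl : ∀ w ∈ l, w.1 ∈ [Reg.M₀, Reg.M₁]) :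
    ActsOn (zeroChain j l) [.M₀, .W, .M₁] := by
  induction l generalizing j with
  | nil => exact fun g hg => by simp [zeroChain] at hg
  | cons w l ih =>
    refine ActsOn.append (fun g hg => ?_) (ih _ fun v hv => hl v (List.mem_cons_of_mem _ hv))
    obtain ⟨r, i⟩ := w
    have hw := hl (r, i) List.mem_cons_self
    simp only [List.mem_cons, List.not_mem_nil, or_false] at hw
    simp only [checkStep, List.mem_cons, List.not_mem_nil, or_false] at hg
    rcases hg with rfl | rfl | rfl <;> rcases hw with rfl | rfl <;> simp [Gate.wires]

theorem actsOn_zeroChain_zeroWires (N : ℕ) : ActsOn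
    (zeroChain 1 (zeroWires N) ++ [.cnot (.W, 3 * N + 1) (.W, 0)]) [.M₀, .W, .M₁] := by
  refine (actsOn_zeroChain 1 fun w hw => ?_).append fun g hg => ?_
  · obtain ⟨⟨r, i⟩, hr, -, rfl⟩ := mem_zeroWires.1 hw
    simp only [List.mem_cons, List.not_mem_nil, or_false] at hr
    rcases hr with rfl | rfl | rfl <;> simp [pack, affineRename, packReg]
  · rw [List.mem_singleton] at hg
    subst hg
    simp [Gate.wires]

theorem packReg_mem {r : Reg} (h : r ∈ [Reg.M₀, Reg.W, Reg.E, Reg.R, Reg.M₁]) :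
    packReg r ∈ [Reg.M₀, Reg.M₁] := by
  cases r <;> simp [packReg] at h ⊢

theorem actsOn_pack_first {V : Party} (hV : V.IsVerifier) :
    ActsOn (mapCircuit pack V.first) [.M₀, .M₁] :=
  hV.1.map pack_injective fun w hw => packReg_mem (by simp at hw ⊢; tauto)

theorem actsOn_pack_second {V : Party} (hV : V.IsVerifier) :
    ActsOn (mapCircuit pack V.second) [.M₀, .M₁] :=
  hV.2.map pack_injective fun w hw => packReg_mem (by simp at hw ⊢; tauto)

theorem actsOn_accept : ActsOn [.X (.W, 1), .toffoli (.W, 1) (pack outWire) outWire]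
    [.M₀, .W, .M₁] := by
  intro g hg
  simp only [List.mem_cons, List.not_mem_nil, or_false] at hg
  rcases hg with rfl | rfl <;> simp [Gate.wires, pack, affineRename, packReg]

theorem isVerifier_compile {V : Party} (hV : V.IsVerifier) (N : ℕ) :
    (compile V N).IsVerifier := by
  have h₁ : ActsOn (mapCircuit pack V.first) [.M₀, .W, .M₁] :=
    (actsOn_pack_first hV).mono (by simp)
  have h₂ : ActsOn (mapCircuit pack V.second) [.M₀, .W, .M₁] :=
    (actsOn_pack_second hV).mono (by simp)
  refine ⟨fun g hg => ?_, h₁.inv.append ((actsOn_zeroChain_zeroWires N).append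
    (h₁.append (h₂.append actsOn_accept)))⟩
  simp only [compile, coinToss, List.range_one, List.flatMap_cons, List.flatMap_nil,
    List.append_nil, List.mem_cons, List.not_mem_nil, or_false] at hg
  rcases hg with rfl | rfl | rfl <;> simp [Gate.wires]

/-! ### The effect of the check -/

/-- The action of `zeroChain` on basis states. -/
def chainMap : ℕ → List Wire → Basis → Basis
  | _, [], S => S
  | j, w :: l, S =>
      chainMap (j + 1) l (if (.W, j) ∈ S ∧ w ∉ S then flip (.W, j + 1) S else S)

theorem run_checkStep {w : Wire} (hw : w.1 ≠ .W) (j : ℕ) (ψ : Ket) : run (checkStep w j) ψ =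
    pushL (fun S => if (.W, j) ∈ S ∧ w ∉ S then flip (.W, j + 1) S else S) ψ := by
  have h : ∀ k, ((Reg.W, k) : Wire) ≠ w := fun k e => hw (e ▸ rfl)
  rw [checkStep, run_cons, run_cons, run_cons, run_nil, apply_X, apply_toffoli, flipL, pushL_pushL,
    pushL_pushL]
  refine pushL_congr fun S _ => ?_
  simp only [mem_flip, h, ne_eq, not_true_eq_false, iff_false, not_false_eq_true, iff_true]
  split_ifs
  · rw [flip_comm, flip_flip]
  · rw [flip_flip]

theorem run_zeroChain {l : List Wire} (hl : ∀ w ∈ l, w.1 ≠ .W) (j : ℕ) (ψ : Ket) :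
    run (zeroChain j l) ψ = pushL (chainMap j l) ψ := by
  induction l generalizing j ψ with
  | nil => exact (pushL_eq_self fun S _ => rfl).symm
  | cons w l ih =>
    rw [zeroChain, run_append, run_checkStep (hl w List.mem_cons_self),
      ih fun v hv => hl v (List.mem_cons_of_mem _ hv), pushL_pushL]
    rfl

theorem chainMap_of_notMem {j : ℕ} {S : Basis} (h : ∀ k, j ≤ k → (Reg.W, k) ∉ S) (l : List Wire) :
    chainMap j l S = S := by
  induction l generalizing j with
  | nil => rfl
  | cons w l ih =>
    rw [chainMap, if_neg fun hc => h j le_rfl hc.1]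
    exact ih fun k hk => h k (by omega)

theorem mem_chainMap {l : List Wire} (hl : ∀ w ∈ l, w.1 ≠ .W) {j : ℕ} {S : Basis}
    (hj : (Reg.W, j) ∈ S) (h : ∀ k, j < k → (Reg.W, k) ∉ S) :
    ((Reg.W, j + l.length) ∈ chainMap j l S ↔ AllZero l S) ∧
      ∀ u : Wire, (∀ k, j < k → u ≠ (.W, k)) → (u ∈ chainMap j l S ↔ u ∈ S) := by
  induction l generalizing j S with
  | nil => simp [chainMap, hj, AllZero]
  | cons w l ih =>
    rw [chainMap]
    by_cases hw : w ∈ S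
    · rw [if_neg fun hc => hc.2 hw, chainMap_of_notMem fun k hk => h k hk]
      exact ⟨iff_of_false (h _ (by simp)) fun hz => hz w List.mem_cons_self hw, fun u _ => Iff.rfl⟩
    · rw [if_pos ⟨hj, hw⟩]
      have hl' : ∀ w ∈ l, w.1 ≠ .W := fun v hv => hl v (List.mem_cons_of_mem _ hv)
      obtain ⟨h₁, h₂⟩ := ih hl' (j := j + 1) (S := flip (.W, j + 1) S)
        (by simp [mem_flip, h]) fun k hk => by
          have := h k (by omega)
          have hne : k ≠ j + 1 := by omega
          simp [mem_flip, this, hne]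
      refine ⟨?_, fun u hu => ?_⟩
      · rw [List.length_cons, ← Nat.add_assoc, Nat.add_right_comm, h₁]
        simp only [AllZero, List.mem_cons, forall_eq_or_imp, hw, not_false_eq_true, true_and]
        refine forall₂_congr fun v hv => ?_
        have : v ≠ (.W, j + 1) := fun e => hl' v hv (e ▸ rfl)
        simp [mem_flip, this]
      · have := hu (j + 1) (by omega)
        rw [h₂ u fun k hk => hu k (by omega)]
        simp [mem_flip, this]

/-! ### The acceptance probability of the compiled verifier -/

theorem normSq_restrict_run_of_pushL {C : Circuit} (hC : ∀ g ∈ C, g.wires.Nodup)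
    {h : Basis → Basis} (hrun : ∀ ψ, run C ψ = pushL h ψ) (p : Basis → Prop) (ψ : Ket) :
    normSq (restrict p (run C ψ)) = normSq (restrict (fun S => p (h S)) ψ) := by
  rw [hrun, restrict_pushL, ← hrun, normSq_run hC]

theorem bitL_eq_zero {G : List Reg} {ψ : Ket} (h : SupportedOn G ψ) {t : Wire} (ht : t.1 ∉ G) :
    bitL t ψ = 0 := by
  ext S
  rw [bitL, restrict_apply]
  by_cases hS : ψ S = 0
  · simp [hS]
  · rw [if_neg fun hm => ht (h S (Finsupp.mem_support_iff.2 hS) t hm), Finsupp.zero_apply]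

theorem bitL_flipL_of_bitL_eq_zero {t : Wire} {ψ : Ket} (h : bitL t ψ = 0) :
    bitL t (flipL t ψ) = flipL t ψ := by
  have := LinearMap.congr_fun (bitL_mul_flipL_self t) ψ
  simpa [h] using this

theorem apply_cnot_of_bitL_eq_zero {c t : Wire} {ψ : Ket} (h : bitL c ψ = 0) :
    (Gate.cnot c t).apply ψ = ψ := by
  simp [Gate.apply_eq, Gate.toEnd, h]

theorem apply_cnot_of_bitL_eq_self {c t : Wire} {ψ : Ket} (h : bitL c ψ = ψ) :
    (Gate.cnot c t).apply ψ = flipL t ψ := by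
  simp [Gate.apply_eq, Gate.toEnd, h]

theorem bitL_flipL_of_ne {t u : Wire} (h : u ≠ t) (ψ : Ket) :
    bitL u (flipL t ψ) = flipL t (bitL u ψ) :=
  (LinearMap.congr_fun (flipL_mul_bitL h) ψ).symm

/-- The state after a coin toss is a superposition of the two outcomes. -/
theorem run_coinToss_one {G : List Reg} {ψ : Ket} (h : SupportedOn G ψ) (hE : Reg.E ∉ G) :
    run (coinToss 1) ψ = (1 / (Real.sqrt 2 : ℂ)) •
      (ψ + flipL (.E, 0) (flipL (.W, 1) (flipL (.R, 0) ψ))) := by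
  have hb : bitL (.E, 0) ψ = 0 := bitL_eq_zero h hE
  have hH : (Gate.H (.E, 0)).apply ψ = (1 / (Real.sqrt 2 : ℂ)) • (ψ + flipL (.E, 0) ψ) := by
    have : (2 : Module.End ℂ Ket) (bitL (.E, 0) ψ) = 0 := by rw [hb, map_zero]
    simp [Gate.apply_eq, Gate.toEnd, this, add_comm]
  have e : coinToss 1 = [.H (.E, 0), .cnot (.E, 0) (.W, 1), .cnot (.E, 0) (.R, 0)] := rfl
  have hf := bitL_flipL_of_bitL_eq_zero hb
  rw [e, run_cons, run_cons, run_cons, run_nil, hH, map_smul, map_smul, map_add, map_add,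
    apply_cnot_of_bitL_eq_zero hb, apply_cnot_of_bitL_eq_zero hb, apply_cnot_of_bitL_eq_self hf,
    apply_cnot_of_bitL_eq_self (by rw [bitL_flipL_of_ne (by simp), hf])]
  simp only [flipL, pushL_pushL, flip_comm]

theorem normSq_add_flipL {t : Wire} {φ ψ : Ket} (hφ : bitL t φ = 0) (hψ : bitL t ψ = 0) :
    normSq (φ + flipL t ψ) = normSq φ + normSq ψ := by
  have hf := bitL_flipL_of_bitL_eq_zero hψ
  have not_eq : ∀ χ, restrict (fun S => ¬ t ∈ S) χ = χ - bitL t χ := fun χ =>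
    eq_sub_of_add_eq' (restrict_add_restrict_not (t ∈ ·) χ)
  have h₁ : restrict (t ∈ ·) (φ + flipL t ψ) = flipL t ψ := by
    change bitL t _ = _
    rw [map_add, hφ, hf, zero_add]
  rw [← normSq_restrict_add (t ∈ ·), h₁, not_eq, map_add, hφ, hf, zero_add, add_sub_cancel_right,
    normSq_flipL, add_comm]

/-- The two tests of the compiled verifier are made with probability one half each. -/
theorem acceptProb_compile {V P : Party} (hV : V.IsVerifier) (hP : P.IsProver) (N : ℕ) {ψ : Ket}
    (hψ : IsAdvice ψ) : acceptProb (compile V N) P ψ =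
      (normSq (restrict (pack outWire ∈ ·)
          (run (mapCircuit pack V.second) (run P.second (run P.first ψ)))) +
        normSq (restrict (AllZero (zeroWires N))
          (run (invCircuit (mapCircuit pack V.first))
            (run P.second (flipL (.R, 0) (run P.first ψ)))))) / 2 := by
  set φ := run P.first ψ with hφ
  have hφs : SupportedOn [.A, .M₀, .M₁] φ :=
    SupportedOn.run (fun S hS w hw => by simp [hψ.2 S hS w hw]) hP.1
  set G : List Reg := [.A, .M₀, .M₁, .R] with hG
  have hφG : SupportedOn G φ := hφs.mono (by simp [hG])
  have hP₂ : ActsOn P.second G := hP.2.mono (by simp [hG])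
  set a := run P.second φ with ha
  set b := run P.second (flipL (.R, 0) φ) with hb
  have haG : SupportedOn G a := hφG.run hP₂
  have hbG : SupportedOn G b := (hφG.flipL (by simp [hG])).run hP₂
  have hV₁ := actsOn_pack_first hV
  have hV₂ := actsOn_pack_second hV
  have sub : [Reg.M₀, Reg.M₁] ⊆ G := by simp [hG]
  set U := mapCircuit pack V.first with hU
  set D := mapCircuit pack V.second with hD
  set Q : Circuit := zeroChain 1 (zeroWires N) ++ [.cnot (.W, 3 * N + 1) (.W, 0)] with hQ
  set Z : Circuit := [.X (.W, 1), .toffoli (.W, 1) (pack outWire) outWire] with hZ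
  -- The classical parts of the verifier.
  have hQa := actsOn_zeroChain_zeroWires N
  have zw : ∀ w ∈ zeroWires N, w.1 ≠ .W := fun w hw => by
    obtain ⟨⟨r, i⟩, hr, -, rfl⟩ := mem_zeroWires.1 hw
    simp only [List.mem_cons, List.not_mem_nil, or_false] at hr
    rcases hr with rfl | rfl | rfl <;> simp [pack, affineRename, packReg]
  let hQm : Basis → Basis := fun S => let S' := chainMap 1 (zeroWires N) S
    if (Reg.W, 3 * N + 1) ∈ S' then flip (.W, 0) S' else S'
  have runQ : ∀ χ, run Q χ = pushL hQm χ := fun χ => by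
    rw [hQ, run_append, run_zeroChain zw, run_cons, run_nil, apply_cnot, pushL_pushL]
  let hZm : Basis → Basis := fun S => let S' := flip (.W, 1) S
    if (Reg.W, 1) ∈ S' ∧ pack outWire ∈ S' then flip outWire S' else S'
  have runZ : ∀ χ, run Z χ = pushL hZm χ := fun χ => by
    rw [hZ, run_cons, run_cons, run_nil, apply_X, apply_toffoli, flipL, pushL_pushL]
  have packOut : ∀ k, pack outWire ≠ (Reg.W, k) := fun k => by
    simp [pack, affineRename, packReg]
  have run_second : ∀ χ, run (compile V N).second χ =
      run Z (run D (run U (run Q (run (invCircuit U) χ)))) := fun χ => by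
    simp only [compile, ← hU, ← hD, ← hQ, ← hZ, run_append]
  have noW : ∀ {χ : Ket}, SupportedOn G χ → ∀ S ∈ χ.support, ∀ k, (Reg.W, k) ∉ S :=
    fun h S hS k hk => by simpa [hG] using h S hS _ hk
  -- Outcome `0`: the check does nothing, and the answer of `V` is copied.
  have branch₀ : normSq (restrict (outWire ∈ ·) (run (compile V N).second a)) =
      normSq (restrict (pack outWire ∈ ·) (run D a)) := by
    have e : run Q (run (invCircuit U) a) = run (invCircuit U) a := by
      rw [runQ]
      refine pushL_eq_self fun S hS => ?_
      have := noW (haG.run (hV₁.inv.mono sub)) S hS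
      have hc : chainMap 1 (zeroWires N) S = S := chainMap_of_notMem (fun k _ => this k) _
      simp only [hQm, hc, if_neg (this _)]
    rw [run_second, e, run_run_inv hV₁.nodup,
      normSq_restrict_run_of_pushL actsOn_accept.nodup runZ]
    congr 1
    refine restrict_congr fun S hS => ?_
    have := noW (haG.run (hV₂.mono sub)) S hS
    by_cases ht : pack outWire ∈ S <;> simp [hZm, mem_flip, this, packOut, ht]
  -- Outcome `1`: the answer of the check is in the output qubit and stays there.
  have branch₁ : normSq (restrict (outWire ∈ ·) (run (compile V N).second (flipL (.W, 1) b))) =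
      normSq (restrict (AllZero (zeroWires N)) (run (invCircuit U) b)) := by
    set b₁ := run (invCircuit U) b with hb₁
    have hb₁G : SupportedOn G b₁ := hbG.run (hV₁.inv.mono sub)
    have notW : ∀ {C : Circuit}, ActsOn C [.M₀, .M₁] → ∀ k, ∀ g ∈ C, (Reg.W, k) ∉ g.wires :=
      fun h k g hg hk => by simpa using (h g hg).2 _ hk
    have e₁ : run (invCircuit U) (flipL (.W, 1) b) = flipL (.W, 1) b₁ :=
      (flipL_run (notW hV₁.inv 1) b).symm
    have e₂ : ∀ χ, run (Gate.X (.W, 1) :: Q) χ = pushL (fun S => hQm (flip (.W, 1) S)) χ :=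
      fun χ => by rw [run_cons, apply_X, runQ, flipL, pushL_pushL]
    have e₃ : run Q (flipL (.W, 1) b₁) = run (Gate.X (.W, 1) :: Q) b₁ := by
      rw [run_cons, apply_X]
    have key : ∀ S ∈ b₁.support, ((Reg.W, 1) ∈ hQm (flip (.W, 1) S)) ∧
        (outWire ∈ hQm (flip (.W, 1) S) ↔ AllZero (zeroWires N) S) := by
      intro S hS
      have hS' := noW hb₁G S hS
      obtain ⟨h₁, h₂⟩ := mem_chainMap zw (j := 1) (S := flip (.W, 1) S)
        (by simp [mem_flip, hS']) fun k hk => by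
          have hne : k ≠ 1 := by omega
          simp [mem_flip, hS', hne]
      rw [length_zeroWires, Nat.add_comm] at h₁
      have hz : AllZero (zeroWires N) (flip (.W, 1) S) ↔ AllZero (zeroWires N) S := by
        refine forall₂_congr fun v hv => ?_
        have : v ≠ (.W, 1) := fun e => zw v hv (e ▸ rfl)
        simp [mem_flip, this]
      have m₁ : (Reg.W, 1) ∈ chainMap 1 (zeroWires N) (flip (.W, 1) S) := by
        rw [h₂ _ fun k hk => by simp; omega]
        simp [mem_flip, hS']
      have m₀ : (Reg.W, 0) ∉ chainMap 1 (zeroWires N) (flip (.W, 1) S) := by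
        rw [h₂ _ fun k hk => by simp; omega]
        simp [mem_flip, hS']
      rw [hz] at h₁
      by_cases hc : AllZero (zeroWires N) S
      · simp [hQm, h₁, hc, mem_flip, m₁, m₀]
      · simp [hQm, h₁, hc, m₁, m₀]
    rw [run_second, e₁, e₃, normSq_restrict_run_of_pushL actsOn_accept.nodup runZ]
    set z := run D (run U (run (Gate.X (.W, 1) :: Q) b₁)) with hz
    have hzW : bitL (.W, 1) z = z := by
      rw [hz, bitL_run (notW hV₂ 1), bitL_run (notW hV₁ 1), e₂, bitL, restrict_pushL,
        restrict_eq_self_iff.2 fun S hS => (key S hS).1]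
    have : restrict (fun S => outWire ∈ hZm S) z = restrict (outWire ∈ ·) z := by
      refine restrict_congr fun S hS => ?_
      have hm : (Reg.W, 1) ∈ S := restrict_eq_self_iff.1 hzW S hS
      simp [hZm, mem_flip, hm]
    have hX : ∀ g ∈ Gate.X (.W, 1) :: Q, g.wires.Nodup := fun g hg => by
      rcases List.mem_cons.1 hg with rfl | hg
      · simp [Gate.wires]
      · exact hQa.nodup g hg
    have hbD : bitL outWire z = run D (run U (bitL outWire (run (Gate.X (.W, 1) :: Q) b₁))) := by
      rw [hz, bitL_run (notW hV₂ 0), bitL_run (notW hV₁ 0)]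
    rw [this]
    change normSq (bitL outWire z) = _
    rw [hbD, normSq_run hV₂.nodup, normSq_run hV₁.nodup, bitL,
      normSq_restrict_run_of_pushL hX e₂]
    congr 1
    exact restrict_congr fun S hS => (key S hS).2
  -- Both outcomes together.
  have hE : ∀ {C : Circuit} {G' : List Reg}, ActsOn C G' → Reg.E ∉ G' →
      ∀ g ∈ C, (Reg.E, 0) ∉ g.wires := fun h hG' g hg hk => hG' ((h g hg).2 _ hk)
  have hW : ∀ g ∈ P.second, (Reg.W, 1) ∉ g.wires := fun g hg hk => by
    simpa using (hP.2 g hg).2 _ hk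
  have hsec : ActsOn (compile V N).second (.W :: G) :=
    (isVerifier_compile hV N).2.mono (by simp [hG])
  have supp : ∀ {χ : Ket}, SupportedOn G χ → SupportedOn (.W :: G) χ := fun h =>
    h.mono (List.subset_cons_self _ _)
  have hx := ((supp haG).run hsec).restrict (outWire ∈ ·)
  have hy := (((supp hbG).flipL (t := (.W, 1)) (by simp)).run hsec).restrict (outWire ∈ ·)
  have hnE : Reg.E ∉ Reg.W :: G := by simp [hG]
  have hfin : finalState (compile V N) P ψ = (1 / (Real.sqrt 2 : ℂ)) •
      (run (compile V N).second a +
        flipL (.E, 0) (run (compile V N).second (flipL (.W, 1) b))) := by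
    rw [finalState, ← hφ]
    change run _ (run _ (run (coinToss 1) φ)) = _
    rw [run_coinToss_one hφG (by simp [hG]), run_smul, run_smul, run_add, run_add,
      ← flipL_run (hE hP₂ (by simp [hG])), ← flipL_run hW,
      ← flipL_run (hE (isVerifier_compile hV N).2 (by simp))]
  have hs : ‖(1 / (Real.sqrt 2 : ℂ))‖ ^ 2 = 1 / 2 := by
    rw [norm_div, Complex.norm_real, norm_one, div_pow, Real.norm_eq_abs, sq_abs,
      Real.sq_sqrt (by norm_num), one_pow]
  have hcomm : ∀ χ, restrict (outWire ∈ ·) (flipL (.E, 0) χ) =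
      flipL (.E, 0) (restrict (outWire ∈ ·) χ) := bitL_flipL_of_ne (by simp)
  rw [acceptProb_eq, hfin, map_smul, map_add, normSq_smul, hs, hcomm,
    normSq_add_flipL (bitL_eq_zero hx hnE) (bitL_eq_zero hy hnE), branch₀, branch₁]
  ring


/-! ### Relocating qubits to the prover's register -/

/-- The rank of a register in a fixed enumeration. -/
def regIndex : Reg → ℕ
  | .A => 0
  | .M₀ => 1
  | .W => 2
  | .E => 3
  | .R => 4
  | .M₁ => 5

/-- The place in the prover's private register where it simulates a given qubit. -/
def stash : Wire → Wire := affineRename (fun _ => .A) (fun _ => 6) regIndex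

theorem stash_injective : Injective stash := by
  rintro ⟨r, i⟩ ⟨r', j⟩ h
  cases r <;> cases r' <;> simp [stash, affineRename, regIndex] at h ⊢ <;> omega

theorem stash_fst (w : Wire) : (stash w).1 = .A := rfl

theorem pack_fst_ne {w : Wire} (h : w.1 ≠ .A) : (pack w).1 ≠ .A := by
  obtain ⟨r, i⟩ := w
  cases r <;> simp [pack, affineRename, packReg] at h ⊢

theorem isAdvice_renK_stash {ψ : Ket} (h : IsAdvice ψ) : IsAdvice (renK stash ψ) := by
  refine ⟨by rw [normSq_renK stash_injective, h.1], fun S hS w hw => ?_⟩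
  obtain ⟨S', -, rfl⟩ := mem_support_pushL hS
  obtain ⟨u, -, rfl⟩ := Finset.mem_image.1 hw
  rfl

/-- The permutation of the qubits that exchanges `α u` and `β u` for the first `N` qubits `u` of
the registers in `X`. -/
def swapRegs (α β : Wire → Wire) (X : List Reg) (N : ℕ) : Equiv.Perm Wire :=
  swapPerm α β (wireList X N)

section SwapRegs

variable {α β : Wire → Wire} {X : List Reg} {N : ℕ}

theorem swapRegs_of_ne {w : Wire} (h : ∀ u : Wire, u.1 ∈ X → w ≠ α u ∧ w ≠ β u) :
    swapRegs α β X N w = w :=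
  swapPerm_of_ne fun u hu => h u (mem_wireList.1 hu).1

variable (hα : Injective α) (hβ : Injective β) (hd : ∀ u v : Wire, v.1 ≠ .A → α u ≠ β v)
  (hA : Reg.A ∉ X) (hX : X.Nodup)
include hα hβ hd hA hX

theorem swapRegs_left (u : Wire) :
    swapRegs α β X N (α u) = if u.1 ∈ X ∧ u.2 < N then β u else α u := by
  have hl : ∀ u ∈ wireList X N, u.1 ≠ .A := fun u hu e => hA (e ▸ (mem_wireList.1 hu).1)
  by_cases hu : u.1 = .A
  · rw [if_neg fun h => hA (hu ▸ h.1)]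
    refine swapRegs_of_ne fun v hv => ?_
    have hv' : v.1 ≠ .A := fun e => hA (e ▸ hv)
    exact ⟨fun e => hv' (hα e ▸ hu), hd u v hv'⟩
  · simp only [swapRegs, swapPerm_left (G := fun w => w.1 ≠ .A) hα hβ (fun u v _ => hd u v) hl
      (nodup_wireList hX N) hu, mem_wireList]

theorem swapRegs_right {u : Wire} (hu : u.1 ≠ .A) :
    swapRegs α β X N (β u) = if u.1 ∈ X ∧ u.2 < N then α u else β u := by
  have hl : ∀ u ∈ wireList X N, u.1 ≠ .A := fun u hu e => hA (e ▸ (mem_wireList.1 hu).1)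
  simp only [swapRegs, swapPerm_right (G := fun w => w.1 ≠ .A) hα hβ (fun u v _ => hd u v) hl
    (nodup_wireList hX N) hu, mem_wireList]

theorem swapRegs_swapRegs (w : Wire) : swapRegs α β X N (swapRegs α β X N w) = w := by
  have hl : ∀ u ∈ wireList X N, u.1 ≠ .A := fun u hu e => hA (e ▸ (mem_wireList.1 hu).1)
  exact swapPerm_swapPerm (G := fun w => w.1 ≠ .A) hα hβ (fun u v _ => hd u v) hl
    (nodup_wireList hX N) w

omit hα hβ hX in
theorem run_swapCircuit_wireList (ψ : Ket) :
    run (swapCircuit α β (wireList X N)) ψ = renK (swapRegs α β X N) ψ :=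
  run_swapCircuit (fun u hu => hd u u fun e => hA (e ▸ (mem_wireList.1 hu).1)) ψ

end SwapRegs

/-- All gates of a circuit act on qubits with index less than `N`. -/
def IndexLT (C : Circuit) (N : ℕ) : Prop := ∀ g ∈ C, ∀ w ∈ g.wires, w.2 < N

theorem indexLT_length_encodeCircuit (C : Circuit) : IndexLT C (encodeCircuit C).length := by
  intro g hg w hw
  have h₁ : (encodeGate g).length ≤ (encodeCircuit C).length := by
    rw [encodeCircuit, List.length_flatMap]
    exact List.le_sum_of_mem (List.mem_map_of_mem hg)
  refine lt_of_lt_of_le ?_ h₁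
  cases g <;> simp only [Gate.wires, List.mem_cons, List.not_mem_nil, or_false] at hw <;>
    simp only [encodeGate, encodeWire, List.length_cons, List.length_append,
      List.length_replicate] <;>
    rcases hw with rfl | rfl | rfl <;> omega

/-- A bound for the indices of the qubits that a party uses. -/
def Party.size (V : Party) : ℕ := (encodeParty V).length

theorem Party.size_pos (V : Party) : 0 < V.size := by simp [Party.size, encodeParty]

theorem Party.indexLT_first (V : Party) : IndexLT V.first V.size := fun g hg w hw =>
  (indexLT_length_encodeCircuit _ g hg w hw).trans_le (by simp [Party.size, encodeParty])

theorem Party.indexLT_second (V : Party) : IndexLT V.second V.size := fun g hg w hw =>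
  (indexLT_length_encodeCircuit _ g hg w hw).trans_le (by simp [Party.size, encodeParty]; omega)

theorem mapCircuit_congr_of_actsOn {f f' : Wire → Wire} {C : Circuit} {X : List Reg}
    (hC : ActsOn C X) (h : ∀ w : Wire, w.1 ∈ X → f w = f' w) :
    mapCircuit f C = mapCircuit f' C :=
  mapCircuit_congr fun g hg w hw => h w ((hC g hg).2 w hw)

theorem mapCircuit_congr_of_indexLT {f f' : Wire → Wire} {C : Circuit} {X : List Reg} {N : ℕ}
    (hC : ActsOn C X) (hN : IndexLT C N) (h : ∀ w : Wire, w.1 ∈ X → w.2 < N → f w = f' w) :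
    mapCircuit f C = mapCircuit f' C :=
  mapCircuit_congr fun g hg w hw => h w ((hC g hg).2 w hw) (hN g hg w hw)

theorem IndexLT.inv {C : Circuit} {N : ℕ} (h : IndexLT C N) : IndexLT (invCircuit C) N := by
  intro g hg
  obtain ⟨g', hg', e⟩ := mem_invCircuit hg
  exact e ▸ h g' hg'

theorem restrict_renK_of_injective {f : Wire → Wire} (hf : Injective f) (w : Wire) (ψ : Ket) :
    restrict (f w ∈ ·) (renK f ψ) = renK f (restrict (w ∈ ·) ψ) := by
  simp only [renK, restrict_pushL, Finset.mem_image, hf.eq_iff, exists_eq_right]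

theorem flipL_renK_of_injective {f : Wire → Wire} (hf : Injective f) (w : Wire) (ψ : Ket) :
    renK f (flipL w ψ) = flipL (f w) (renK f ψ) := by
  simp only [renK, flipL, pushL_pushL, image_flip hf]

theorem allZero_flip_iff {l : List Wire} {t : Wire} (ht : t ∉ l) (S : Basis) :
    AllZero l (flip t S) ↔ AllZero l S := by
  refine forall₂_congr fun w hw => ?_
  have : w ≠ t := fun e => ht (e ▸ hw)
  simp [mem_flip, this]

theorem fst_of_mem_zeroWires {N : ℕ} {w : Wire} (h : w ∈ zeroWires N) :
    w.1 ∈ [Reg.M₀, Reg.M₁] := by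
  obtain ⟨⟨r, i⟩, hr, -, rfl⟩ := mem_zeroWires.1 h
  exact packReg_mem (by simp at hr ⊢; tauto)

/-! ### The honest prover -/

/-- The honest prover of the compiled protocol. It simulates the original protocol in its private
register up to the verifier's message, and hands over the verifier's registers. If the coin
shows `1` it then hands over the message `R` of the verifier. In either case it applies the second
circuit of `P` and sends `M₁`; on outcome `1` this is idle work, which saves a case distinction in
the circuit. -/
def honest (V P : Party) (N : ℕ) : Party where
  first := mapCircuit stash (P.first ++ V.first) ++
    swapCircuit stash pack (wireList [.M₀, .W, .E] N)
  second := controlledSwaps stash pack (.R, 0) (wireList [.R] N) ++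
    (mapCircuit stash P.second ++ swapCircuit stash pack (wireList [.M₁] N))

theorem stash_ne_pack (u v : Wire) (hv : v.1 ≠ .A) : stash u ≠ pack v :=
  fun e => pack_fst_ne hv (e ▸ rfl)

theorem isProver_honest {V P : Party} (hV : V.IsVerifier) (hP : P.IsProver) (N : ℕ) :
    (honest V P N).IsProver := by
  have all : ∀ {C : Circuit} {G G' : List Reg}, ActsOn C G → .A ∈ G' →
      ActsOn (mapCircuit stash C) G' := fun h hA => h.map stash_injective fun w _ => hA
  have sw : ∀ {X G : List Reg}, .A ∉ X → .A ∈ G → (∀ r ∈ X, packReg r ∈ G) →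
      ActsOn (swapCircuit stash pack (wireList X N)) G := fun hX hA hG =>
    actsOn_swapCircuit fun u hu => by
      have hu := (mem_wireList.1 hu).1
      exact ⟨stash_ne_pack u u fun e => hX (e ▸ hu), hA, hG _ hu⟩
  refine ⟨ActsOn.append ?_ (sw (by simp) (by simp) (by simp [packReg])),
    ActsOn.append (actsOn_controlledSwaps (by simp) fun u hu => ?_)
      ((all hP.2 (by simp)).append (sw (by simp) (by simp) (by simp [packReg])))⟩
  · rw [mapCircuit_append]
    exact (all hP.1 (by simp)).append (all hV.1 (by simp))
  · obtain ⟨r, i⟩ := u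
    have hr := (mem_wireList.1 hu).1
    simp only [List.mem_singleton] at hr
    subst hr
    simp [stash, pack, affineRename, packReg]

theorem acceptProb_honest {V P : Party} (hV : V.IsVerifier) (hP : P.IsProver) {ψ : Ket}
    (hψ : IsAdvice ψ) :
    acceptProb (compile V V.size) (honest V P V.size) (renK stash ψ) =
      (acceptProb V P ψ + 1) / 2 := by
  set N := V.size with hN
  set φ := run P.first ψ with hφ
  set χ := run V.first φ with hχ
  have hφs : SupportedOn [.A, .M₀, .M₁] φ :=
    SupportedOn.run (fun S hS w hw => by simp [hψ.2 S hS w hw]) hP.1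
  set π₁ := swapRegs stash pack [.M₀, .W, .E] N with hπ₁
  set π₂ := swapRegs stash pack [.R] N with hπ₂
  set π₃ := swapRegs stash pack [.M₁] N with hπ₃
  have left : ∀ {X : List Reg}, .A ∉ X → X.Nodup → ∀ u : Wire,
      swapRegs stash pack X N (stash u) = if u.1 ∈ X ∧ u.2 < N then pack u else stash u :=
    fun hA hX u => swapRegs_left stash_injective pack_injective stash_ne_pack hA hX u
  have right : ∀ {X : List Reg}, .A ∉ X → X.Nodup → ∀ {u : Wire}, u.1 ≠ .A →
      swapRegs stash pack X N (pack u) = if u.1 ∈ X ∧ u.2 < N then stash u else pack u :=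
    fun hA hX u hu => swapRegs_right stash_injective pack_injective stash_ne_pack hA hX hu
  -- The places of the qubits after the first, and after the second exchange.
  set f₁ : Wire → Wire := fun w => π₁ (stash w) with hf₁
  set f₂ : Wire → Wire := fun w => π₂ (f₁ w) with hf₂
  set f₃ : Wire → Wire := fun w => π₃ (f₁ w) with hf₃
  have inj₁ : Injective f₁ := π₁.injective.comp stash_injective
  have inj₂ : Injective f₂ := π₂.injective.comp inj₁
  have inj₃ : Injective f₃ := π₃.injective.comp inj₁
  have f₁_eq : ∀ w, f₁ w = if w.1 ∈ [Reg.M₀, .W, .E] ∧ w.2 < N then pack w else stash w :=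
    fun w => left (by simp) (by simp) w
  have f₂_pack : ∀ w : Wire, w.1 ∈ [Reg.M₀, .W, .E, .R] → w.2 < N → f₂ w = pack w := by
    rintro ⟨r, i⟩ hr hi
    simp only [hf₂, f₁_eq, hπ₂]
    simp only [List.mem_cons, List.not_mem_nil, or_false] at hr
    rcases hr with rfl | rfl | rfl | rfl
    all_goals simp only at hi
    all_goals simp [hi, left, right]
  have f₃_pack : ∀ w : Wire, w.1 ∈ [Reg.M₀, .W, .M₁] → w.2 < N → f₃ w = pack w := by
    rintro ⟨r, i⟩ hr hi
    simp only [hf₃, f₁_eq, hπ₃]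
    simp only [List.mem_cons, List.not_mem_nil, or_false] at hr
    rcases hr with rfl | rfl | rfl
    all_goals simp only at hi
    all_goals simp [hi, left, right]
  have hfirst : run (honest V P N).first (renK stash ψ) = renK f₁ χ := by
    rw [honest, run_append, run_renK stash_injective, run_append,
      run_swapCircuit_wireList stash_ne_pack (by simp), renK_renK]
  -- No qubit of the register `R` is in use yet.
  have noR : ∀ w, f₁ w ≠ (.R, 0) := by
    rintro ⟨r, i⟩ h
    rw [f₁_eq] at h
    split_ifs at h
    · cases r <;> simp [pack, affineRename, packReg] at h
    · simp [stash, affineRename] at h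
  have noR' : ∀ S ∈ (renK f₁ χ).support, (Reg.R, 0) ∉ S := fun S hS h => by
    obtain ⟨S', -, rfl⟩ := mem_support_pushL hS
    obtain ⟨w, -, hw⟩ := Finset.mem_image.1 h
    exact noR w hw
  have hcs : ∀ u ∈ wireList [.R] N, stash u ≠ pack u ∧ (Reg.R, 0) ≠ stash u ∧
      (Reg.R, 0) ≠ pack u := by
    rintro ⟨r, i⟩ hu
    have hr := (mem_wireList.1 hu).1
    simp only [List.mem_singleton] at hr
    subst hr
    simp [stash, pack, affineRename, packReg]
  have hsecond : ∀ ξ, run (honest V P N).second ξ = renK π₃ (run (mapCircuit stash P.second)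
      (pushL (fun S => if (Reg.R, 0) ∈ S then S.image π₂ else S) ξ)) := fun ξ => by
    rw [honest, run_append, run_append, run_controlledSwaps hcs,
      run_swapCircuit_wireList stash_ne_pack (by simp)]
    rfl
  rw [acceptProb_compile hV (isProver_honest hV hP N) N (isAdvice_renK_stash hψ), hfirst,
    hsecond, hsecond]
  congr 2
  · -- Outcome `0`: the original protocol is carried out with renamed qubits.
    have e : pushL (fun S => if (Reg.R, 0) ∈ S then S.image π₂ else S) (renK f₁ χ) = renK f₁ χ :=
      pushL_eq_self fun S hS => if_neg (noR' S hS)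
    have eP : mapCircuit stash P.second = mapCircuit f₁ P.second :=
      mapCircuit_congr_of_actsOn hP.2 fun w hw => by
        rw [f₁_eq, if_neg]
        rintro ⟨h, -⟩
        simp at hw h
        rcases hw with h' | h' | h' <;> simp [h'] at h
    have eV : mapCircuit pack V.second = mapCircuit f₃ V.second :=
      mapCircuit_congr_of_indexLT hV.2 V.indexLT_second fun w hw hi => (f₃_pack w hw hi).symm
    have eo : pack outWire = f₃ outWire := (f₃_pack outWire (by simp) V.size_pos).symm
    rw [e, eP, run_renK inj₁, renK_renK, eV, run_renK inj₃, eo, restrict_renK_of_injective inj₃,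
      normSq_renK inj₃, acceptProb_eq]
    rfl
  · -- Outcome `1`: undoing the first circuit of `V` leads back to a state of the prover.
    have e : pushL (fun S => if (Reg.R, 0) ∈ S then S.image π₂ else S)
        (flipL (.R, 0) (renK f₁ χ)) = flipL (.R, 0) (renK f₂ χ) := by
      have hR : π₂ (.R, 0) = (.R, 0) := by
        refine swapRegs_of_ne ?_
        rintro ⟨r, i⟩ hr
        simp only [List.mem_singleton] at hr
        subst hr
        simp [stash, pack, affineRename, packReg]
      trans renK π₂ (flipL (.R, 0) (renK f₁ χ))
      · refine pushL_congr fun S hS => if_pos ?_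
        obtain ⟨S', hS', rfl⟩ := mem_support_pushL hS
        simp [mem_flip, noR' S' hS']
      · rw [flipL_renK_of_injective π₂.injective, hR, renK_renK]
    set U := invCircuit (mapCircuit pack V.first) with hU
    set K := mapCircuit stash P.second with hK
    have hKA : ActsOn K [.A] := hP.2.map stash_injective fun w _ => by simp [stash_fst]
    have hUM : ActsOn U [.M₀, .M₁] := (actsOn_pack_first hV).inv
    have hU' : U = mapCircuit pack (invCircuit V.first) := (mapCircuit_invCircuit _ _).symm
    have notR : ∀ {C : Circuit} {G : List Reg}, ActsOn C G → .R ∉ G →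
        ∀ g ∈ C, (Reg.R, 0) ∉ g.wires := fun h hG g hg hw => hG ((h g hg).2 _ hw)
    have π₃_pack : ∀ w : Wire, w.1 ∈ [Reg.M₀, .W, .E, .R] → π₃ (pack w) = pack w := fun w hw => by
      have hne : w.1 ≠ .A := fun e => by simp [e] at hw
      rw [hπ₃, right (by simp) (by simp) hne, if_neg]
      rintro ⟨h, -⟩
      simp at h
      simp [h] at hw
    have eU₃ : U = mapCircuit π₃ U := by
      conv_lhs => rw [hU']
      rw [hU', mapCircuit_mapCircuit]
      exact mapCircuit_congr_of_actsOn hV.1.inv fun w hw => (π₃_pack w hw).symm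
    have eU₂ : U = mapCircuit f₂ (invCircuit V.first) := by
      rw [hU']
      exact mapCircuit_congr_of_indexLT hV.1.inv V.indexLT_first.inv
        fun w hw hi => (f₂_pack w hw hi).symm
    have hπR : π₃ (.R, 0) = (.R, 0) := by
      refine swapRegs_of_ne ?_
      rintro ⟨r, i⟩ hr
      simp only [List.mem_singleton] at hr
      subst hr
      simp [stash, pack, affineRename, packReg]
    have main : run U (renK π₃ (run K (flipL (.R, 0) (renK f₂ χ)))) =
        flipL (.R, 0) (renK π₃ (run K (renK f₂ φ))) := by
      rw [← flipL_run (notR hKA (by simp)), flipL_renK_of_injective π₃.injective, hπR,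
        ← flipL_run (notR hUM (by simp))]
      congr 1
      conv_lhs => rw [eU₃]
      rw [run_renK π₃.injective, run_comm (C := U) (D := K), eU₂, run_renK inj₂, hχ,
        run_inv_run hV.1.nodup]
      intro g hg g' hg' w hw hw'
      have h₁ := (hUM g hg).2 w hw
      have h₂ := (hKA g' hg').2 w hw'
      simp only [List.mem_singleton] at h₂
      simp [h₂] at h₁
    rw [e, main]
    have zeroA : ∀ {t : Wire} {l : List Reg}, t.1 ∈ l → Reg.M₀ ∉ l → Reg.M₁ ∉ l →
        t ∉ zeroWires N := fun h h₀ h₁ ht => by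
      have := fst_of_mem_zeroWires ht
      simp only [List.mem_cons, List.not_mem_nil, or_false] at this
      rcases this with h' | h' <;> rw [h'] at h <;> contradiction
    have hz : restrict (AllZero (zeroWires N)) (flipL (.R, 0) (renK π₃ (run K (renK f₂ φ)))) =
        flipL (.R, 0) (renK π₃ (run K (renK f₂ φ))) := by
      rw [flipL, restrict_pushL]
      simp only [allZero_flip_iff (zeroA (t := (.R, 0)) (l := [.R]) (by simp) (by simp)
        (by simp))]
      rw [renK, restrict_pushL]
      have : ∀ S : Basis, AllZero (zeroWires N) (S.image π₃) ↔ AllZero (zeroWires N) S := by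
        refine fun S => forall₂_congr fun w hw => ?_
        obtain ⟨u, hu, -, rfl⟩ := mem_zeroWires.1 hw
        have hs : π₃.symm (pack u) = pack u := by
          rw [Equiv.symm_apply_eq, π₃_pack u (by simp at hu ⊢; tauto)]
        rw [mem_image_equiv, hs]
      simp only [this]
      rw [restrict_run fun g hg w hw S =>
        allZero_flip_iff (zeroA ((hKA g hg).2 w hw) (by simp) (by simp)) S]
      congr 3
      rw [restrict_eq_self_iff]
      intro S hS w hw hwS
      obtain ⟨u, hu, hi, rfl⟩ := mem_zeroWires.1 hw
      obtain ⟨S', hS', rfl⟩ := mem_support_pushL hS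
      rw [← f₂_pack u (by simp at hu ⊢; tauto) hi] at hwS
      obtain ⟨v, hv, e⟩ := Finset.mem_image.1 hwS
      have := hφs S' hS' v hv
      rw [inj₂ e] at this
      simp at this hu
      rcases hu with h | h | h <;> simp [h] at this
    rw [hz, normSq_flipL, normSq_renK π₃.injective, normSq_run hKA.nodup, normSq_renK inj₂, hφ,
      normSq_run hP.1.nodup, hψ.1]


/-! ### Polynomial time of the compiled parties -/

/-- A family of qubits of one register whose index is an affine function of the parameter. -/
def IsAffine (w : ℕ → Wire) : Prop := ∃ r a b, ∀ i, w i = (r, a * i + b)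

theorem IsAffine.encodeWire {w : ℕ → Wire} (h : IsAffine w) :
    IsTemplate fun i => encodeWire (w i) := by
  obtain ⟨r, a, b, h⟩ := h
  simpa only [h] using IsTemplate.wire r a b

theorem isAffine_affineRename {w : ℕ → Wire} (h : IsAffine w) (ρ : Reg → Reg) (a b : Reg → ℕ) :
    IsAffine fun i => affineRename ρ a b (w i) := by
  obtain ⟨r, c, d, h⟩ := h
  refine ⟨ρ r, a r * c, a r * d + b r, fun i => ?_⟩
  simp only [h, affineRename, Prod.mk.injEq, true_and]
  ring

theorem isAffine_index (r : Reg) : IsAffine fun i => (r, i) := ⟨r, 1, 0, fun i => by simp⟩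

theorem isAffine_const (w : Wire) : IsAffine fun _ => w := ⟨w.1, 0, w.2, fun i => by simp⟩

section Templates

variable {u v w : ℕ → Wire}

theorem IsAffine.encodeX (hu : IsAffine u) : IsTemplate fun i => encodeGate (.X (u i)) :=
  hu.encodeWire.cons _

theorem IsAffine.encodeCnot (hu : IsAffine u) (hv : IsAffine v) :
    IsTemplate fun i => encodeGate (.cnot (u i) (v i)) :=
  (hu.encodeWire.append hv.encodeWire).cons _

theorem IsAffine.encodeToffoli (hu : IsAffine u) (hv : IsAffine v) (hw : IsAffine w) :
    IsTemplate fun i => encodeGate (.toffoli (u i) (v i) (w i)) :=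
  ((hu.encodeWire.append hv.encodeWire).append hw.encodeWire).cons _

theorem IsTemplate.encodeThree {g₁ g₂ g₃ : ℕ → Gate} (h₁ : IsTemplate fun i => encodeGate (g₁ i))
    (h₂ : IsTemplate fun i => encodeGate (g₂ i)) (h₃ : IsTemplate fun i => encodeGate (g₃ i)) :
    IsTemplate fun i => encodeCircuit [g₁ i, g₂ i, g₃ i] := by
  simpa [encodeCircuit] using h₁.append (h₂.append h₃)

theorem IsAffine.swapGates (hu : IsAffine u) (hv : IsAffine v) :
    IsTemplate fun i => encodeCircuit (swapGates (u i) (v i)) :=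
  (hu.encodeCnot hv).encodeThree (hv.encodeCnot hu) (hu.encodeCnot hv)

theorem IsAffine.controlledSwap (c : Wire) (hu : IsAffine u) (hv : IsAffine v) :
    IsTemplate fun i => encodeCircuit (controlledSwap c (u i) (v i)) :=
  (hv.encodeCnot hu).encodeThree ((isAffine_const c).encodeToffoli hu hv) (hv.encodeCnot hu)

theorem IsAffine.checkStep (hu : IsAffine u) (a b : ℕ) :
    IsTemplate fun i => encodeCircuit (checkStep (u i) (a * i + b)) :=
  hu.encodeX.encodeThree (IsAffine.encodeToffoli ⟨.W, a, b, fun _ => rfl⟩ hu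
    ⟨.W, a, b + 1, fun _ => rfl⟩) hu.encodeX

end Templates

section Families

variable {V : List Bool → Party} (hV : PolyTime V)
include hV

theorem PolyTime.polyTimeFun_encodeParty : PolyTimeFun fun x => encodeParty (V x) :=
  (polyTime_iff V).1 hV

theorem polyTimeCircuit_swapCircuit {α β : Wire → Wire}
    (hα : ∀ r, IsAffine fun i => α (r, i)) (hβ : ∀ r, IsAffine fun i => β (r, i))
    (X : List Reg) : PolyTimeCircuit fun x => swapCircuit α β (wireList X (V x).size) := by
  induction X with
  | nil => exact hV.first.const []
  | cons r X ih =>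
    have h := (polyTimeCircuit_loop hV.polyTimeFun_encodeParty ((hα r).swapGates (hβ r))).append ih
    convert h using 2 with x
    simp [swapCircuit, wireList, loopCircuit, List.flatMap_map, Party.size]

theorem polyTimeCircuit_controlledSwaps {α β : Wire → Wire} (c : Wire)
    (hα : ∀ r, IsAffine fun i => α (r, i)) (hβ : ∀ r, IsAffine fun i => β (r, i))
    (r : Reg) : PolyTimeCircuit fun x => controlledSwaps α β c (wireList [r] (V x).size) := by
  convert polyTimeCircuit_loop hV.polyTimeFun_encodeParty ((hα r).controlledSwap c (hβ r))
    using 2 with x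
  simp [controlledSwaps, wireList, loopCircuit, List.flatMap_map, Party.size]

theorem polyTimeCircuit_zeroChain :
    PolyTimeCircuit fun x => zeroChain 1 (zeroWires (V x).size) := by
  have h : ∀ r, IsAffine fun i => pack (r, i) := fun r =>
    isAffine_affineRename (isAffine_index r) _ _ _
  have hT := (((h .W).checkStep 3 1).append ((h .E).checkStep 3 2)).append ((h .R).checkStep 3 3)
  simp only [← encodeCircuit_append] at hT
  simpa only [zeroChain_zeroWires, Party.size] using
    polyTimeCircuit_loop hV.polyTimeFun_encodeParty hT

/-- The only gate of the compiled verifier outside loops whose qubit index depends on the input. -/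
theorem polyTimeCircuit_copyAnswer :
    PolyTimeCircuit fun x => [.cnot (.W, 3 * (V x).size + 1) (.W, 0)] := by
  have h := (polyTimeFun_const hV.polyTimeFun_encodeParty [.cnot, .reg .W]).append
    ((polyTimeFun_transduce (Γ := Token) (fun (_ : Unit) _ => ((), [.one, .one, .one]))
      (fun _ => [.one, .reg .W]) ()).comp hV.polyTimeFun_encodeParty)
  have e : ∀ l : List Token, transduce (fun (_ : Unit) _ => ((), [Token.one, .one, .one]))
      (fun _ => [.one, .reg .W]) () l =
        List.replicate (3 * l.length + 1) .one ++ [.reg .W] := by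
    intro l
    induction l with
    | nil => rfl
    | cons t l ih => simp [transduce, ih, Nat.mul_add, List.replicate_succ]
  rw [PolyTimeCircuit]
  convert h using 2 with x
  simp [e, encodeCircuit, encodeGate, encodeWire, Party.size]

theorem polyTime_compile : PolyTime fun x => compile (V x) (V x).size := by
  have h₁ := hV.first.map packReg packScale packShift
  have h₂ := hV.second.map packReg packScale packShift
  exact (hV.first.const (coinToss 1)).mk (h₁.inv.append
    (((polyTimeCircuit_zeroChain hV).append (polyTimeCircuit_copyAnswer hV)).append
      (h₁.append (h₂.append (hV.first.const _)))))

theorem polyTime_honest {P : List Bool → Party} (hP : PolyTime P) :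
    PolyTime fun x => honest (V x) (P x) (V x).size := by
  have hs : ∀ r, IsAffine fun i => stash (r, i) := fun r =>
    isAffine_affineRename (isAffine_index r) _ _ _
  have hp : ∀ r, IsAffine fun i => pack (r, i) := fun r =>
    isAffine_affineRename (isAffine_index r) _ _ _
  exact (((hP.first.append hV.first).map _ _ _).append
    (polyTimeCircuit_swapCircuit hV hs hp _)).mk
    ((polyTimeCircuit_controlledSwaps hV _ hs hp _).append
      ((hP.second.map _ _ _).append (polyTimeCircuit_swapCircuit hV hs hp _)))

end Families

/-! ### The reduction for soundness -/

/-- The place in the prover's private register that corresponds to a qubit of the original protocol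
when the messages of the compiled protocol are simulated there. -/
def stashPack (w : Wire) : Wire := stash (pack w)

theorem stashPack_injective : Injective stashPack := stash_injective.comp pack_injective

theorem stashPack_ne (u v : Wire) (hv : v.1 ≠ .A) : stashPack u ≠ id v :=
  fun e => hv (congrArg Prod.fst e).symm

/-- The circuit that rewinds the second circuit of a prover for the compiled protocol, flips the
coin, and runs the second circuit again. -/
def rewind (Q : Party) : Circuit := invCircuit Q.second ++ (.X (.R, 0) :: Q.second)

/-- The prover for the original protocol that is obtained from a prover `Q` for the compiled one.
It runs `Q` on the coin outcome `1`, undoes the first circuit of the verifier, and sends the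
resulting message; having received the reply, it replaces the coin by `0` by means of `rewind`. -/
def reduction (V Q : Party) (N : ℕ) : Party where
  first := mapCircuit stash (Q.first ++ (.X (.R, 0) :: (Q.second ++
      invCircuit (mapCircuit pack V.first)))) ++ swapCircuit stashPack id (wireList [.M₀] N)
  second := swapCircuit stashPack id (wireList [.R] N) ++
    (mapCircuit stash (rewind Q) ++ swapCircuit stashPack id (wireList [.M₁] N))

theorem polyTime_reduction {V Q : List Bool → Party} (hV : PolyTime V) (hQ : PolyTime Q) :
    PolyTime fun x => reduction (V x) (Q x) (V x).size := by
  have hs : ∀ r, IsAffine fun i => stashPack (r, i) := fun r =>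
    isAffine_affineRename (isAffine_affineRename (isAffine_index r) packReg packScale packShift)
      (fun _ => .A) (fun _ => 6) regIndex
  have hi : ∀ r, IsAffine fun i => id (r, i) := isAffine_index
  have hX := hV.first.const [.X (.R, 0)]
  have hU := (hV.first.map packReg packScale packShift).inv
  exact (((hQ.first.append (hX.append (hQ.second.append hU))).map _ _ _).append
    (polyTimeCircuit_swapCircuit hV hs hi _)).mk
    ((polyTimeCircuit_swapCircuit hV hs hi _).append
      (((hQ.second.inv.append (hX.append hQ.second)).map _ _ _).append
        (polyTimeCircuit_swapCircuit hV hs hi _)))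

theorem actsOn_rewind {Q : Party} (hQ : Q.IsProver) : ActsOn (rewind Q) [.A, .R, .M₁] := by
  refine hQ.2.inv.append fun g hg => ?_
  rcases List.mem_cons.1 hg with rfl | hg
  · simp [Gate.wires]
  · exact hQ.2 g hg

theorem isProver_reduction {V Q : Party} (hV : V.IsVerifier) (hQ : Q.IsProver) (N : ℕ) :
    (reduction V Q N).IsProver := by
  have all : ∀ {C : Circuit} {G G' : List Reg}, ActsOn C G → .A ∈ G' →
      ActsOn (mapCircuit stash C) G' := fun h hA => h.map stash_injective fun w _ => hA
  have sw : ∀ {X G : List Reg}, .A ∉ X → .A ∈ G → X ⊆ G →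
      ActsOn (swapCircuit stashPack id (wireList X N)) G := fun hX hA hG =>
    actsOn_swapCircuit fun u hu => by
      have hu := (mem_wireList.1 hu).1
      exact ⟨stashPack_ne u u fun e => hX (e ▸ hu), hA, hG hu⟩
  have hX : ActsOn [.X (.R, 0)] [.R] := fun g hg => by
    rw [List.mem_singleton] at hg
    subst hg
    simp [Gate.wires]
  refine ⟨ActsOn.append ?_ (sw (by simp) (by simp) (by simp)),
    (sw (by simp) (by simp) (by simp)).append
      ((all (actsOn_rewind hQ) (by simp)).append (sw (by simp) (by simp) (by simp)))⟩
  rw [mapCircuit_append]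
  refine (all hQ.1 (by simp)).append (ActsOn.append (C := [_]) (all hX (by simp)) ?_)
  change ActsOn (mapCircuit stash _) _
  rw [mapCircuit_append]
  exact (all hQ.2 (by simp)).append (all (actsOn_pack_first hV).inv (by simp))

theorem restrict_allZero_renK {f : Wire → Wire} (hf : Injective f) (l : List Wire) (ψ : Ket) :
    restrict (AllZero (l.map f)) (renK f ψ) = renK f (restrict (AllZero l) ψ) := by
  have h : ∀ S : Basis, AllZero (l.map f) (S.image f) ↔ AllZero l S := fun S => by
    simp only [AllZero, List.forall_mem_map, Finset.mem_image, hf.eq_iff, exists_eq_right]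
  simp only [renK, restrict_pushL, h]

theorem restrict_allZero_run {C : Circuit} {l : List Wire}
    (h : ∀ g ∈ C, ∀ w ∈ g.wires, w ∉ l) (ψ : Ket) :
    restrict (AllZero l) (run C ψ) = run C (restrict (AllZero l) ψ) :=
  restrict_run (fun g hg w hw S => allZero_flip_iff (h g hg w hw) S) ψ

/-- The prover `reduction V Q` is accepted at least with the probability that the part of the state
that passes the check of the compiled verifier is accepted after rewinding. -/
theorem le_acceptProb_reduction {V Q : Party} (hV : V.IsVerifier) (hQ : Q.IsProver)
    {ψ χ : Ket} (hχ : χ = run (invCircuit (mapCircuit pack V.first))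
      (run Q.second (flipL (.R, 0) (run Q.first ψ)))) :
    normSq (restrict (pack outWire ∈ ·) (run (mapCircuit pack V.second) (run (rewind Q)
      (run (mapCircuit pack V.first) (restrict (AllZero (zeroWires V.size)) χ))))) ≤
      acceptProb V (reduction V Q V.size) (renK stash ψ) := by
  set N := V.size with hN
  set ζ := restrict (AllZero (zeroWires N)) χ with hζ
  set π := swapRegs stashPack id with hπ
  have hfst : ∀ w, (stashPack w).1 = .A := fun w => rfl
  have left : ∀ {X : List Reg}, .A ∉ X → X.Nodup → ∀ u : Wire,
      π X N (stashPack u) = if u.1 ∈ X ∧ u.2 < N then u else stashPack u :=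
    fun hA hX u => swapRegs_left stashPack_injective injective_id stashPack_ne hA hX u
  have right : ∀ {X : List Reg}, .A ∉ X → X.Nodup → ∀ {u : Wire}, u.1 ≠ .A →
      π X N u = if u.1 ∈ X ∧ u.2 < N then stashPack u else u :=
    fun hA hX u hu => swapRegs_right stashPack_injective injective_id stashPack_ne hA hX hu
  have final : finalState V (reduction V Q N) (renK stash ψ) =
      run V.second (renK (π [.M₁] N) (run (mapCircuit stash (rewind Q)) (renK (π [.R] N)
        (run V.first (renK (π [.M₀] N) (renK stash χ)))))) := by
    have h₁ : run (reduction V Q N).first (renK stash ψ) = renK (π [.M₀] N) (renK stash χ) := by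
      rw [reduction, run_append, run_renK stash_injective, run_append, run_cons, run_append,
        run_swapCircuit_wireList stashPack_ne (by simp), apply_X, hχ]
    rw [finalState, h₁, reduction, run_append, run_append,
      run_swapCircuit_wireList stashPack_ne (by simp),
      run_swapCircuit_wireList stashPack_ne (by simp)]
  have zw : ∀ v ∈ zeroWires N, ∃ u : Wire, (u.1 = .W ∨ u.1 = .E ∨ u.1 = .R) ∧ u.2 < N ∧
      v = pack u := fun v hv => by simpa using mem_zeroWires.1 hv
  -- The projection to the states that pass the check can be postponed to the end.
  have postpone : ∃ l, run V.second (renK (π [.M₁] N) (run (mapCircuit stash (rewind Q))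
      (renK (π [.R] N) (run V.first (renK (π [.M₀] N) (renK stash ζ)))))) =
      restrict (AllZero l) (finalState V (reduction V Q N) (renK stash ψ)) := by
    refine ⟨((((zeroWires N).map stash).map (π [.M₀] N)).map (π [.R] N)).map (π [.M₁] N), ?_⟩
    rw [final, restrict_allZero_run, restrict_allZero_renK (π [.M₁] N).injective,
      restrict_allZero_run, restrict_allZero_renK (π [.R] N).injective, restrict_allZero_run,
      restrict_allZero_renK (π [.M₀] N).injective, restrict_allZero_renK stash_injective]
    · intro g hg w hw hm
      have hw' := (hV.1 g hg).2 w hw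
      simp only [List.mem_map, exists_exists_and_eq_and] at hm
      obtain ⟨v, hv, rfl⟩ := hm
      obtain ⟨u, hu, hi, rfl⟩ := zw v hv
      change (π [.M₀] N (stashPack u)).1 ∈ _ at hw'
      rw [left (by simp) (by simp), if_neg (by rcases hu with h | h | h <;> simp [h]), hfst] at hw'
      simp at hw'
    · intro g hg w hw hm
      obtain ⟨g, hg', rfl⟩ := List.mem_map.1 hg
      rw [Gate.wires_map] at hw
      obtain ⟨w, hw', rfl⟩ := List.mem_map.1 hw
      have hwQ := (actsOn_rewind hQ g hg').2 w hw'
      simp only [List.mem_map, exists_exists_and_eq_and] at hm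
      obtain ⟨v, hv, e⟩ := hm
      obtain ⟨u, hu, hi, rfl⟩ := zw v hv
      change π [.R] N (π [.M₀] N (stashPack u)) = stash w at e
      rw [left (by simp) (by simp), if_neg (by rcases hu with h | h | h <;> simp [h]),
        left (by simp) (by simp)] at e
      obtain ⟨r, i⟩ := u
      simp only at hu hi
      rcases hu with rfl | rfl | rfl
      · rw [if_neg (by simp)] at e
        rw [← stash_injective e] at hwQ
        simp [pack, affineRename, packReg] at hwQ
      · rw [if_neg (by simp)] at e
        rw [← stash_injective e] at hwQ
        simp [pack, affineRename, packReg] at hwQ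
      · rw [if_pos (by simp [hi])] at e
        simpa [stash_fst] using congrArg Prod.fst e
    · intro g hg w hw hm
      have hw' := (hV.2 g hg).2 w hw
      simp only [List.mem_map, exists_exists_and_eq_and] at hm
      obtain ⟨v, hv, rfl⟩ := hm
      obtain ⟨u, hu, hi, rfl⟩ := zw v hv
      change (π [.M₁] N (π [.R] N (π [.M₀] N (stashPack u)))).1 ∈ _ at hw'
      rw [left (by simp) (by simp), if_neg (by rcases hu with h | h | h <;> simp [h]),
        left (by simp) (by simp)] at hw'
      obtain ⟨r, i⟩ := u
      simp only at hu hi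
      rcases hu with rfl | rfl | rfl
      · rw [if_neg (by simp), left (by simp) (by simp), if_neg (by simp), hfst] at hw'
        simp at hw'
      · rw [if_neg (by simp), left (by simp) (by simp), if_neg (by simp), hfst] at hw'
        simp at hw'
      · rw [if_pos (by simp [hi]), right (by simp) (by simp) (by simp), if_neg (by simp)] at hw'
        simp at hw'
  -- On the part that passes the check, the original verifier starts from fresh private qubits.
  set ρ : Wire → Wire := fun w => π [.M₀, .W, .E] N (stash w) with hρ
  have injρ : Injective ρ := (π [.M₀, .W, .E] N).injective.comp stash_injective
  have ρ_pack : ∀ u, ρ (pack u) = if u.1 ∈ [Reg.M₀, .W, .E] ∧ u.2 < N then u else stashPack u :=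
    left (by simp) (by simp)
  set f₁ : Wire → Wire := fun w => π [.R] N (ρ w) with hf₁
  set f₂ : Wire → Wire := fun w => π [.M₁] N (ρ w) with hf₂
  have inj₁ : Injective f₁ := (π [.R] N).injective.comp injρ
  have inj₂ : Injective f₂ := (π [.M₁] N).injective.comp injρ
  have fresh : renK (π [.M₀] N) (renK stash ζ) = renK f₁ ζ := by
    rw [renK_renK]
    refine renK_congr fun S hS w hw => ?_
    have hS₀ : AllZero (zeroWires N) S :=
      restrict_eq_self_iff.1 (by rw [hζ, restrict_restrict]; simp only [and_self]) S hS
    simp only [hf₁, hρ]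
    by_cases h : ∃ u : Wire, u.1 ∈ [Reg.M₀, .W, .E, .R] ∧ u.2 < N ∧ w = pack u
    · obtain ⟨⟨r, i⟩, hr, hi, rfl⟩ := h
      simp only at hr hi
      have hM : r = .M₀ := by
        by_contra hne
        exact hS₀ _ (mem_zeroWires.2 ⟨(r, i), by simp [hne] at hr ⊢; exact hr, hi, rfl⟩) hw
      subst hM
      change π [.M₀] N (stashPack _) = π [.R] N (π _ N (stashPack _))
      rw [left (by simp) (by simp), left (by simp) (by simp), if_pos (by simp [hi]),
        if_pos (by simp [hi]), right (by simp) (by simp) (by simp), if_neg (by simp)]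
    · have fix : ∀ X : List Reg, X ⊆ [.M₀, .W, .E, .R] → π X N (stash w) = stash w := by
        refine fun X hX => swapPerm_of_ne fun u hu => ?_
        obtain ⟨hu, hi⟩ := mem_wireList.1 hu
        refine ⟨fun e => h ⟨u, hX hu, hi, stash_injective e⟩, fun e => ?_⟩
        have := hX hu
        rw [← show stash w = u from e] at this
        simp [stash_fst] at this
      rw [fix _ (by simp), fix _ (by simp), fix _ (by simp)]
  have eV₁ : V.first = mapCircuit f₁ (mapCircuit pack V.first) := by
    conv_lhs => rw [← mapCircuit_id V.first]
    rw [mapCircuit_mapCircuit]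
    refine mapCircuit_congr_of_indexLT hV.1 V.indexLT_first ?_
    rintro ⟨r, i⟩ hr hi
    simp only [List.mem_cons, List.not_mem_nil, or_false] at hr
    simp only [hf₁, ρ_pack]
    rcases hr with rfl | rfl | rfl | rfl
    all_goals replace hi : i < N := hi
    all_goals simp [hi, left, right]
  have eV₂ : V.second = mapCircuit f₂ (mapCircuit pack V.second) := by
    conv_lhs => rw [← mapCircuit_id V.second]
    rw [mapCircuit_mapCircuit]
    refine mapCircuit_congr_of_indexLT hV.2 V.indexLT_second ?_
    rintro ⟨r, i⟩ hr hi
    simp only [List.mem_cons, List.not_mem_nil, or_false] at hr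
    simp only [hf₂, ρ_pack]
    rcases hr with rfl | rfl | rfl
    all_goals replace hi : i < N := hi
    all_goals simp [hi, left, right]
  have eQ : mapCircuit stash (rewind Q) = mapCircuit ρ (rewind Q) := by
    refine mapCircuit_congr_of_actsOn (actsOn_rewind hQ) fun w hw => ?_
    refine (swapRegs_of_ne fun u hu => ⟨fun e => ?_, fun e => ?_⟩).symm
    · obtain ⟨r, i⟩ := u
      rw [stash_injective e] at hw
      simp only [List.mem_cons, List.not_mem_nil, or_false] at hu
      rcases hu with rfl | rfl | rfl <;> simp [pack, affineRename, packReg] at hw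
    · rw [← show stash w = u from e] at hu
      simp [stash_fst] at hu
  have unswap : ∀ ξ, renK (π [.R] N) (renK f₁ ξ) = renK ρ ξ := fun ξ => by
    rw [renK_renK]
    congr 2
    funext w
    exact swapRegs_swapRegs stashPack_injective injective_id stashPack_ne (by simp) (by simp) _
  have eo : f₂ (pack outWire) = outWire := by
    simp only [hf₂, ρ_pack]
    rw [if_pos ⟨by simp, V.size_pos⟩, right (by simp) (by simp) (by simp), if_neg (by simp)]
  obtain ⟨l, hl⟩ := postpone
  rw [fresh, eV₁, run_renK inj₁, unswap, eQ, run_renK injρ, renK_renK, ← hf₂] at hl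
  conv_lhs at hl => rw [eV₂]
  rw [run_renK inj₂] at hl
  rw [acceptProb_eq, ← normSq_renK inj₂, ← restrict_renK_of_injective inj₂, eo, hl, restrict_comm]
  exact normSq_restrict_le _ _


/-! ### Completeness and soundness of the compiled protocol -/

theorem acceptProb_le_one {V P : Party} (hV : V.IsVerifier) (hP : P.IsProver) {ψ : Ket}
    (hψ : IsAdvice ψ) : acceptProb V P ψ ≤ 1 := by
  rw [acceptProb_eq]
  refine (normSq_restrict_le _ _).trans_eq ?_
  rw [finalState, normSq_run hV.2.nodup, normSq_run hP.2.nodup, normSq_run hV.1.nodup,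
    normSq_run hP.1.nodup, hψ.1]

/-- If both tests of the compiled verifier succeed with high probability, then so does
`reduction V Q` against `V`. -/
theorem acceptProb_compile_le {V Q : Party} (hV : V.IsVerifier) (hQ : Q.IsProver) {ψ : Ket}
    (hψ : IsAdvice ψ) : acceptProb (compile V V.size) Q ψ ≤
      1 - (1 - acceptProb V (reduction V Q V.size) (renK stash ψ)) / 6 := by
  have hq := le_acceptProb_reduction hV hQ (ψ := ψ) rfl
  rw [acceptProb_compile hV hQ _ hψ]
  set q := acceptProb V (reduction V Q V.size) (renK stash ψ)
  set φ := run Q.first ψ with hφ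
  set D := mapCircuit pack V.second
  set U := mapCircuit pack V.first
  have hU : ActsOn U _ := actsOn_pack_first hV
  have hD : ActsOn D _ := actsOn_pack_second hV
  have hφ₁ : normSq φ = 1 := by rw [hφ, normSq_run hQ.1.nodup, hψ.1]
  set χ := run (invCircuit U) (run Q.second (flipL (.R, 0) φ)) with hχ
  have hχ₁ : normSq χ = 1 := by
    rw [hχ, normSq_run hU.inv.nodup, normSq_run hQ.2.nodup, normSq_flipL, hφ₁]
  set ζ := restrict (AllZero (zeroWires V.size)) χ
  set ζ' := restrict (fun S => ¬ AllZero (zeroWires V.size) S) χ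
  have hζ : ζ + ζ' = χ := restrict_add_restrict_not _ _
  have hζn : normSq ζ + normSq ζ' = 1 := hχ₁ ▸ normSq_restrict_add _ χ
  -- `T` undoes the passage from coin outcome `0` to `1` and runs the second circuit of `V`.
  set T : Ket → Ket := fun ξ => run D (run (rewind Q) (run U ξ)) with hT
  have hTn : ∀ ξ, normSq (T ξ) = normSq ξ := fun ξ => by
    simp only [hT]
    rw [normSq_run hD.nodup, normSq_run (actsOn_rewind hQ).nodup, normSq_run hU.nodup]
  have hTχ : T χ = run D (run Q.second φ) := by
    simp only [hT, hχ]
    rw [run_run_inv hU.nodup, rewind, run_append, run_inv_run hQ.2.nodup, run_cons, apply_X,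
      flipL_flipL]
  have hTζ : T ζ = T χ + (-1 : ℂ) • T ζ' := by
    have : T χ = T ζ + T ζ' := by
      rw [← hζ]
      simp only [hT, run_add]
    rw [this, neg_one_smul]
    abel
  rw [← hTχ]
  change normSq (restrict (pack outWire ∈ ·) (T ζ)) ≤ q at hq
  have h₁ := normSq_restrict_add (pack outWire ∈ ·) (T ζ)
  have h₂ := normSq_restrict_add (pack outWire ∈ ·) (T χ)
  have h₃ := normSq_restrict_le (fun S => ¬ pack outWire ∈ S) (T ζ')
  have h₄ : normSq (restrict (fun S => ¬ pack outWire ∈ S) (T ζ)) ≤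
      2 * normSq (restrict (fun S => ¬ pack outWire ∈ S) (T χ)) + 2 * normSq (T ζ') := by
    rw [hTζ, map_add, map_smul]
    refine (normSq_add_le _ _).trans ?_
    rw [normSq_smul]
    simp only [norm_neg, norm_one, one_pow, one_mul]
    linarith
  rw [hTn] at h₁ h₂ h₄
  linarith [normSq_nonneg (restrict (fun S => ¬ pack outWire ∈ S) (T χ)), normSq_nonneg ζ']

/-- The form of the bound in which the error term of soundness up to a negligible function can be
absorbed. Beyond `s = 1` it only says that `acceptProb` is at most `1`. -/
theorem acceptProb_compile_le_of_le {V Q : Party} (hV : V.IsVerifier) (hQ : Q.IsProver) {ψ : Ket}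
    (hψ : IsAdvice ψ) {s e : ℝ}
    (h : acceptProb V (reduction V Q V.size) (renK stash ψ) ≤ s + e) :
    acceptProb (compile V V.size) Q ψ ≤ 1 - (1 - s) / 16 + |e| := by
  have h₁ := acceptProb_compile_le hV hQ hψ
  have h₂ := acceptProb_le_one (isVerifier_compile hV V.size) hQ hψ
  have h₃ := le_abs_self e
  have h₄ := abs_nonneg e
  rcases le_total s 1 with hs | hs <;> linarith

theorem efficientVerifier_compile {V : List Bool → Party} (hV : EfficientVerifier V) :
    EfficientVerifier fun x => compile (V x) (V x).size :=
  ⟨polyTime_compile hV.1, fun x => isVerifier_compile (hV.2 x) _⟩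

theorem complete_compile {L : PromiseProblem} {V : List Bool → Party} {c : ℕ → ℝ}
    (hV : EfficientVerifier V) (h : Complete L V c) :
    Complete L (fun x => compile (V x) (V x).size) fun n => 1 - (1 - c n) / 2 := by
  obtain ⟨P, hP, h⟩ := h
  refine ⟨fun x => honest (V x) (P x) (V x).size,
    ⟨polyTime_honest hV.1 hP.1, fun x => isProver_honest (hV.2 x) (hP.2 x) _⟩, fun x hx => ?_⟩
  obtain ⟨ψ, hψ, hc⟩ := h x hx
  refine ⟨renK stash ψ, isAdvice_renK_stash hψ, ?_⟩
  rw [acceptProb_honest (hV.2 x) (hP.2 x) hψ]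
  linarith

theorem efficientProver_reduction {V Q : List Bool → Party} (hV : EfficientVerifier V)
    (hQ : EfficientProver Q) : EfficientProver fun x => reduction (V x) (Q x) (V x).size :=
  ⟨polyTime_reduction hV.1 hQ.1, fun x => isProver_reduction (hV.2 x) (hQ.2 x) _⟩

theorem sound_compile {L : PromiseProblem} {V : List Bool → Party} {s : ℕ → ℝ}
    (hV : EfficientVerifier V) (h : Sound L V s) :
    Sound L (fun x => compile (V x) (V x).size) fun n => 1 - (1 - s n) / 16 := by
  intro Q hQ x hx ψ hψ
  have := acceptProb_compile_le_of_le (s := s x.length) (e := 0) (hV.2 x) (hQ.2 x) hψ (by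
    rw [add_zero]
    exact h _ (efficientProver_reduction hV hQ) x hx _ (isAdvice_renK_stash hψ))
  simpa using this

theorem soundUpToNegl_compile {L : PromiseProblem} {V : List Bool → Party} {s : ℕ → ℝ}
    (hV : EfficientVerifier V) (h : SoundUpToNegl L V s) :
    SoundUpToNegl L (fun x => compile (V x) (V x).size) fun n => 1 - (1 - s n) / 16 := by
  intro Q hQ
  obtain ⟨ν, hν, h⟩ := h _ (efficientProver_reduction hV hQ)
  exact ⟨fun n => |ν n|, hν.trans_abs_le fun n => (abs_abs (ν n)).le, fun x hx ψ hψ =>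
    acceptProb_compile_le_of_le (hV.2 x) (hQ.2 x) hψ (h x hx _ (isAdvice_renK_stash hψ))⟩

end QIA

theorem mainTheorem10 (L : QIA.PromiseProblem) (c s : ℕ → ℝ) :
    ((∃ V, QIA.IsArgument L V c s) →
      ∃ V', QIA.IsSingleCoin V' ∧
        QIA.IsArgument L V' (fun n => 1 - (1 - c n) / 2) (fun n => 1 - (1 - s n) / 16)) ∧
    ((∃ V, QIA.IsArgumentUpToNegl L V c s) →
      ∃ V', QIA.IsSingleCoin V' ∧
        QIA.IsArgumentUpToNegl L V' (fun n => 1 - (1 - c n) / 2)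
          (fun n => 1 - (1 - s n) / 16)) :=
  ⟨fun ⟨V, hV, hc, hs⟩ => ⟨fun x => QIA.compile (V x) (V x).size, fun _ => rfl,
      QIA.efficientVerifier_compile hV, QIA.complete_compile hV hc, QIA.sound_compile hV hs⟩,
    fun ⟨V, hV, hc, hs⟩ => ⟨fun x => QIA.compile (V x) (V x).size, fun _ => rfl,
      QIA.efficientVerifier_compile hV, QIA.complete_compile hV hc,
      QIA.soundUpToNegl_compile hV hs⟩⟩
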